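/- Let $n\ge 2$ and let $\mathbb{H}^n\times\mathbb{R}$ carry the product metric $\hat g=\left(\frac{2}{1-|x|^2}\right)^2|dx|^2+dt^2$, with $\mathbb{H}^n$ in the ball model. For $a>0$ let $(I_a,f(a,\cdot))$ be the maximal positive solution of $$f_{tt}=(n-1)\coth(f)\,(1+f_t^2),\qquad f(a,0)=a,\quad f_t(a,0)=0,$$ and let $\mathcal{C}_a$ be the catenoid $\{X(a,t,\xi): t\in I_a,\ \xi\in S^{n-1}\}$, where $X(a,t,\xi)=(\tanh(f(a,t)/2)\,\xi,\;t)$. Its unit normal at $X(a,t,\xi)$ is $N_a=(1+f_t^2)^{-1/2}\left(-\frac{\xi}{2\cosh^2(f/2)},\,f_t\right)$, its Jacobi operator is $J_a=-\Delta-(|A_a|^2+\widehat{\mathrm{Ric}}(N_a,N_a))$, and its variation Jacobi field is $e(a,t)=\hat g(N_a,\partial X/\partial a)$ (it depends on $a$ and $t$ only). For an interval $]\alpha,\beta[$ in $I_a$ put $\mathcal{D}_a(\alpha,\beta)=X(a,]\alpha,\beta[,S^{n-1})$. A relatively compact domain of $\mathcal{C}_a$ is called stable-unstable if the least eigenvalue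 of $J_a$ on it, with Dirichlet boundary condition, is $0$. A curve of a family of plane curves $t\mapsto(x(a,t),y(a,t))$ is said to touch the envelope of the family at its point of parameter $t$ if $x_a y_t-x_t y_a=0$ at $(a,t)$. The catenoid $\mathcal{C}_a$ is said to touch the envelope of the family of catenoids at $X(a,t,\xi)$ if the catenary $t\mapsto(\tanh(f(a,t)/2),t)$ touches the envelope of the family of catenaries at its point of parameter $t$. Then, for every $a>0$, the interval $I_a$ is of the form $]-T(a),T(a)[$ with $0<T(a)<\infty$, the function $f$ is differentiable with respect to $a$ at $(a,t)$ for every $t\in I_a$, and there is $\sigma(a)\in\,]0,T(a)[$ such that: 1. for $\alpha\in\,]0,T(a)[$, the domain $\mathcal{D}_a(-\alpha,\alpha)$ is stable-unstable if and only if $\alpha=\sigma(a)$; 2. the boundary of $\mathcal{D}_a(-\sigma(a),\sigma(a))$ in $\mathcal{C}_a$ consists of the two spheres $X(a,\pm\sigma(a),S^{n-1})$, and the union of these two spheres is exactly the set of points at which $\mathcal{C}_a$ touches the envelope of the family of catenoids; moreover, $\mathcal{D}_a(-\sigma(a),\sigma(a))$ is the only domain $\mathcal{D}_a(-\alpha,\alpha)$,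 $0<\alpha<T(a)$, whose boundary is that set; 3. for $t\in I_a$, $e(a,t)=0$ if and only if $t=\pm\sigma(a)$; in particular, $\sigma(a)$ is the unique positive zero of $e(a,\cdot)$. -/

import Mathlib

open Set Filter Topology

noncomputable section

/-! ### Riemannian geometry on open subsets of `ℝⁿ × ℝ`

A Riemannian metric is given by its coefficients `g p u v`, where `p` is a point and `u`, `v` are
tangent vectors at `p`.  Only points at which `g` is smooth and positive definite matter. -/

/-- The vector space `ℝⁿ × ℝ`; it contains `ℍⁿ × ℝ` (ball model) as the open set `‖x‖ < 1`. -/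
abbrev Amb (n : ℕ) : Type := EuclideanSpace ℝ (Fin n) × ℝ

/-- Christoffel symbols: `christoffel g p u v` is the vector `Γ_p(u, v)` determined by
`2 g(Γ(u, v), w) = ∂_u g(v, w) + ∂_v g(u, w) - ∂_w g(u, v)` for all `w`. -/
def christoffel {n : ℕ} (g : Amb n → Amb n → Amb n → ℝ) (p u v : Amb n) : Amb n :=
  Classical.epsilon fun z : Amb n => ∀ w : Amb n,
    2 * g p z w = fderiv ℝ (fun q => g q v w) p u + fderiv ℝ (fun q => g q u w) p v
      - fderiv ℝ (fun q => g q u v) p w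

/-- The Levi-Civita covariant derivative `∇_w Z` at `p`. -/
def covDeriv {n : ℕ} (g : Amb n → Amb n → Amb n → ℝ) (Z : Amb n → Amb n) (p w : Amb n) : Amb n :=
  fderiv ℝ Z p w + christoffel g p w (Z p)

/-- The curvature tensor `R(u, v)w = ∇_u ∇_v w - ∇_v ∇_u w` (`u`, `v`, `w` extended as constant
vector fields). -/
def curvature {n : ℕ} (g : Amb n → Amb n → Amb n → ℝ) (p u v w : Amb n) : Amb n :=
  covDeriv g (fun q => christoffel g q v w) p u - covDeriv g (fun q => christoffel g q u w) p v

/-- The Ricci curvature `Ric(v, w)`, the trace of `u ↦ R(u, v)w`, in the standard basis. -/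
def ricci {n : ℕ} (g : Amb n → Amb n → Amb n → ℝ) (p v w : Amb n) : ℝ :=
  (∑ i : Fin n, (curvature g p (EuclideanSpace.single i 1, 0) v w).1 i)
    + (curvature g p (0, 1) v w).2

/-- The gradient of a function on the ambient space. -/
def gradAmb {n : ℕ} (g : Amb n → Amb n → Amb n → ℝ) (φ : Amb n → ℝ) (p : Amb n) : Amb n :=
  Classical.epsilon fun z : Amb n => ∀ w : Amb n, g p z w = fderiv ℝ φ p w

/-! ### Hypersurfaces

A hypersurface is a subset `M` of the ambient space, with a unit normal field `N`.  Fields and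
functions along `M` are given by ambient extensions; none of the quantities below depends, at the
points of `M`, on the choice of the extension. -/

/-- `N` is a (differentiable) unit normal field along `M`: at every point it is orthogonal to the
velocities of all curves in `M`. -/
def IsUnitNormal {n : ℕ} (g : Amb n → Amb n → Amb n → ℝ) (M : Set (Amb n))
    (N : Amb n → Amb n) : Prop :=
  ∀ p ∈ M, DifferentiableAt ℝ N p ∧ g p (N p) (N p) = 1 ∧
    ∀ (c : ℝ → Amb n) (w : Amb n), c 0 = p → (∀ᶠ r in 𝓝 (0 : ℝ), c r ∈ M) →
      HasDerivAt c w 0 → g p (N p) w = 0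

/-- A `g`-orthonormal basis of the tangent space `(N p)^⊥` of the hypersurface at `p`
(everything defined from it is independent of the choice). -/
def tangentFrame {n : ℕ} (g : Amb n → Amb n → Amb n → ℝ) (N : Amb n → Amb n) (p : Amb n) :
    Fin n → Amb n :=
  Classical.epsilon fun e : Fin n → Amb n =>
    (∀ i, g p (N p) (e i) = 0) ∧ ∀ i j, g p (e i) (e j) = if i = j then 1 else 0

/-- The gradient on the hypersurface: the tangential part of the ambient gradient. -/
def gradHyp {n : ℕ} (g : Amb n → Amb n → Amb n → ℝ) (N : Amb n → Amb n) (φ : Amb n → ℝ)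
    (p : Amb n) : Amb n :=
  gradAmb g φ p - g p (gradAmb g φ p) (N p) • N p

/-- The Laplacian of the induced metric (the non-positive one), `Δ_M φ = div_M (grad_M φ)`. -/
def laplaceHyp {n : ℕ} (g : Amb n → Amb n → Amb n → ℝ) (N : Amb n → Amb n) (φ : Amb n → ℝ)
    (p : Amb n) : ℝ :=
  ∑ i : Fin n, g p (covDeriv g (gradHyp g N φ) p (tangentFrame g N p i)) (tangentFrame g N p i)

/-- The squared norm `|A|²` of the second fundamental form. -/
def normSqSecondFF {n : ℕ} (g : Amb n → Amb n → Amb n → ℝ) (N : Amb n → Amb n) (p : Amb n) : ℝ :=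
  ∑ i : Fin n, ∑ j : Fin n,
    (g p (covDeriv g N p (tangentFrame g N p i)) (tangentFrame g N p j)) ^ 2

/-- The Jacobi operator `J = -Δ_M - (|A|² + Ric(N, N))`. -/
def jacobiOp {n : ℕ} (g : Amb n → Amb n → Amb n → ℝ) (N : Amb n → Amb n) (φ : Amb n → ℝ)
    (p : Amb n) : ℝ :=
  - laplaceHyp g N φ p - (normSqSecondFF g N p + ricci g p (N p) (N p)) * φ p

/-- The boundary, inside a hypersurface, of a relatively compact relatively open domain. -/
def bdry {n : ℕ} (Ω : Set (Amb n)) : Set (Amb n) := closure Ω \ Ω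

/-- The eigenvalues of the Jacobi operator on the domain `Ω` with Dirichlet boundary condition. -/
def dirichletEigenvalues {n : ℕ} (g : Amb n → Amb n → Amb n → ℝ) (N : Amb n → Amb n)
    (Ω : Set (Amb n)) : Set ℝ :=
  {l | ∃ φ : Amb n → ℝ, (∃ U : Set (Amb n), IsOpen U ∧ Ω ⊆ U ∧ ContDiffOn ℝ 2 φ U) ∧
    ContinuousOn φ (closure Ω) ∧ (∃ p ∈ Ω, φ p ≠ 0) ∧ (∀ p ∈ bdry Ω, φ p = 0) ∧
    ∀ p ∈ Ω, jacobiOp g N φ p = l * φ p}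

/-- The relatively compact domain `Ω` of `M` is stable-unstable: the least Dirichlet eigenvalue of
the Jacobi operator is `0`. -/
def IsStableUnstable {n : ℕ} (g : Amb n → Amb n → Amb n → ℝ) (M : Set (Amb n))
    (N : Amb n → Amb n) (Ω : Set (Amb n)) : Prop :=
  Ω ⊆ M ∧ IsCompact (closure Ω) ∧ closure Ω ⊆ M ∧ IsLeast (dirichletEigenvalues g N Ω) 0

/-! ### Catenoids in `ℍⁿ × ℝ` -/

/-- The product metric `(2 / (1 - |x|²))² |dx|² + dt²` of `ℍⁿ × ℝ`. -/
def hypMetric (n : ℕ) (p u v : Amb n) : ℝ :=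
  (2 / (1 - ‖p.1‖ ^ 2)) ^ 2 * inner ℝ u.1 v.1 + u.2 * v.2

/-- `f` is a (positive) solution on the open interval `I` of the Cauchy problem
`f'' = (n - 1) coth(f) (1 + f'²)`, `f(0) = a`, `f'(0) = 0`. -/
structure IsCatenarySolution (n : ℕ) (a : ℝ) (I : Set ℝ) (f : ℝ → ℝ) : Prop where
  isOpen : IsOpen I
  ordConnected : I.OrdConnected
  zero_mem : (0 : ℝ) ∈ I
  pos : ∀ t ∈ I, 0 < f t
  init : f 0 = a
  init_deriv : deriv f 0 = 0
  differentiable : ∀ t ∈ I, DifferentiableAt ℝ f t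
  ode : ∀ t ∈ I, HasDerivAt (deriv f)
    (((n : ℝ) - 1) * (Real.cosh (f t) / Real.sinh (f t)) * (1 + deriv f t ^ 2)) t

/-- A solution that extends every other one. -/
def IsMaximalCatenarySolution (n : ℕ) (a : ℝ) (I : Set ℝ) (f : ℝ → ℝ) : Prop :=
  IsCatenarySolution n a I f ∧
    ∀ (J : Set ℝ) (h : ℝ → ℝ), IsCatenarySolution n a J h → J ⊆ I ∧ EqOn h f J

/-- The maximal interval `I_a`. -/
def catInterval (n : ℕ) (a : ℝ) : Set ℝ :=
  ⋃₀ {I | ∃ f : ℝ → ℝ, IsCatenarySolution n a I f}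

/-- The maximal solution `f(a, t)`, `t ∈ I_a` (the common value at `t` of all solutions whose
interval contains `t`). -/
def catF (n : ℕ) (a t : ℝ) : ℝ :=
  Classical.epsilon fun ρ : ℝ =>
    ∃ (I : Set ℝ) (f : ℝ → ℝ), IsCatenarySolution n a I f ∧ t ∈ I ∧ f t = ρ

/-- The parametrization `X(a, t, ξ) = (tanh(f(a, t) / 2) ξ, t)`, `|ξ| = 1`. -/
def catX (n : ℕ) (a t : ℝ) (ξ : EuclideanSpace ℝ (Fin n)) : Amb n :=
  (Real.tanh (catF n a t / 2) • ξ, t)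

/-- The rotationally symmetric domain `D_a(α, β) = X(a, ]α, β[, S^{n-1})`. -/
def catDomain (n : ℕ) (a α β : ℝ) : Set (Amb n) :=
  {p | ∃ t ∈ Ioo α β, ∃ ξ : EuclideanSpace ℝ (Fin n), ‖ξ‖ = 1 ∧ p = catX n a t ξ}

/-- The catenoid `𝒞_a`. -/
def catenoid (n : ℕ) (a : ℝ) : Set (Amb n) :=
  {p | ∃ t ∈ catInterval n a, ∃ ξ : EuclideanSpace ℝ (Fin n), ‖ξ‖ = 1 ∧ p = catX n a t ξ}

/-- The sphere `X(a, t, S^{n-1})`. -/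
def catSphere (n : ℕ) (a t : ℝ) : Set (Amb n) :=
  {p | ∃ ξ : EuclideanSpace ℝ (Fin n), ‖ξ‖ = 1 ∧ p = catX n a t ξ}

/-- The unit normal of `𝒞_a`,
`N_a = (1 + f_t²)^{-1/2} (-ξ / (2 cosh²(f / 2)), f_t)` at the point `X(a, t, ξ)`, written as a
function of the point `p = (x, t)`, with `ξ = x / |x|`. -/
def catNormal (n : ℕ) (a : ℝ) (p : Amb n) : Amb n :=
  (1 / Real.sqrt (1 + deriv (catF n a) p.2 ^ 2)) •
    ((-(1 / (2 * Real.cosh (catF n a p.2 / 2) ^ 2)) • ((1 / ‖p.1‖) • p.1), deriv (catF n a) p.2) :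
      Amb n)

/-- The variation Jacobi field `e = ĝ(N_a, ∂X/∂a)` at the point `X(a, t, ξ)`. -/
def variationField (n : ℕ) (a t : ℝ) (ξ : EuclideanSpace ℝ (Fin n)) : ℝ :=
  hypMetric n (catX n a t ξ) (catNormal n a (catX n a t ξ)) (deriv (fun b => catX n b t ξ) a)

/-! ### Envelopes -/

/-- The determinant whose vanishing at `(a, t)` says that, at the point `(x(a, t), y(a, t))`, the
`a`-th curve of the family of plane curves `t ↦ (x(a, t), y(a, t))` touches the envelope of the
family. -/
def envelopeDet (x y : ℝ → ℝ → ℝ) (a t : ℝ) : ℝ :=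
  Matrix.det !![deriv (fun b => x b t) a, deriv (fun s => x a s) t;
                deriv (fun b => y b t) a, deriv (fun s => y a s) t]

/-- The set of points where the catenoid `𝒞_a` touches the envelope of the family of catenoids:
the rotation orbits of the points where the catenary `C_a : t ↦ (tanh(f(a, t) / 2), t)` touches
the envelope of the family of catenaries. -/
def envelopeContact (n : ℕ) (a : ℝ) : Set (Amb n) :=
  {p | ∃ t ∈ catInterval n a, envelopeDet (fun b s => Real.tanh (catF n b s / 2)) (fun _ s => s) a t = 0 ∧
    ∃ ξ : EuclideanSpace ℝ (Fin n), ‖ξ‖ = 1 ∧ p = catX n a t ξ}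

end

/-! Write m = n - 1 and s = arsinh f_t. Along a catenary s increases with t, and the equation has
the first integral sinh f = sinh a (cosh s)^(1/m). The time is then a quadrature, dt/ds = tanh f /
(m cosh s). This speed is positive, even in s and smaller than 1 / (m cosh s), so t(s) maps the line
onto a bounded symmetric interval. That interval is I_a, since every solution has to follow these
formulas (`profSol_unique`).

Differentiating in a at fixed t gives f_a / √(1 + f_t²) = coth a tanh f / cosh s - tanh s · ∂t/∂a,
which is `profVar`. The variation field is its negative, and the envelope determinant is a positive
multiple of it, so both vanish at the same t. As a function of s, `profVar` is even, equals 1 at 0,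
strictly decreases for s > 0 and becomes negative. Hence it has exactly one positive zero, which is
σ in the variable t.

For stability, the Jacobi operator acts on functions of t as w ↦ -(w'' + P w) / (1 + f_t²), with P =
m(m + 1) coth² f - m, and `profVar` solves w'' + P w = 0. So 0 is a Dirichlet eigenvalue for α = σ.
Eigenfunctions are not assumed symmetric or of constant sign, and lower bounds come from the maximum
principle (`notMem_dirichletEigenvalues`): if w(t) is positive on the closed domain and J w > l w
inside, then l is not an eigenvalue, as one sees at a maximum of φ / w. A suitable w rules out every
l < 0 when α = σ, and another rules out l = 0 when α < σ. When α > σ, a shooting argument in l, made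
continuous by the Prüfer angle, produces a negative eigenvalue.

The geometric part computes the connection and curvature of ℍⁿ × ℝ in closed form, then the
principal curvatures of a hypersurface of revolution. Minimality removes the normal derivative from
the Laplacian, and at a point of contact the Laplacian is controlled through curves lying in the
hypersurface. -/

noncomputable section

/-! ### The catenary parametrized by `s = arsinh f_t` -/

/-- The ratio `sinh f / sinh a` on a catenary, as a function of `s = arsinh f_t`. -/
def profRatio (m s : ℝ) : ℝ := Real.exp (Real.log (Real.cosh s) / m)

/-- The solution `f` as a function of `s = arsinh f_t`. -/
def profF (m a s : ℝ) : ℝ := Real.arsinh (Real.sinh a * profRatio m s)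

/-- The derivative of `t` with respect to `s = arsinh f_t`. -/
def profSpeed (m a s : ℝ) : ℝ := Real.tanh (profF m a s) / (m * Real.cosh s)

/-- The variable `t` as a function of `s = arsinh f_t`. -/
def profTime (m a s : ℝ) : ℝ := ∫ r in (0 : ℝ)..s, profSpeed m a r

lemma hasDerivAt_tanh (x : ℝ) : HasDerivAt Real.tanh (1 / Real.cosh x ^ 2) x := by
  have h := (Real.hasDerivAt_sinh x).div (Real.hasDerivAt_cosh x) (Real.cosh_pos x).ne'
  have e : (Real.sinh / Real.cosh) = Real.tanh := by
    ext y; rw [Pi.div_apply, Real.tanh_eq_sinh_div_cosh]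
  rw [e] at h
  refine h.congr_deriv ?_
  rw [← sq, ← sq, Real.cosh_sq]
  ring

lemma profRatio_pos (m s : ℝ) : 0 < profRatio m s := Real.exp_pos _

lemma profRatio_zero (m : ℝ) : profRatio m 0 = 1 := by simp [profRatio]

lemma profRatio_neg (m s : ℝ) : profRatio m (-s) = profRatio m s := by simp [profRatio]

lemma profF_neg (m a s : ℝ) : profF m a (-s) = profF m a s := by simp [profF, profRatio_neg]

lemma profF_zero (m a : ℝ) : profF m a 0 = a := by simp [profF, profRatio_zero]

lemma sinh_profF (m a s : ℝ) : Real.sinh (profF m a s) = Real.sinh a * profRatio m s :=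
  Real.sinh_arsinh _

lemma profF_pos {m a : ℝ} (ha : 0 < a) (s : ℝ) : 0 < profF m a s := by
  rw [← Real.sinh_pos_iff, sinh_profF]
  exact mul_pos (Real.sinh_pos_iff.2 ha) (profRatio_pos m s)

lemma tanh_pos {x : ℝ} (hx : 0 < x) : 0 < Real.tanh x := by
  rw [Real.tanh_eq_sinh_div_cosh]
  exact div_pos (Real.sinh_pos_iff.2 hx) (Real.cosh_pos x)

lemma tanh_lt_one' (x : ℝ) : Real.tanh x < 1 := by
  rw [Real.tanh_eq_sinh_div_cosh, div_lt_one (Real.cosh_pos x)]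
  exact Real.sinh_lt_cosh x

lemma hasDerivAt_profRatio (m s : ℝ) :
    HasDerivAt (profRatio m) (profRatio m s * (Real.tanh s / m)) s := by
  have h := (((Real.hasDerivAt_cosh s).log (Real.cosh_pos s).ne').div_const m).exp
  rwa [← Real.tanh_eq_sinh_div_cosh] at h

lemma hasDerivAt_profF (m a s : ℝ) :
    HasDerivAt (profF m a) (Real.tanh (profF m a s) * Real.tanh s / m) s := by
  have h := ((hasDerivAt_profRatio m s).const_mul (Real.sinh a)).arsinh
  refine h.congr_deriv ?_
  rw [profF, Real.tanh_arsinh, smul_eq_mul]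
  ring

lemma hasDerivAt_profF_param {m a : ℝ} (ha : 0 < a) (s : ℝ) :
    HasDerivAt (fun b => profF m b s)
      (Real.cosh a / Real.sinh a * Real.tanh (profF m a s)) a := by
  have h := ((Real.hasDerivAt_sinh a).mul_const (profRatio m s)).arsinh
  refine h.congr_deriv ?_
  have := (Real.sinh_pos_iff.2 ha).ne'
  rw [profF, Real.tanh_arsinh, smul_eq_mul]
  field_simp

lemma continuous_profF (m : ℝ) : Continuous fun p : ℝ × ℝ => profF m p.1 p.2 := by
  unfold profF profRatio
  refine Real.continuous_arsinh.comp ((Real.continuous_sinh.comp continuous_fst).mul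
    (Real.continuous_exp.comp (Continuous.div_const (Continuous.log ?_ ?_) m)))
  · exact Real.continuous_cosh.comp continuous_snd
  · exact fun p => (Real.cosh_pos p.2).ne'

lemma continuous_tanh : Continuous Real.tanh :=
  continuous_iff_continuousAt.2 fun x => (hasDerivAt_tanh x).continuousAt

lemma continuous_profSpeed {m : ℝ} (hm : 0 < m) :
    Continuous fun p : ℝ × ℝ => profSpeed m p.1 p.2 := by
  unfold profSpeed
  refine (continuous_tanh.comp (continuous_profF m)).div (by fun_prop) fun p => ?_
  exact (mul_pos hm (Real.cosh_pos _)).ne'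

lemma profSpeed_pos {m a : ℝ} (hm : 0 < m) (ha : 0 < a) (s : ℝ) : 0 < profSpeed m a s :=
  div_pos (tanh_pos (profF_pos ha s)) (mul_pos hm (Real.cosh_pos s))

lemma profSpeed_neg (m a s : ℝ) : profSpeed m a (-s) = profSpeed m a s := by
  simp [profSpeed, profF_neg]

lemma hasDerivAt_profTime {m : ℝ} (hm : 0 < m) (a s : ℝ) :
    HasDerivAt (profTime m a) (profSpeed m a s) s := by
  have hc : Continuous fun r => profSpeed m a r :=
    Continuous.comp (g := fun p : ℝ × ℝ => profSpeed m p.1 p.2) (f := fun r => (a, r))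
      (continuous_profSpeed hm) (by fun_prop)
  unfold profTime
  exact intervalIntegral.integral_hasDerivAt_right (hc.intervalIntegrable _ _)
    (hc.stronglyMeasurableAtFilter _ _) hc.continuousAt

lemma profTime_zero (m a : ℝ) : profTime m a 0 = 0 := by simp [profTime]

lemma profTime_neg (m a s : ℝ) : profTime m a (-s) = - profTime m a s := by
  unfold profTime
  rw [intervalIntegral.integral_symm]
  congr 1
  have := intervalIntegral.integral_comp_neg (a := 0) (b := s) (fun r => profSpeed m a r)
  simpa [profSpeed_neg] using this.symm

lemma continuous_profTime {m : ℝ} (hm : 0 < m) (a : ℝ) : Continuous (profTime m a) :=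
  continuous_iff_continuousAt.2 fun s => (hasDerivAt_profTime hm a s).continuousAt

lemma strictMono_profTime {m a : ℝ} (hm : 0 < m) (ha : 0 < a) : StrictMono (profTime m a) :=
  strictMono_of_deriv_pos fun s => by
    rw [(hasDerivAt_profTime hm a s).deriv]
    exact profSpeed_pos hm ha s

/-! ### Boundedness and symmetry of the range of the time function -/

lemma profTime_le {m a : ℝ} (hm : 0 < m) (s : ℝ) (hs : 0 ≤ s) :
    profTime m a s ≤ Real.pi / 2 / m := by
  have hd : ∀ x, HasDerivAt (fun x => Real.arctan (Real.sinh x) / m - profTime m a x)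
      (1 / (1 + Real.sinh x ^ 2) * Real.cosh x / m - profSpeed m a x) x := fun x =>
    (((Real.hasDerivAt_sinh x).arctan).div_const m).sub (hasDerivAt_profTime hm a x)
  -- The function arctan(sinh x) has derivative 1 / cosh x, and the speed is tanh f times 1 / (m
  -- cosh x) with tanh f < 1.
  have hmono : Monotone (fun x => Real.arctan (Real.sinh x) / m - profTime m a x) := by
    refine monotone_of_deriv_nonneg (fun x => (hd x).differentiableAt) fun x => ?_
    rw [(hd x).deriv, add_comm, ← Real.cosh_sq, profSpeed, sub_nonneg]
    rw [div_le_iff₀ (by positivity)]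
    have : 1 / Real.cosh x ^ 2 * Real.cosh x / m * (m * Real.cosh x) = 1 := by field_simp
    rw [this]
    exact (tanh_lt_one' _).le
  have h := hmono hs
  simp only [Real.sinh_zero, Real.arctan_zero, zero_div, profTime_zero, sub_zero] at h
  have h2 : Real.arctan (Real.sinh s) / m ≤ Real.pi / 2 / m := by
    gcongr
    exact (Real.arctan_lt_pi_div_two _).le
  linarith

/-- Half the length of the maximal interval. -/
def profHeight (m a : ℝ) : ℝ := sSup (range (profTime m a))

lemma bddAbove_profTime {m a : ℝ} (hm : 0 < m) (ha : 0 < a) :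
    BddAbove (range (profTime m a)) := by
  refine ⟨Real.pi / 2 / m, ?_⟩
  rintro _ ⟨s, rfl⟩
  rcases le_total 0 s with h | h
  · exact profTime_le hm s h
  · have := (strictMono_profTime hm ha).monotone h
    rw [profTime_zero] at this
    have : 0 ≤ Real.pi / 2 / m := by positivity
    linarith

lemma profTime_lt {m a : ℝ} (hm : 0 < m) (ha : 0 < a) (s : ℝ) :
    profTime m a s < profHeight m a :=
  ((strictMono_profTime hm ha) (lt_add_one s)).trans_le
    (le_csSup (bddAbove_profTime hm ha) ⟨s + 1, rfl⟩)

lemma profHeight_pos {m a : ℝ} (hm : 0 < m) (ha : 0 < a) : 0 < profHeight m a := by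
  simpa [profTime_zero] using profTime_lt hm ha 0

lemma range_profTime {m a : ℝ} (hm : 0 < m) (ha : 0 < a) :
    range (profTime m a) = Ioo (-profHeight m a) (profHeight m a) := by
  apply Subset.antisymm
  · rintro _ ⟨s, rfl⟩
    refine ⟨?_, profTime_lt hm ha s⟩
    have := profTime_lt hm ha (-s)
    rw [profTime_neg] at this
    linarith
  · intro t ht
    have aux : ∀ t < profHeight m a, ∃ s, t < profTime m a s := fun t ht => by
      obtain ⟨_, ⟨s, rfl⟩, h⟩ := exists_lt_of_lt_csSup (range_nonempty _) ht
      exact ⟨s, h⟩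
    obtain ⟨s₂, h₂⟩ := aux t ht.2
    obtain ⟨s₁, h₁⟩ := aux (-t) (by linarith [ht.1])
    have h₁' : profTime m a (-s₁) < t := by rw [profTime_neg]; linarith
    exact mem_range_of_exists_le_of_exists_ge (continuous_profTime hm a) ⟨_, h₁'.le⟩ ⟨_, h₂.le⟩

/-- The inverse of `profTime`: the value of `s = arsinh f_t` as a function of `t`. -/
def profInv (m a : ℝ) : ℝ → ℝ := Function.invFun (profTime m a)

lemma profInv_profTime {m a : ℝ} (hm : 0 < m) (ha : 0 < a) (s : ℝ) :
    profInv m a (profTime m a s) = s :=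
  Function.leftInverse_invFun (strictMono_profTime hm ha).injective s

lemma profTime_profInv {m a t : ℝ} (hm : 0 < m) (ha : 0 < a)
    (ht : t ∈ Ioo (-profHeight m a) (profHeight m a)) : profTime m a (profInv m a t) = t :=
  Function.invFun_eq (by rw [← range_profTime hm ha] at ht; exact ht)

lemma profInv_zero {m a : ℝ} (hm : 0 < m) (ha : 0 < a) : profInv m a 0 = 0 := by
  simpa [profTime_zero] using profInv_profTime hm ha 0

lemma neg_mem_Ioo {T t : ℝ} (ht : t ∈ Ioo (-T) T) : -t ∈ Ioo (-T) T :=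
  ⟨by linarith [ht.2], by linarith [ht.1]⟩

lemma profInv_neg {m a t : ℝ} (hm : 0 < m) (ha : 0 < a)
    (ht : t ∈ Ioo (-profHeight m a) (profHeight m a)) : profInv m a (-t) = -profInv m a t := by
  apply (strictMono_profTime hm ha).injective
  rw [profTime_profInv hm ha (neg_mem_Ioo ht), profTime_neg, profTime_profInv hm ha ht]

lemma profInv_lt_profInv {m a t t' : ℝ} (hm : 0 < m) (ha : 0 < a)
    (ht : t ∈ Ioo (-profHeight m a) (profHeight m a))
    (ht' : t' ∈ Ioo (-profHeight m a) (profHeight m a)) (h : t < t') :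
    profInv m a t < profInv m a t' := by
  rw [← (strictMono_profTime hm ha).lt_iff_lt, profTime_profInv hm ha ht,
    profTime_profInv hm ha ht']
  exact h

lemma continuousAt_profInv {m a t : ℝ} (hm : 0 < m) (ha : 0 < a)
    (ht : t ∈ Ioo (-profHeight m a) (profHeight m a)) : ContinuousAt (profInv m a) t := by
  rw [Metric.continuousAt_iff]
  intro ε hε
  set s := profInv m a t
  have h₁ : profTime m a (s - ε) < t := by
    conv_rhs => rw [← profTime_profInv hm ha ht]
    exact strictMono_profTime hm ha (by linarith)
  have h₂ : t < profTime m a (s + ε) := by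
    conv_lhs => rw [← profTime_profInv hm ha ht]
    exact strictMono_profTime hm ha (by linarith)
  have hn : ∀ᶠ y in 𝓝 t, dist (profInv m a y) s < ε := by
    filter_upwards [Ioo_mem_nhds h₁ h₂, Ioo_mem_nhds ht.1 ht.2] with y hy hy'
    rw [← profTime_profInv hm ha hy', mem_Ioo, (strictMono_profTime hm ha).lt_iff_lt,
      (strictMono_profTime hm ha).lt_iff_lt] at hy
    rw [Real.dist_eq, abs_lt]
    constructor <;> linarith [hy.1, hy.2]
  exact Metric.eventually_nhds_iff.1 hn

lemma hasDerivAt_profInv {m a t : ℝ} (hm : 0 < m) (ha : 0 < a)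
    (ht : t ∈ Ioo (-profHeight m a) (profHeight m a)) :
    HasDerivAt (profInv m a) (m * Real.cosh (profInv m a t) *
      (Real.cosh (profF m a (profInv m a t)) / Real.sinh (profF m a (profInv m a t)))) t := by
  have h := HasDerivAt.of_local_left_inverse (continuousAt_profInv hm ha ht)
    (hasDerivAt_profTime hm a _) (profSpeed_pos hm ha _).ne'
    (by filter_upwards [Ioo_mem_nhds ht.1 ht.2] with y hy using profTime_profInv hm ha hy)
  refine h.congr_deriv ?_
  rw [profSpeed, Real.tanh_eq_sinh_div_cosh]
  have := Real.sinh_pos_iff.2 (profF_pos (m := m) ha (profInv m a t))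
  have := Real.cosh_pos (profF m a (profInv m a t))
  have := Real.cosh_pos (profInv m a t)
  field_simp

/-- The solution `f(a, t)`. -/
def profSol (m a t : ℝ) : ℝ := profF m a (profInv m a t)

lemma hasDerivAt_profSol {m a t : ℝ} (hm : 0 < m) (ha : 0 < a)
    (ht : t ∈ Ioo (-profHeight m a) (profHeight m a)) :
    HasDerivAt (profSol m a) (Real.sinh (profInv m a t)) t := by
  have h := (hasDerivAt_profF m a (profInv m a t)).comp t (hasDerivAt_profInv hm ha ht)
  refine h.congr_deriv ?_
  rw [Real.tanh_eq_sinh_div_cosh, Real.tanh_eq_sinh_div_cosh]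
  have := Real.sinh_pos_iff.2 (profF_pos (m := m) ha (profInv m a t))
  have := Real.cosh_pos (profF m a (profInv m a t))
  have := Real.cosh_pos (profInv m a t)
  field_simp

lemma hasDerivAt_sinh_profInv {m a t : ℝ} (hm : 0 < m) (ha : 0 < a)
    (ht : t ∈ Ioo (-profHeight m a) (profHeight m a)) :
    HasDerivAt (fun t => Real.sinh (profInv m a t))
      (m * (Real.cosh (profSol m a t) / Real.sinh (profSol m a t)) *
        (1 + Real.sinh (profInv m a t) ^ 2)) t := by
  have h := (hasDerivAt_profInv hm ha ht).sinh
  refine h.congr_deriv ?_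
  rw [add_comm, ← Real.cosh_sq, profSol]
  ring

/-- A solution `h` of the catenary equation agrees with `profSol`, and its interval is contained
in the range of `profTime`. -/
lemma profSol_unique {m a : ℝ} (hm : 0 < m) (ha : 0 < a) {I : Set ℝ} {h h' : ℝ → ℝ}
    (hI : IsOpen I) (hc : I.OrdConnected) (h0 : (0 : ℝ) ∈ I) (hpos : ∀ t ∈ I, 0 < h t)
    (hinit : h 0 = a) (hinit' : h' 0 = 0) (hd : ∀ t ∈ I, HasDerivAt h (h' t) t)
    (hd' : ∀ t ∈ I, HasDerivAt h' (m * (Real.cosh (h t) / Real.sinh (h t)) * (1 + h' t ^ 2)) t) :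
    I ⊆ Ioo (-profHeight m a) (profHeight m a) ∧ EqOn h (profSol m a) I := by
  have hpc : IsPreconnected I := isPreconnected_iff_ordConnected.2 hc
  -- First integrals: a function with zero derivative on the interval keeps its value at 0. This is
  -- applied to the energy and then to the time.
  have hconst : ∀ (k k' : ℝ → ℝ), (∀ t ∈ I, HasDerivAt k (k' t) t) → (∀ t ∈ I, k' t = 0) →
      ∀ t ∈ I, k t = k 0 := fun k k' hk hk' t ht =>
    hI.is_const_of_deriv_eq_zero hpc
      (fun x hx => (hk x hx).differentiableAt.differentiableWithinAt)
      (fun x hx => by rw [(hk x hx).deriv, hk' x hx]; rfl) ht h0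
  set s : ℝ → ℝ := fun t => Real.arsinh (h' t) with hs
  have hss : ∀ t, Real.sinh (s t) = h' t := fun t => Real.sinh_arsinh _
  have hcs : ∀ t, Real.cosh (s t) = √(1 + h' t ^ 2) := fun t => Real.cosh_arsinh _
  have hsd : ∀ t ∈ I, HasDerivAt s (m * (Real.cosh (h t) / Real.sinh (h t)) * Real.cosh (s t)) t := by
    intro t ht
    refine (hd' t ht).arsinh.congr_deriv ?_
    rw [← hcs, smul_eq_mul, ← hss, add_comm, ← Real.cosh_sq]
    have := Real.cosh_pos (s t)
    field_simp
  -- Conservation of log sinh f - (log cosh s) / m, whose value at t = 0 is log sinh a.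
  have hen : ∀ t ∈ I, h t = profF m a (s t) := by
    have hk := hconst (fun t => Real.log (Real.sinh (h t)) - Real.log (Real.cosh (s t)) / m)
      _ (fun t ht => (((hd t ht).sinh).log (Real.sinh_pos_iff.2 (hpos t ht)).ne').sub
        ((((hsd t ht).cosh).log (Real.cosh_pos _).ne').div_const m)) (fun t ht => by
          rw [hss]
          have := Real.sinh_pos_iff.2 (hpos t ht)
          have := Real.cosh_pos (s t)
          field_simp
          ring)
    intro t ht
    have := hk t ht
    simp only [hs, hinit, hinit', Real.arsinh_zero, Real.cosh_zero, Real.log_one, zero_div,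
      sub_zero] at this
    rw [← Real.sinh_inj, sinh_profF, profRatio,
      ← Real.exp_log (Real.sinh_pos_iff.2 (hpos t ht)), ← Real.exp_log (Real.sinh_pos_iff.2 ha),
      ← Real.exp_add, ← this]
    simp [hs]
  -- Once f is known as a function of s, the composite `profTime` ∘ s has derivative 1 in t, so it
  -- is t itself. This confines t to the range of `profTime`.
  have htime : ∀ t ∈ I, profTime m a (s t) = t := by
    have hk := hconst (fun t => profTime m a (s t) - t) _
      (fun t ht => ((hasDerivAt_profTime hm a (s t)).comp t (hsd t ht)).sub (hasDerivAt_id t))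
      (fun t ht => by
        rw [profSpeed, ← hen t ht, Real.tanh_eq_sinh_div_cosh]
        have := Real.sinh_pos_iff.2 (hpos t ht)
        have := Real.cosh_pos (h t)
        have := Real.cosh_pos (s t)
        field_simp
        ring)
    intro t ht
    have := hk t ht
    simp only [hs, hinit', Real.arsinh_zero, profTime_zero, sub_zero] at this
    linarith
  refine ⟨fun t ht => ?_, fun t ht => ?_⟩
  · rw [← range_profTime hm ha, ← htime t ht]
    exact mem_range_self _
  · rw [hen t ht, profSol]
    congr 1
    rw [← profInv_profTime hm ha (s t), htime t ht]

/-! ### Dependence on the parameter `a` -/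

/-- The derivative of `profSpeed` with respect to `a`. -/
def profSpeedParam (m a s : ℝ) : ℝ :=
  1 / Real.cosh (profF m a s) ^ 2 * (Real.cosh a / Real.sinh a * Real.tanh (profF m a s)) /
    (m * Real.cosh s)

/-- The derivative of `profTime` with respect to `a`. -/
def profTimeParam (m a s : ℝ) : ℝ := ∫ r in (0 : ℝ)..s, profSpeedParam m a r

/-- The Jacobi field `f_a / √(1 + f_t²)` as a function of `s = arsinh f_t`. -/
def profVar (m a s : ℝ) : ℝ :=
  Real.cosh a / Real.sinh a * Real.tanh (profF m a s) / Real.cosh s -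
    Real.tanh s * profTimeParam m a s

lemma hasDerivAt_profSpeed_param {m a : ℝ} (ha : 0 < a) (s : ℝ) :
    HasDerivAt (fun b => profSpeed m b s) (profSpeedParam m a s) a :=
  (HasDerivAt.comp a (hasDerivAt_tanh (profF m a s)) (hasDerivAt_profF_param ha s)).div_const
    (m * Real.cosh s)

lemma continuous_profSpeedParam {m : ℝ} (hm : 0 < m) (a : ℝ) :
    Continuous fun s => profSpeedParam m a s := by
  have hF : Continuous fun s => profF m a s :=
    continuous_iff_continuousAt.2 fun s => (hasDerivAt_profF m a s).continuousAt
  unfold profSpeedParam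
  have h1 : ∀ s, Real.cosh (profF m a s) ^ 2 ≠ 0 := fun s => pow_ne_zero _ (Real.cosh_pos _).ne'
  have h2 : ∀ s, m * Real.cosh s ≠ 0 := fun s => (mul_pos hm (Real.cosh_pos s)).ne'
  refine Continuous.div (Continuous.mul (Continuous.div continuous_const
    ((Real.continuous_cosh.comp hF).pow 2) h1) (continuous_const.mul (continuous_tanh.comp hF)))
    (continuous_const.mul Real.continuous_cosh) h2

lemma profSpeedParam_pos {m a : ℝ} (hm : 0 < m) (ha : 0 < a) (s : ℝ) :
    0 < profSpeedParam m a s := by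
  have := Real.cosh_pos (profF m a s)
  have := Real.cosh_pos a
  have := Real.sinh_pos_iff.2 ha
  have := tanh_pos (profF_pos (m := m) ha s)
  have := Real.cosh_pos s
  unfold profSpeedParam
  positivity

lemma profSpeedParam_neg (m a s : ℝ) : profSpeedParam m a (-s) = profSpeedParam m a s := by
  simp [profSpeedParam, profF_neg]

lemma hasDerivAt_profTimeParam {m : ℝ} (hm : 0 < m) (a s : ℝ) :
    HasDerivAt (profTimeParam m a) (profSpeedParam m a s) s := by
  have hc := continuous_profSpeedParam hm a
  unfold profTimeParam
  exact intervalIntegral.integral_hasDerivAt_right (hc.intervalIntegrable _ _)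
    (hc.stronglyMeasurableAtFilter _ _) hc.continuousAt

lemma profTimeParam_zero (m a : ℝ) : profTimeParam m a 0 = 0 := by simp [profTimeParam]

lemma profTimeParam_neg (m a s : ℝ) : profTimeParam m a (-s) = -profTimeParam m a s := by
  unfold profTimeParam
  rw [intervalIntegral.integral_symm]
  congr 1
  have := intervalIntegral.integral_comp_neg (a := 0) (b := s) (fun r => profSpeedParam m a r)
  simpa [profSpeedParam_neg] using this.symm

lemma strictMono_profTimeParam {m a : ℝ} (hm : 0 < m) (ha : 0 < a) :
    StrictMono (profTimeParam m a) :=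
  strictMono_of_deriv_pos fun s => by
    rw [(hasDerivAt_profTimeParam hm a s).deriv]
    exact profSpeedParam_pos hm ha s

/-- Differentiation under the integral sign. For b in ]a/2, 2a[ the integrand's derivative is
dominated by a constant, because coth b ≤ cosh(2a) / sinh(a/2) and the factors 1 / cosh², tanh and 1
/ cosh are at most 1. -/
lemma hasDerivAt_profTime_param {m a : ℝ} (hm : 0 < m) (ha : 0 < a) (s : ℝ) :
    HasDerivAt (fun b => profTime m b s) (profTimeParam m a s) a := by
  have hc : ∀ b, Continuous fun r => profSpeed m b r := fun b =>
    Continuous.comp (g := fun p : ℝ × ℝ => profSpeed m p.1 p.2) (f := fun r => (b, r))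
      (continuous_profSpeed hm) (by fun_prop)
  refine (intervalIntegral.hasDerivAt_integral_of_dominated_loc_of_deriv_le
    (F := fun b r => profSpeed m b r) (F' := fun b r => profSpeedParam m b r)
    (s := Ioo (a / 2) (2 * a)) (bound := fun _ => Real.cosh (2 * a) / Real.sinh (a / 2) / m)
    (Ioo_mem_nhds (by linarith) (by linarith))
    (Eventually.of_forall fun b => (hc b).aestronglyMeasurable)
    ((hc a).intervalIntegrable _ _) (continuous_profSpeedParam hm a).aestronglyMeasurable
    (Eventually.of_forall fun r _ b hb => ?_) intervalIntegrable_const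
    (Eventually.of_forall fun r _ b hb =>
      hasDerivAt_profSpeed_param (by linarith [hb.1] : 0 < b) r)).2
  have hb0 : 0 < b := by linarith [hb.1]
  rw [Real.norm_of_nonneg (profSpeedParam_pos hm hb0 r).le, profSpeedParam]
  have h1 : 1 / Real.cosh (profF m b r) ^ 2 ≤ 1 := by
    rw [div_le_one (by positivity)]
    exact one_le_pow₀ (Real.one_le_cosh _)
  have h2 : Real.cosh b / Real.sinh b ≤ Real.cosh (2 * a) / Real.sinh (a / 2) := by
    have := Real.cosh_pos (2 * a)
    have h3 : 0 < Real.sinh (a / 2) := Real.sinh_pos_iff.2 (by linarith)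
    have h4 : Real.sinh (a / 2) ≤ Real.sinh b := Real.sinh_le_sinh.2 hb.1.le
    have h5 : Real.cosh b ≤ Real.cosh (2 * a) :=
      Real.cosh_le_cosh.2 (by rw [abs_of_pos hb0, abs_of_pos (by linarith)]; exact hb.2.le)
    gcongr
  have h3 := tanh_pos (profF_pos (m := m) hb0 r)
  have h4 := tanh_lt_one' (profF m b r)
  have h5 : 0 < Real.cosh b / Real.sinh b :=
    div_pos (Real.cosh_pos _) (Real.sinh_pos_iff.2 hb0)
  have h6 : m ≤ m * Real.cosh r := le_mul_of_one_le_right hm.le (Real.one_le_cosh r)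
  have h7 : 1 / Real.cosh (profF m b r) ^ 2 *
      (Real.cosh b / Real.sinh b * Real.tanh (profF m b r)) ≤
      1 * (Real.cosh (2 * a) / Real.sinh (a / 2) * 1) := by
    gcongr
  rw [one_mul, mul_one] at h7
  gcongr

lemma exists_mem_uIcc_sub_eq_mul {f f' : ℝ → ℝ} (hf : ∀ x, HasDerivAt f (f' x) x) (x y : ℝ) :
    ∃ z ∈ uIcc x y, f y - f x = f' z * (y - x) := by
  have hcont : Continuous f := continuous_iff_continuousAt.2 fun x => (hf x).continuousAt
  rcases lt_trichotomy x y with h | rfl | h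
  · obtain ⟨z, hz, he⟩ := exists_hasDerivAt_eq_slope f f' h hcont.continuousOn fun x _ => hf x
    refine ⟨z, by rw [uIcc_of_le h.le]; exact Ioo_subset_Icc_self hz, ?_⟩
    rw [he, div_mul_cancel₀ _ (by linarith)]
  · exact ⟨x, by simp, by simp⟩
  · obtain ⟨z, hz, he⟩ := exists_hasDerivAt_eq_slope f f' h hcont.continuousOn fun x _ => hf x
    refine ⟨z, by rw [uIcc_of_ge h.le]; exact Ioo_subset_Icc_self hz, ?_⟩
    rw [he, ← neg_sub x y, mul_neg, div_mul_cancel₀ _ (by linarith)]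
    ring

/-- The strict inequalities t(s - δ) < t < t(s + δ) survive a small change of the parameter, and
monotonicity in s then traps the root. In particular t stays in the maximal interval of all nearby
parameters. -/
lemma eventually_profTime_param_mem {m a t : ℝ} (hm : 0 < m) (ha : 0 < a)
    (ht : t ∈ Ioo (-profHeight m a) (profHeight m a)) {δ : ℝ} (hδ : 0 < δ) :
    ∀ᶠ b in 𝓝 a, profTime m b (profInv m b t) = t ∧ dist (profInv m b t) (profInv m a t) < δ := by
  set s := profInv m a t
  have h₁ : profTime m a (s - δ) < t := by
    conv_rhs => rw [← profTime_profInv hm ha ht]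
    exact strictMono_profTime hm ha (by linarith)
  have h₂ : t < profTime m a (s + δ) := by
    conv_lhs => rw [← profTime_profInv hm ha ht]
    exact strictMono_profTime hm ha (by linarith)
  filter_upwards [(hasDerivAt_profTime_param hm ha (s - δ)).continuousAt.eventually_lt_const h₁,
    (hasDerivAt_profTime_param hm ha (s + δ)).continuousAt.eventually_const_lt h₂,
    eventually_gt_nhds ha] with b hb₁ hb₂ hb
  have hr : t ∈ range (profTime m b) :=
    mem_range_of_exists_le_of_exists_ge (continuous_profTime hm b) ⟨_, hb₁.le⟩ ⟨_, hb₂.le⟩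
  rw [range_profTime hm hb] at hr
  have he := profTime_profInv hm hb hr
  refine ⟨he, ?_⟩
  rw [← he, (strictMono_profTime hm hb).lt_iff_lt] at hb₁ hb₂
  rw [Real.dist_eq, abs_lt]
  constructor <;> linarith

lemma continuousAt_profInv_param {m a t : ℝ} (hm : 0 < m) (ha : 0 < a)
    (ht : t ∈ Ioo (-profHeight m a) (profHeight m a)) :
    ContinuousAt (fun b => profInv m b t) a :=
  Metric.tendsto_nhds.2 fun _ hδ =>
    (eventually_profTime_param_mem hm ha ht hδ).mono fun _ h => h.2

/-- Implicit differentiation of `profTime m b (profInv m b t) = t`. The mean value theorem in s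
gives s_b - s = (t - t_b(s)) / speed_b(ζ) with ζ between s and s_b; then ζ → s, and joint continuity
of the speed gives the limit of the slopes. -/
lemma hasDerivAt_profInv_param {m a t : ℝ} (hm : 0 < m) (ha : 0 < a)
    (ht : t ∈ Ioo (-profHeight m a) (profHeight m a)) :
    HasDerivAt (fun b => profInv m b t)
      (-profTimeParam m a (profInv m a t) / profSpeed m a (profInv m a t)) a := by
  set s := profInv m a t with hs
  choose ζ hζ he using fun b =>
    exists_mem_uIcc_sub_eq_mul (fun x => hasDerivAt_profTime hm b x) s (profInv m b t)
  have hζt : Tendsto ζ (𝓝 a) (𝓝 s) := by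
    rw [tendsto_iff_dist_tendsto_zero]
    have hc := (continuousAt_profInv_param hm ha ht)
    rw [ContinuousAt, tendsto_iff_dist_tendsto_zero] at hc
    refine squeeze_zero (fun _ => dist_nonneg) (fun b => ?_) hc
    rw [Real.dist_eq, Real.dist_eq]
    exact abs_sub_left_of_mem_uIcc (hζ b)
  have hg : Tendsto (fun b => profSpeed m b (ζ b)) (𝓝 a) (𝓝 (profSpeed m a s)) :=
    Tendsto.comp (g := fun p : ℝ × ℝ => profSpeed m p.1 p.2) (f := fun b => (b, ζ b))
      (y := 𝓝 (a, s)) ((continuous_profSpeed hm).tendsto (a, s)) (tendsto_id.prodMk_nhds hζt)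
  have hsl := (hasDerivAt_iff_tendsto_slope.1 (hasDerivAt_profTime_param hm ha s))
  rw [hasDerivAt_iff_tendsto_slope]
  refine ((hsl.neg).div (hg.mono_left nhdsWithin_le_nhds) (profSpeed_pos hm ha s).ne').congr' ?_
  filter_upwards [((eventually_profTime_param_mem hm ha ht one_pos).and
    (eventually_gt_nhds ha)).filter_mono nhdsWithin_le_nhds] with b hb
  have hpos := profSpeed_pos hm hb.2 (ζ b)
  have hea : profTime m a s = t := profTime_profInv hm ha ht
  have h1 := he b
  rw [hb.1.1] at h1
  have h2 : profInv m b t - s = (t - profTime m b s) / profSpeed m b (ζ b) := by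
    rw [h1]; field_simp
  simp only [Pi.div_apply, slope_def_field, ← hs]
  rw [h2, hea]
  ring

/-- Chain rule for f(b, t) = F(b, s(b, t)): the speed in the derivative of s cancels the factor tanh
F in F_s, leaving f_a = coth a tanh f - sinh s · ∂t/∂a. -/
lemma hasDerivAt_profSol_param {m a t : ℝ} (hm : 0 < m) (ha : 0 < a)
    (ht : t ∈ Ioo (-profHeight m a) (profHeight m a)) :
    HasDerivAt (fun b => profSol m b t)
      (Real.cosh (profInv m a t) * profVar m a (profInv m a t)) a := by
  have h := (((Real.hasDerivAt_sinh a).mul (HasDerivAt.comp a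
    (hasDerivAt_profRatio m (profInv m a t)) (hasDerivAt_profInv_param hm ha ht))).arsinh)
  refine h.congr_deriv ?_
  set s := profInv m a t with hs
  have h3 := profRatio_pos m s
  have hF : Real.tanh (profF m a s) = Real.sinh a * profRatio m s /
    √(1 + (Real.sinh a * profRatio m s) ^ 2) := by rw [profF, Real.tanh_arsinh]
  simp only [Pi.mul_apply, Function.comp_apply, smul_eq_mul, profVar, profSpeed, ← hs]
  rw [hF, Real.tanh_eq_sinh_div_cosh]
  field_simp
  ring

/-! ### The Jacobi field `profVar` -/

lemma profVar_zero {m a : ℝ} (ha : 0 < a) : profVar m a 0 = 1 := by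
  simp only [profVar, profF_zero, profTimeParam_zero, Real.cosh_zero, Real.tanh_eq_sinh_div_cosh]
  field_simp
  simp

lemma profVar_neg (m a s : ℝ) : profVar m a (-s) = profVar m a s := by
  simp [profVar, profF_neg, profTimeParam_neg]

/-- The term from the derivative of tanh F cancels against tanh s times the derivative of
`profTimeParam`. The two surviving terms have the same sign, which is the source of monotonicity. -/
lemma hasDerivAt_profVar {m : ℝ} (hm : 0 < m) (a s : ℝ) :
    HasDerivAt (profVar m a) (-(Real.cosh a / Real.sinh a * Real.tanh (profF m a s) * Real.sinh s +
      profTimeParam m a s) / Real.cosh s ^ 2) s := by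
  have h := ((((hasDerivAt_tanh (profF m a s)).comp s (hasDerivAt_profF m a s)).const_mul
    (Real.cosh a / Real.sinh a)).div (Real.hasDerivAt_cosh s) (Real.cosh_pos s).ne').sub
    ((hasDerivAt_tanh s).mul (hasDerivAt_profTimeParam hm a s))
  refine h.congr_deriv ?_
  simp only [profSpeedParam, Function.comp_apply]
  rw [Real.tanh_eq_sinh_div_cosh s]
  field_simp
  ring

lemma profVar_deriv_neg {m a : ℝ} (hm : 0 < m) (ha : 0 < a) {s : ℝ} (hs : 0 < s) :
    -(Real.cosh a / Real.sinh a * Real.tanh (profF m a s) * Real.sinh s +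
      profTimeParam m a s) / Real.cosh s ^ 2 < 0 := by
  have h4 := tanh_pos (profF_pos (m := m) ha s)
  have h6 := strictMono_profTimeParam hm ha hs
  rw [profTimeParam_zero] at h6
  rw [neg_div, neg_lt_zero]
  positivity

lemma continuous_profVar {m a : ℝ} (hm : 0 < m) : Continuous (profVar m a) :=
  continuous_iff_continuousAt.2 fun s => (hasDerivAt_profVar hm a s).continuousAt

lemma profVar_strictAntiOn {m a : ℝ} (hm : 0 < m) (ha : 0 < a) :
    StrictAntiOn (profVar m a) (Ici 0) := by
  refine strictAntiOn_of_deriv_neg (convex_Ici 0) (continuous_profVar hm).continuousOn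
    fun s hs => ?_
  rw [interior_Ici] at hs
  rw [(hasDerivAt_profVar hm a s).deriv]
  exact profVar_deriv_neg hm ha hs

/-- Multiplied by cosh s, the field is coth a tanh F - sinh s · `profTimeParam`. The first term is
less than coth a; for s ≥ 1 the second is at least c sinh s, with c > 0 the value of `profTimeParam`
at 1. -/
lemma exists_profVar_neg {m a : ℝ} (hm : 0 < m) (ha : 0 < a) : ∃ s, 0 < s ∧ profVar m a s < 0 := by
  set c := profTimeParam m a 1 with hc
  have hc0 : 0 < c := by
    have := strictMono_profTimeParam hm ha one_pos
    rwa [profTimeParam_zero] at this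
  obtain ⟨s, hs1, hs⟩ : ∃ s, 1 ≤ s ∧ Real.cosh a / Real.sinh a / c < Real.sinh s := by
    have ht := Real.sinhOrderIso.tendsto_atTop
    have := (ht.eventually_gt_atTop (Real.cosh a / Real.sinh a / c)).and (eventually_ge_atTop 1)
    obtain ⟨s, hs⟩ := this.exists
    exact ⟨s, hs.2, hs.1⟩
  refine ⟨s, by linarith, ?_⟩
  have h3 := Real.cosh_pos s
  have h5 := tanh_lt_one' (profF m a s)
  have h6 := (strictMono_profTimeParam hm ha).monotone hs1
  have h8 : 0 < Real.cosh a / Real.sinh a := by positivity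
  have he : profVar m a s = (Real.cosh a / Real.sinh a * Real.tanh (profF m a s) -
      Real.sinh s * profTimeParam m a s) / Real.cosh s := by
    rw [profVar, Real.tanh_eq_sinh_div_cosh s]
    ring
  rw [he]
  apply div_neg_of_neg_of_pos _ h3
  rw [div_lt_iff₀ hc0] at hs
  have : Real.sinh s * c ≤ Real.sinh s * profTimeParam m a s := by gcongr
  nlinarith

/-- The positive zero of `profVar`. -/
lemma exists_profVar_zero {m a : ℝ} (hm : 0 < m) (ha : 0 < a) :
    ∃ s, 0 < s ∧ profVar m a s = 0 := by
  obtain ⟨s₁, h₁, h₂⟩ := exists_profVar_neg hm ha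
  have h0 := profVar_zero (m := m) ha
  obtain ⟨s, hs, he⟩ := intermediate_value_Icc' h₁.le (continuous_profVar hm).continuousOn
    (show (0 : ℝ) ∈ Icc (profVar m a s₁) (profVar m a 0) from ⟨h₂.le, by rw [h0]; exact zero_le_one⟩)
  refine ⟨s, lt_of_le_of_ne hs.1 ?_, he⟩
  rintro rfl
  rw [h0] at he
  exact one_ne_zero he

/-! ### The Jacobi field as a function of `t` -/

/-- The potential `P` in the equation `w'' + P w = 0` of rotationally symmetric Jacobi fields. -/
def profPot (m a t : ℝ) : ℝ :=
  m * (m + 1) * (Real.cosh (profSol m a t) / Real.sinh (profSol m a t)) ^ 2 - m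

/-- The weight `1 + f_t²`. -/
def profWeight (m a t : ℝ) : ℝ := 1 + Real.sinh (profInv m a t) ^ 2

/-- The `t`-derivative of the Jacobi field `profVar m a ∘ profInv m a`. -/
def profVarDeriv (m a t : ℝ) : ℝ :=
  -(m * (Real.cosh a / Real.sinh a) * Real.tanh (profInv m a t)) -
    m * (Real.cosh (profSol m a t) / Real.sinh (profSol m a t)) *
      profTimeParam m a (profInv m a t) / Real.cosh (profInv m a t)

lemma hasDerivAt_profVar_profInv {m a t : ℝ} (hm : 0 < m) (ha : 0 < a)
    (ht : t ∈ Ioo (-profHeight m a) (profHeight m a)) :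
    HasDerivAt (fun t => profVar m a (profInv m a t)) (profVarDeriv m a t) t := by
  have h := HasDerivAt.comp t (hasDerivAt_profVar hm a (profInv m a t)) (hasDerivAt_profInv hm ha ht)
  refine h.congr_deriv ?_
  unfold profVarDeriv profSol
  set s := profInv m a t
  have h1 := Real.sinh_pos_iff.2 (profF_pos (m := m) ha s)
  rw [Real.tanh_eq_sinh_div_cosh, Real.tanh_eq_sinh_div_cosh]
  field_simp
  ring

/-- The Jacobi equation w'' + P w = 0, checked on the explicit formula. No mixed derivatives of f in
a and t need to be exchanged. -/
lemma hasDerivAt_profVarDeriv {m a t : ℝ} (hm : 0 < m) (ha : 0 < a)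
    (ht : t ∈ Ioo (-profHeight m a) (profHeight m a)) :
    HasDerivAt (profVarDeriv m a) (-(profPot m a t * profVar m a (profInv m a t))) t := by
  have hS := hasDerivAt_profInv hm ha ht
  have hf := hasDerivAt_profSol hm ha ht
  have h1 : 0 < Real.sinh (profSol m a t) := Real.sinh_pos_iff.2 (profF_pos ha _)
  have h3 := Real.cosh_pos (profInv m a t)
  have h := (((HasDerivAt.comp t (hasDerivAt_tanh _) hS).const_mul
    (m * (Real.cosh a / Real.sinh a))).neg).sub
    (((((hf.cosh).div hf.sinh h1.ne').const_mul m).mul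
      (HasDerivAt.comp t (hasDerivAt_profTimeParam hm a _) hS)).div hS.cosh h3.ne')
  refine h.congr_deriv ?_
  have hF : profF m a (profInv m a t) = profSol m a t := rfl
  simp only [profPot, profVar, profSpeedParam, hF, Function.comp_apply]
  rw [Real.tanh_eq_sinh_div_cosh, Real.tanh_eq_sinh_div_cosh]
  simp only [Pi.mul_apply, Pi.div_apply, Function.comp_apply]
  field_simp
  simp only [Real.cosh_sq (profSol m a t), pow_succ, pow_zero, one_mul]
  ring

/-! ### The maximal solution -/

lemma pos_of_two_le {n : ℕ} (hn : 2 ≤ n) : (0 : ℝ) < (n : ℝ) - 1 := by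
  have : (2 : ℝ) ≤ n := by exact_mod_cast hn
  linarith

lemma isCatenarySolution_of_eqOn {n : ℕ} (hn : 2 ≤ n) {a : ℝ} (ha : 0 < a) {f : ℝ → ℝ}
    (hf : EqOn f (profSol (n - 1) a) (Ioo (-profHeight (n - 1) a) (profHeight (n - 1) a))) :
    IsCatenarySolution n a (Ioo (-profHeight (n - 1) a) (profHeight (n - 1) a)) f := by
  have hm := pos_of_two_le hn
  have hT := profHeight_pos hm ha
  have h0 : (0 : ℝ) ∈ Ioo (-profHeight (n - 1) a) (profHeight (n - 1) a) :=
    ⟨by linarith, hT⟩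
  have hev : ∀ t ∈ Ioo (-profHeight (n - 1) a) (profHeight (n - 1) a),
      f =ᶠ[𝓝 t] profSol (n - 1) a := fun t ht =>
    eventually_of_mem (Ioo_mem_nhds ht.1 ht.2) hf
  have hd : ∀ t ∈ Ioo (-profHeight (n - 1) a) (profHeight (n - 1) a),
      HasDerivAt f (Real.sinh (profInv (n - 1) a t)) t := fun t ht =>
    (hasDerivAt_profSol hm ha ht).congr_of_eventuallyEq (hev t ht)
  refine ⟨isOpen_Ioo, ordConnected_Ioo, h0, fun t ht => ?_, ?_, ?_,
    fun t ht => (hd t ht).differentiableAt, fun t ht => ?_⟩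
  · rw [hf ht]
    exact profF_pos ha _
  · rw [hf h0, profSol, profInv_zero hm ha, profF_zero]
  · rw [(hd 0 h0).deriv, profInv_zero hm ha, Real.sinh_zero]
  · rw [hf ht, (hd t ht).deriv]
    exact (hasDerivAt_sinh_profInv hm ha ht).congr_of_eventuallyEq
      (eventually_of_mem (Ioo_mem_nhds ht.1 ht.2) fun x hx => (hd x hx).deriv)

lemma IsCatenarySolution.subset_and_eqOn {n : ℕ} (hn : 2 ≤ n) {a : ℝ} (ha : 0 < a) {I : Set ℝ}
    {f : ℝ → ℝ} (h : IsCatenarySolution n a I f) :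
    I ⊆ Ioo (-profHeight (n - 1) a) (profHeight (n - 1) a) ∧ EqOn f (profSol (n - 1) a) I :=
  profSol_unique (pos_of_two_le hn) ha h.isOpen h.ordConnected h.zero_mem h.pos h.init
    h.init_deriv (fun t ht => (h.differentiable t ht).hasDerivAt) h.ode

lemma catInterval_eq {n : ℕ} (hn : 2 ≤ n) {a : ℝ} (ha : 0 < a) :
    catInterval n a = Ioo (-profHeight (n - 1) a) (profHeight (n - 1) a) := by
  apply Subset.antisymm
  · rintro t ⟨I, ⟨f, hf⟩, ht⟩
    exact (hf.subset_and_eqOn hn ha).1 ht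
  · intro t ht
    exact ⟨_, ⟨_, isCatenarySolution_of_eqOn hn ha fun _ _ => rfl⟩, ht⟩

/-- The choice operator returns the value at t of some solution, and by uniqueness all solutions
defined at t share that value. -/
lemma catF_eq {n : ℕ} (hn : 2 ≤ n) {a t : ℝ} (ha : 0 < a)
    (ht : t ∈ Ioo (-profHeight (n - 1) a) (profHeight (n - 1) a)) :
    catF n a t = profSol (n - 1) a t := by
  have hex : ∃ ρ, ∃ (I : Set ℝ) (f : ℝ → ℝ), IsCatenarySolution n a I f ∧ t ∈ I ∧ f t = ρ :=
    ⟨_, _, _, isCatenarySolution_of_eqOn hn ha fun _ _ => rfl, ht, rfl⟩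
  obtain ⟨I, f, hf, htI, he⟩ := Classical.epsilon_spec hex
  rw [catF, ← he]
  exact (hf.subset_and_eqOn hn ha).2 htI

lemma isMaximalCatenarySolution_catF {n : ℕ} (hn : 2 ≤ n) {a : ℝ} (ha : 0 < a) :
    IsMaximalCatenarySolution n a (catInterval n a) (catF n a) := by
  rw [catInterval_eq hn ha]
  refine ⟨isCatenarySolution_of_eqOn hn ha fun t ht => catF_eq hn ha ht, fun J h hJ => ?_⟩
  obtain ⟨h1, h2⟩ := hJ.subset_and_eqOn hn ha
  exact ⟨h1, fun t ht => by rw [h2 ht, catF_eq hn ha (h1 ht)]⟩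

lemma catF_eventuallyEq {n : ℕ} (hn : 2 ≤ n) {a t : ℝ} (ha : 0 < a)
    (ht : t ∈ Ioo (-profHeight (n - 1) a) (profHeight (n - 1) a)) :
    catF n a =ᶠ[𝓝 t] profSol (n - 1) a :=
  eventually_of_mem (Ioo_mem_nhds ht.1 ht.2) fun _ hx => catF_eq hn ha hx

lemma deriv_catF {n : ℕ} (hn : 2 ≤ n) {a t : ℝ} (ha : 0 < a)
    (ht : t ∈ Ioo (-profHeight (n - 1) a) (profHeight (n - 1) a)) :
    deriv (catF n a) t = Real.sinh (profInv (n - 1) a t) :=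
  ((hasDerivAt_profSol (pos_of_two_le hn) ha ht).congr_of_eventuallyEq
    (catF_eventuallyEq hn ha ht)).deriv

/-- For b near a, the point t also lies in the maximal interval of b, so the closed formula holds on
a neighbourhood of a and can be differentiated there. -/
lemma hasDerivAt_catF_param {n : ℕ} (hn : 2 ≤ n) {a t : ℝ} (ha : 0 < a)
    (ht : t ∈ Ioo (-profHeight (n - 1) a) (profHeight (n - 1) a)) :
    HasDerivAt (fun b => catF n b t) (Real.cosh (profInv (n - 1) a t) *
      profVar (n - 1) a (profInv (n - 1) a t)) a := by
  have hm := pos_of_two_le hn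
  refine (hasDerivAt_profSol_param hm ha ht).congr_of_eventuallyEq ?_
  filter_upwards [eventually_profTime_param_mem hm ha ht one_pos, eventually_gt_nhds ha]
    with b hb hb0
  refine catF_eq hn hb0 ?_
  rw [← range_profTime hm hb0, ← hb.1]
  exact mem_range_self _

/-! ### The radius of the catenoid -/

lemma hasDerivAt_tanh_half_catF_param {n : ℕ} (hn : 2 ≤ n) {a t : ℝ} (ha : 0 < a)
    (ht : t ∈ Ioo (-profHeight (n - 1) a) (profHeight (n - 1) a)) :
    HasDerivAt (fun b => Real.tanh (catF n b t / 2)) (1 / (2 * Real.cosh (catF n a t / 2) ^ 2) *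
      (Real.cosh (profInv (n - 1) a t) * profVar (n - 1) a (profInv (n - 1) a t))) a := by
  refine (HasDerivAt.comp a (hasDerivAt_tanh _)
    ((hasDerivAt_catF_param hn ha ht).div_const 2)).congr_deriv ?_
  have := Real.cosh_pos (catF n a t / 2)
  field_simp

lemma hyp_conformal_factor (x : ℝ) :
    2 / (1 - Real.tanh (x / 2) ^ 2) = 2 * Real.cosh (x / 2) ^ 2 := by
  have h2 := Real.cosh_sq (x / 2)
  rw [Real.tanh_eq_sinh_div_cosh]
  have h3 : 1 - (Real.sinh (x / 2) / Real.cosh (x / 2)) ^ 2 = 1 / Real.cosh (x / 2) ^ 2 := by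
    field_simp
    linarith
  rw [h3]
  field_simp

lemma norm_catX_fst {n : ℕ} (hn : 2 ≤ n) {a t : ℝ} (ha : 0 < a)
    (ht : t ∈ Ioo (-profHeight (n - 1) a) (profHeight (n - 1) a))
    {ξ : EuclideanSpace ℝ (Fin n)} (hξ : ‖ξ‖ = 1) :
    ‖(catX n a t ξ).1‖ = Real.tanh (catF n a t / 2) := by
  have h : 0 < catF n a t := by rw [catF_eq hn ha ht]; exact profF_pos ha _
  rw [catX, norm_smul, hξ, mul_one, Real.norm_of_nonneg (tanh_pos (by linarith)).le]

/-- The variation Jacobi field. -/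
lemma variationField_eq {n : ℕ} (hn : 2 ≤ n) {a t : ℝ} (ha : 0 < a)
    (ht : t ∈ Ioo (-profHeight (n - 1) a) (profHeight (n - 1) a))
    {ξ : EuclideanSpace ℝ (Fin n)} (hξ : ‖ξ‖ = 1) :
    variationField n a t ξ = - profVar (n - 1) a (profInv (n - 1) a t) := by
  have hd : HasDerivAt (fun b => catX n b t ξ)
      ((1 / (2 * Real.cosh (catF n a t / 2) ^ 2) * (Real.cosh (profInv (n - 1) a t) *
        profVar (n - 1) a (profInv (n - 1) a t))) • ξ, 0) a :=
    ((hasDerivAt_tanh_half_catF_param hn ha ht).smul_const ξ).prodMk (hasDerivAt_const a t)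
  have hpos : 0 < Real.tanh (catF n a t / 2) := by
    have h : 0 < catF n a t := by rw [catF_eq hn ha ht]; exact profF_pos ha _
    exact tanh_pos (by linarith)
  have hN : catNormal n a (catX n a t ξ) = (1 / √(1 + deriv (catF n a) t ^ 2)) •
      ((-(1 / (2 * Real.cosh (catF n a t / 2) ^ 2)) • ξ, deriv (catF n a) t) : Amb n) := by
    have h1 := norm_catX_fst hn ha ht hξ
    unfold catNormal
    rw [h1]
    simp only [catX]
    rw [smul_smul (1 / Real.tanh _), one_div_mul_cancel hpos.ne', one_smul]
  rw [variationField, hd.deriv, hN, hypMetric, norm_catX_fst hn ha ht hξ,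
    hyp_conformal_factor, deriv_catF hn ha ht, add_comm 1, ← Real.cosh_sq,
    Real.sqrt_sq (Real.cosh_pos _).le]
  simp only [Prod.smul_fst, Prod.smul_snd, inner_smul_left, inner_smul_right,
    real_inner_self_eq_norm_sq, hξ]
  have h1 := Real.cosh_pos (catF n a t / 2)
  simp
  field_simp

/-- Since y = t does not depend on a, the determinant reduces to x_a, a positive multiple of
`profVar`. -/
lemma envelopeDet_eq {n : ℕ} (hn : 2 ≤ n) {a t : ℝ} (ha : 0 < a)
    (ht : t ∈ Ioo (-profHeight (n - 1) a) (profHeight (n - 1) a)) :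
    envelopeDet (fun b s => Real.tanh (catF n b s / 2)) (fun _ s => s) a t = 0 ↔
      profVar (n - 1) a (profInv (n - 1) a t) = 0 := by
  have h1 := Real.cosh_pos (catF n a t / 2)
  have h2 := Real.cosh_pos (profInv (n - 1) a t)
  rw [envelopeDet, Matrix.det_fin_two_of, (hasDerivAt_tanh_half_catF_param hn ha ht).deriv]
  simp [h1.ne', h2.ne']

/-! ### The Levi-Civita connection of `ℍⁿ × ℝ` -/

/-- The conformal factor of the ball model. -/
def hypFactor {n : ℕ} (p : Amb n) : ℝ := 2 / (1 - ‖p.1‖ ^ 2)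

lemma hypMetric_apply {n : ℕ} (p u v : Amb n) :
    hypMetric n p u v = hypFactor p ^ 2 * inner ℝ u.1 v.1 + u.2 * v.2 := rfl

lemma hypFactor_pos {n : ℕ} {p : Amb n} (hp : ‖p.1‖ < 1) : 0 < hypFactor p :=
  div_pos two_pos (by nlinarith [norm_nonneg p.1])

lemma isOpen_ball_fst (n : ℕ) : IsOpen {p : Amb n | ‖p.1‖ < 1} :=
  isOpen_lt (by fun_prop) continuous_const

lemma hypMetric_comm {n : ℕ} (p u v : Amb n) : hypMetric n p u v = hypMetric n p v u := by
  simp only [hypMetric, real_inner_comm, mul_comm]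

lemma hypMetric_add_left {n : ℕ} (p u u' v : Amb n) :
    hypMetric n p (u + u') v = hypMetric n p u v + hypMetric n p u' v := by
  simp only [hypMetric, Prod.fst_add, Prod.snd_add, inner_add_left]; ring

lemma hypMetric_sub_left {n : ℕ} (p u u' v : Amb n) :
    hypMetric n p (u - u') v = hypMetric n p u v - hypMetric n p u' v := by
  simp only [hypMetric, Prod.fst_sub, Prod.snd_sub, inner_sub_left]; ring

lemma hypMetric_smul_left {n : ℕ} (p : Amb n) (c : ℝ) (u v : Amb n) :
    hypMetric n p (c • u) v = c * hypMetric n p u v := by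
  simp only [hypMetric, Prod.smul_fst, Prod.smul_snd, real_inner_smul_left, smul_eq_mul]; ring

lemma hypMetric_ext {n : ℕ} {p z z' : Amb n} (hp : ‖p.1‖ < 1)
    (h : ∀ w, hypMetric n p z w = hypMetric n p z' w) : z = z' := by
  have h1 := h (z - z')
  rw [← sub_eq_zero, ← hypMetric_sub_left, hypMetric_apply, real_inner_self_eq_norm_sq] at h1
  have h2 := hypFactor_pos hp
  have h3 : ‖(z - z').1‖ = 0 := by
    by_contra hne
    have : 0 < ‖(z - z').1‖ := lt_of_le_of_ne (norm_nonneg _) (Ne.symm hne)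
    nlinarith [mul_pos (pow_pos h2 2) (pow_pos this 2), mul_self_nonneg (z - z').2]
  rw [h3] at h1
  have h4 : (z - z').2 = 0 := by nlinarith
  rw [← sub_eq_zero]
  exact Prod.ext (norm_eq_zero.1 h3) h4

lemma hasFDerivAt_hypFactor {n : ℕ} {p : Amb n} (hp : ‖p.1‖ < 1) :
    HasFDerivAt (hypFactor (n := n)) (hypFactor p ^ 2 • (innerSL ℝ p.1).comp
      (ContinuousLinearMap.fst ℝ (EuclideanSpace ℝ (Fin n)) ℝ)) p := by
  have h0 : (1 : ℝ) - ‖p.1‖ ^ 2 ≠ 0 := by nlinarith [norm_nonneg p.1]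
  have h1 : HasFDerivAt (fun q : Amb n => 1 - ‖q.1‖ ^ 2) _ p :=
    (hasFDerivAt_fst.norm_sq).const_sub 1
  have h2 : HasDerivAt (fun x : ℝ => 2 / x) (-2 / (1 - ‖p.1‖ ^ 2) ^ 2) (1 - ‖p.1‖ ^ 2) := by
    simpa using! (hasDerivAt_const _ (2 : ℝ)).div (hasDerivAt_id _) h0
  refine (h2.comp_hasFDerivAt p h1).congr_fderiv ?_
  ext v
  · simp [hypFactor]
    field_simp
  · simp

lemma fderiv_hypMetric {n : ℕ} {p : Amb n} (hp : ‖p.1‖ < 1) (u v w : Amb n) :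
    fderiv ℝ (fun q => hypMetric n q v w) p u =
      2 * hypFactor p ^ 3 * inner ℝ p.1 u.1 * inner ℝ v.1 w.1 := by
  have h : HasFDerivAt (fun q => hypMetric n q v w) _ p :=
    (((hasFDerivAt_hypFactor hp).pow 2).mul_const (inner ℝ v.1 w.1)).add_const (v.2 * w.2)
  rw [h.fderiv]
  simp
  ring

/-- The Christoffel symbols of `ℍⁿ × ℝ`, in closed form. -/
def hypGamma {n : ℕ} (p u v : Amb n) : Amb n :=
  (hypFactor p • (inner ℝ p.1 u.1 • v.1 + inner ℝ p.1 v.1 • u.1 - inner ℝ u.1 v.1 • p.1), 0)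

/-- The closed form satisfies the Koszul identity, and nondegeneracy of the metric leaves the choice
operator no other vector. -/
lemma christoffel_eq {n : ℕ} {p : Amb n} (hp : ‖p.1‖ < 1) (u v : Amb n) :
    christoffel (hypMetric n) p u v = hypGamma p u v := by
  have hex : ∀ w : Amb n, 2 * hypMetric n p (hypGamma p u v) w =
      fderiv ℝ (fun q => hypMetric n q v w) p u + fderiv ℝ (fun q => hypMetric n q u w) p v
      - fderiv ℝ (fun q => hypMetric n q u v) p w := by
    intro w
    rw [fderiv_hypMetric hp, fderiv_hypMetric hp, fderiv_hypMetric hp]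
    simp only [hypMetric_apply, hypGamma, real_inner_smul_left,
      inner_add_left, inner_sub_left, zero_mul, add_zero]
    ring
  refine hypMetric_ext hp fun w => ?_
  have h2 := Classical.epsilon_spec (p := fun z : Amb n => ∀ w : Amb n, 2 * hypMetric n p z w =
    fderiv ℝ (fun q => hypMetric n q v w) p u + fderiv ℝ (fun q => hypMetric n q u w) p v
      - fderiv ℝ (fun q => hypMetric n q u v) p w) ⟨_, hex⟩
  have h3 := (h2 w).trans (hex w).symm
  unfold christoffel
  linarith

lemma fderiv_hypGamma {n : ℕ} {p : Amb n} (hp : ‖p.1‖ < 1) (u v w : Amb n) :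
    fderiv ℝ (fun q => hypGamma q v w) p u =
      ((hypFactor p ^ 2 * inner ℝ p.1 u.1) •
        (inner ℝ p.1 v.1 • w.1 + inner ℝ p.1 w.1 • v.1 - inner ℝ v.1 w.1 • p.1) +
      hypFactor p • (inner ℝ u.1 v.1 • w.1 + inner ℝ u.1 w.1 • v.1 - inner ℝ v.1 w.1 • u.1), 0) := by
  have hB : ∀ x y : EuclideanSpace ℝ (Fin n), HasFDerivAt (fun q : Amb n => inner ℝ q.1 x • y)
      (((innerSL ℝ x).comp (ContinuousLinearMap.fst ℝ _ ℝ)).smulRight y) p := by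
    intro x y
    convert (((innerSL ℝ x).comp (ContinuousLinearMap.fst ℝ _ ℝ)).smulRight y).hasFDerivAt using 2
    simp [real_inner_comm]
  have hC : HasFDerivAt (fun q : Amb n => inner ℝ v.1 w.1 • q.1)
      (inner ℝ v.1 w.1 • ContinuousLinearMap.fst ℝ (EuclideanSpace ℝ (Fin n)) ℝ) p :=
    hasFDerivAt_fst.fun_const_smul _
  have h : HasFDerivAt (fun q => hypGamma q v w) _ p :=
    ((hasFDerivAt_hypFactor hp).smul (((hB v.1 w.1).add (hB w.1 v.1)).sub hC)).prodMk
      (hasFDerivAt_const (0 : ℝ) p)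
  rw [h.fderiv]
  simp [real_inner_comm, add_comm]

lemma curvature_eq {n : ℕ} {p : Amb n} (hp : ‖p.1‖ < 1) (u v w : Amb n) :
    curvature (hypMetric n) p u v w =
      (hypFactor p ^ 2 • (inner ℝ u.1 w.1 • v.1 - inner ℝ v.1 w.1 • u.1), 0) := by
  have hev : ∀ v w : Amb n, (fun q => christoffel (hypMetric n) q v w) =ᶠ[𝓝 p]
      fun q => hypGamma q v w := fun v w =>
    eventually_of_mem ((isOpen_ball_fst n).mem_nhds hp) fun q hq => christoffel_eq hq v w
  -- The relation λ(1 - |x|²) = 2 for the conformal factor λ; it removes |x|² from the quadratic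
  -- terms in the Christoffel symbols.
  have hf : ‖p.1‖ ^ 2 * hypFactor p = hypFactor p - 2 := by
    have : (1 : ℝ) - ‖p.1‖ ^ 2 ≠ 0 := by nlinarith [norm_nonneg p.1]
    rw [hypFactor]
    field_simp
    ring
  simp only [curvature, covDeriv, (hev _ _).fderiv_eq, christoffel_eq hp, fderiv_hypGamma hp]
  simp only [hypGamma, inner_smul_right, inner_add_right, inner_sub_right,
    real_inner_self_eq_norm_sq]
  refine Prod.ext ?_ (by simp)
  simp only [Prod.fst_sub, Prod.fst_add]
  rw [real_inner_comm u.1 v.1, real_inner_comm u.1 p.1, real_inner_comm v.1 p.1]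
  match_scalars
  · ring
  · linear_combination (hypFactor p * inner ℝ u.1 w.1) * hf
  · ring
  · linear_combination (-(hypFactor p * inner ℝ v.1 w.1)) * hf

lemma ricci_eq {n : ℕ} {p : Amb n} (hp : ‖p.1‖ < 1) (v w : Amb n) :
    ricci (hypMetric n) p v w = -((n : ℝ) - 1) * (hypFactor p ^ 2 * inner ℝ v.1 w.1) := by
  simp only [ricci, curvature_eq hp, add_zero]
  have h1 : ∀ i : Fin n, (hypFactor p ^ 2 • (inner ℝ (EuclideanSpace.single i (1 : ℝ)) w.1 • v.1 -
      inner ℝ v.1 w.1 • EuclideanSpace.single i (1 : ℝ))) i =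
      hypFactor p ^ 2 * (w.1 i * v.1 i) - hypFactor p ^ 2 * inner ℝ v.1 w.1 := by
    intro i
    simp [EuclideanSpace.inner_single_left]
    ring
  rw [Finset.sum_congr rfl fun i _ => h1 i, Finset.sum_sub_distrib, ← Finset.mul_sum]
  have h2 : ∑ i, w.1 i * v.1 i = inner ℝ v.1 w.1 := by
    simp [PiLp.inner_apply]
  rw [h2]
  simp
  ring

/-! ### Orthonormal frames -/

/-- The linear map that turns the metric at `p` into the Euclidean one. -/
def hypScale {n : ℕ} (p u : Amb n) : WithLp 2 (EuclideanSpace ℝ (Fin n) × ℝ) :=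
  WithLp.toLp 2 (hypFactor p • u.1, u.2)

lemma inner_hypScale {n : ℕ} (p u v : Amb n) :
    inner ℝ (hypScale p u) (hypScale p v) = hypMetric n p u v := by
  simp [hypScale, hypMetric_apply, inner_smul_left, inner_smul_right]
  ring

lemma hypScale_surjective {n : ℕ} {p : Amb n} (hp : ‖p.1‖ < 1) :
    Function.Surjective (hypScale p) := fun y =>
  ⟨((hypFactor p)⁻¹ • y.fst, y.snd), by
    have := (hypFactor_pos hp).ne'
    simp only [hypScale, smul_smul, mul_inv_cancel₀ this, one_smul]
    rfl⟩

lemma finrank_hyp (n : ℕ) : Module.finrank ℝ (WithLp 2 (EuclideanSpace ℝ (Fin n) × ℝ)) =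
    Fintype.card (Option (Fin n)) := by
  rw [(WithLp.linearEquiv 2 ℝ (EuclideanSpace ℝ (Fin n) × ℝ)).finrank_eq]
  simp

/-- The map `hypScale p` carries the metric at p to the Euclidean one, and an orthonormal family of
n + 1 vectors is then an orthonormal basis. -/
lemma hypMetric_parseval {n : ℕ} {p : Amb n} {F : Option (Fin n) → Amb n}
    (hF : ∀ i j, hypMetric n p (F i) (F j) = if i = j then 1 else 0) (u v : Amb n) :
    hypMetric n p u v = ∑ i, hypMetric n p u (F i) * hypMetric n p v (F i) := by
  have ho : Orthonormal ℝ fun i => hypScale p (F i) := by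
    rw [orthonormal_iff_ite]
    intro i j
    rw [inner_hypScale, hF]
  obtain ⟨b, hb⟩ := Orthonormal.exists_orthonormalBasis_extension_of_card_eq
    (v := fun i => hypScale p (F i)) (s := univ) (finrank_hyp n)
    (ho.comp _ Subtype.val_injective)
  rw [← inner_hypScale, ← b.sum_inner_mul_inner]
  refine Finset.sum_congr rfl fun i _ => ?_
  rw [hb i (mem_univ i), inner_hypScale, real_inner_comm, inner_hypScale]

lemma tangentFrame_spec {n : ℕ} {p : Amb n} (hp : ‖p.1‖ < 1) {N : Amb n → Amb n}
    (hN : hypMetric n p (N p) (N p) = 1) :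
    (∀ i, hypMetric n p (N p) (tangentFrame (hypMetric n) N p i) = 0) ∧
      ∀ i j, hypMetric n p (tangentFrame (hypMetric n) N p i) (tangentFrame (hypMetric n) N p j) =
        if i = j then 1 else 0 := by
  refine Classical.epsilon_spec (p := fun e : Fin n → Amb n =>
    (∀ i, hypMetric n p (N p) (e i) = 0) ∧
      ∀ i j, hypMetric n p (e i) (e j) = if i = j then 1 else 0) ?_
  -- The index `none` carries the normal. Completing it to an orthonormal basis indexed by `Option
  -- (Fin n)` leaves exactly n tangent vectors.
  have ho : Orthonormal ℝ (({none} : Set (Option (Fin n))).domRestrict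
      fun _ => hypScale p (N p)) := by
    rw [orthonormal_iff_ite]
    rintro ⟨i, rfl⟩ ⟨j, rfl⟩
    rw [if_pos rfl]
    exact (inner_hypScale p _ _).trans hN
  obtain ⟨b, hb⟩ := ho.exists_orthonormalBasis_extension_of_card_eq (finrank_hyp n)
  choose e he using fun i : Fin n => hypScale_surjective hp (b (some i))
  refine ⟨e, fun i => ?_, fun i j => ?_⟩
  · rw [← inner_hypScale, he, ← hb none rfl, b.inner_eq_ite]
    simp
  · rw [← inner_hypScale, he, he, b.inner_eq_ite]
    simp

lemma tangentFrame_parseval {n : ℕ} {p : Amb n} (hp : ‖p.1‖ < 1) {N : Amb n → Amb n}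
    (hN : hypMetric n p (N p) (N p) = 1) (u v : Amb n) :
    ∑ i, hypMetric n p u (tangentFrame (hypMetric n) N p i) *
        hypMetric n p v (tangentFrame (hypMetric n) N p i) =
      hypMetric n p u v - hypMetric n p u (N p) * hypMetric n p v (N p) := by
  obtain ⟨h1, h2⟩ := tangentFrame_spec hp hN
  have h := hypMetric_parseval (p := p)
    (F := fun i => Option.elim i (N p) (tangentFrame (hypMetric n) N p)) (fun i j => by
      rcases i with _ | i <;> rcases j with _ | j
      · simp [hN]
      · simp [h1]
      · simp [hypMetric_comm p _ (N p), h1]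
      · simp [h2]) u v
  rw [h, Fintype.sum_option]
  simp

/-! ### The gradient and the Laplacian -/

/-- The gradient on `ℍⁿ × ℝ`, in closed form. -/
def hypGrad {n : ℕ} (φ : Amb n → ℝ) (p : Amb n) : Amb n :=
  ((hypFactor p ^ 2)⁻¹ • ∑ i, fderiv ℝ φ p (EuclideanSpace.single i 1, 0) •
    EuclideanSpace.single i (1 : ℝ), fderiv ℝ φ p (0, 1))

lemma hypMetric_hypGrad {n : ℕ} {p : Amb n} (hp : ‖p.1‖ < 1) (φ : Amb n → ℝ) (w : Amb n) :
    hypMetric n p (hypGrad φ p) w = fderiv ℝ φ p w := by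
  have hw : w = ∑ i, w.1 i • ((EuclideanSpace.single i 1, 0) : Amb n) + w.2 • (0, 1) := by
    refine Prod.ext ?_ ?_
    · rw [Prod.fst_add, Prod.fst_sum]
      ext j
      simp [Finset.sum_apply, Pi.single_apply]
    · rw [Prod.snd_add, Prod.snd_sum]
      simp
  have := (pow_pos (hypFactor_pos hp) 2).ne'
  conv_rhs => rw [hw]
  simp only [hypGrad, map_add, map_sum, map_smul, hypMetric_apply, real_inner_smul_left, sum_inner,
    EuclideanSpace.inner_single_left, smul_eq_mul]
  rw [mul_inv_cancel_left₀ this]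
  simp [mul_comm]

lemma hypMetric_gradAmb {n : ℕ} {p : Amb n} (hp : ‖p.1‖ < 1) (φ : Amb n → ℝ) (w : Amb n) :
    hypMetric n p (gradAmb (hypMetric n) φ p) w = fderiv ℝ φ p w :=
  Classical.epsilon_spec (p := fun z : Amb n => ∀ w : Amb n,
    hypMetric n p z w = fderiv ℝ φ p w) ⟨_, hypMetric_hypGrad hp φ⟩ w

lemma gradAmb_eq {n : ℕ} {p : Amb n} (hp : ‖p.1‖ < 1) (φ : Amb n → ℝ) :
    gradAmb (hypMetric n) φ p = hypGrad φ p :=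
  hypMetric_ext hp fun w => by rw [hypMetric_gradAmb hp, hypMetric_hypGrad hp]

lemma differentiableAt_gradAmb {n : ℕ} {p : Amb n} (hp : ‖p.1‖ < 1) {φ : Amb n → ℝ}
    (hφ : DifferentiableAt ℝ (fderiv ℝ φ) p) :
    DifferentiableAt ℝ (gradAmb (hypMetric n) φ) p := by
  have hev : gradAmb (hypMetric n) φ =ᶠ[𝓝 p] hypGrad φ :=
    eventually_of_mem ((isOpen_ball_fst n).mem_nhds hp) fun q hq => gradAmb_eq hq φ
  refine DifferentiableAt.congr_of_eventuallyEq ?_ hev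
  have h1 : DifferentiableAt ℝ (hypFactor (n := n)) p := (hasFDerivAt_hypFactor hp).differentiableAt
  have h2 : ∀ v : Amb n, DifferentiableAt ℝ (fun q => fderiv ℝ φ q v) p := fun v =>
    hφ.clm_apply (differentiableAt_const v)
  refine DifferentiableAt.prodMk (DifferentiableAt.smul ((h1.pow 2).inv
    (pow_pos (hypFactor_pos hp) 2).ne') ?_) (h2 _)
  exact DifferentiableAt.fun_sum fun i _ => (h2 _).smul_const _

/-- The tangential gradient is Z - dφ(N) N, with Z the ambient gradient. Differentiating the
coefficient dφ(N) produces a multiple of N, which is orthogonal to e; what remains is the ambient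
Hessian corrected by the second fundamental form. -/
lemma hypMetric_covDeriv_gradHyp {n : ℕ} {p : Amb n} (hp : ‖p.1‖ < 1) {φ : Amb n → ℝ}
    (hφ : DifferentiableAt ℝ (fderiv ℝ φ) p) {N : Amb n → Amb n} (hN : DifferentiableAt ℝ N p)
    {e : Amb n} (he : hypMetric n p (N p) e = 0) :
    hypMetric n p (covDeriv (hypMetric n) (gradHyp (hypMetric n) N φ) p e) e =
      fderiv ℝ (fderiv ℝ φ) p e e - fderiv ℝ φ p (hypGamma p e e) -
        fderiv ℝ φ p (N p) * hypMetric n p (covDeriv (hypMetric n) N p e) e := by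
  set Z := gradAmb (hypMetric n) φ with hZ
  have hZd : DifferentiableAt ℝ Z p := differentiableAt_gradAmb hp hφ
  have hev : gradHyp (hypMetric n) N φ =ᶠ[𝓝 p] fun q => Z q - fderiv ℝ φ q (N q) • N q :=
    eventually_of_mem ((isOpen_ball_fst n).mem_nhds hp) fun q hq => by
      rw [gradHyp, hypMetric_gradAmb hq]
  have hc : DifferentiableAt ℝ (fun q => fderiv ℝ φ q (N q)) p := hφ.clm_apply hN
  have hd := hZd.hasFDerivAt.sub (hc.hasFDerivAt.smul hN.hasFDerivAt)
  have hval : gradHyp (hypMetric n) N φ p = Z p - fderiv ℝ φ p (N p) • N p := hev.eq_of_nhds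
  have hder : fderiv ℝ (gradHyp (hypMetric n) N φ) p e = fderiv ℝ Z p e -
      (fderiv ℝ φ p (N p) • fderiv ℝ N p e + fderiv ℝ (fun q => fderiv ℝ φ q (N q)) p e • N p) := by
    rw [hev.fderiv_eq]
    erw [hd.fderiv]
    simp
  -- Differentiate the defining relation g(Z, e) = dφ(e) in the direction e; the first term on the
  -- right is the variation of the conformal factor.
  have hcomp : fderiv ℝ (fderiv ℝ φ) p e e = 2 * hypFactor p ^ 3 * inner ℝ p.1 e.1 *
      inner ℝ (Z p).1 e.1 + hypMetric n p (fderiv ℝ Z p e) e := by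
    have h1 : HasFDerivAt (fun q => hypMetric n q (Z q) e) _ p :=
      (((hasFDerivAt_hypFactor hp).pow 2).mul
        ((hZd.hasFDerivAt.fst).inner ℝ (hasFDerivAt_const e.1 p))).add
        ((hZd.hasFDerivAt.snd).mul_const e.2)
    have h2 : HasFDerivAt (fun q => fderiv ℝ φ q e) _ p :=
      hφ.hasFDerivAt.clm_apply (hasFDerivAt_const e p)
    have hev2 : (fun q => hypMetric n q (Z q) e) =ᶠ[𝓝 p] fun q => fderiv ℝ φ q e :=
      eventually_of_mem ((isOpen_ball_fst n).mem_nhds hp) fun q hq => hypMetric_gradAmb hq φ e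
    have h3 := congrArg (fun L => L e) (h2.unique (h1.congr_of_eventuallyEq hev2.symm))
    simp at h3
    rw [h3, hypMetric_apply]
    ring
  have hG := hypMetric_gradAmb hp φ (hypGamma p e e)
  rw [← hZ] at hG
  rw [covDeriv, covDeriv, christoffel_eq hp, christoffel_eq hp, hder, hval, hcomp, ← hG]
  simp only [hypMetric_apply, hypGamma, Prod.fst_add, Prod.snd_add, Prod.fst_sub, Prod.snd_sub,
    Prod.smul_fst, Prod.smul_snd, inner_add_left, inner_sub_left, inner_smul_left,
    inner_smul_right, inner_add_right, inner_sub_right, smul_eq_mul, conj_trivial] at he ⊢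
  rw [real_inner_comm e.1 p.1, real_inner_comm (Z p).1 p.1, real_inner_comm (N p).1 p.1,
    real_inner_comm e.1 (N p).1, real_inner_comm e.1 (Z p).1] at *
  linear_combination -(fderiv ℝ (fun q => fderiv ℝ φ q (N q)) p e) * he

lemma laplaceHyp_eq {n : ℕ} {p : Amb n} (hp : ‖p.1‖ < 1) {φ : Amb n → ℝ}
    (hφ : DifferentiableAt ℝ (fderiv ℝ φ) p) {N : Amb n → Amb n} (hN : DifferentiableAt ℝ N p)
    (hN1 : hypMetric n p (N p) (N p) = 1) :
    laplaceHyp (hypMetric n) N φ p = ∑ i,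
      (fderiv ℝ (fderiv ℝ φ) p (tangentFrame (hypMetric n) N p i)
          (tangentFrame (hypMetric n) N p i) -
        fderiv ℝ φ p (hypGamma p (tangentFrame (hypMetric n) N p i)
          (tangentFrame (hypMetric n) N p i)) -
        fderiv ℝ φ p (N p) * hypMetric n p (covDeriv (hypMetric n) N p
          (tangentFrame (hypMetric n) N p i)) (tangentFrame (hypMetric n) N p i)) :=
  Finset.sum_congr rfl fun i _ =>
    hypMetric_covDeriv_gradHyp hp hφ hN ((tangentFrame_spec hp hN1).1 i)

/-! ### Geometry of a hypersurface of revolution -/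

/-- The conformal factor `2 cosh² (f / 2)` along the hypersurface. -/
def revFactor (f : ℝ → ℝ) (t : ℝ) : ℝ := 2 * Real.cosh (f t / 2) ^ 2

/-- The Euclidean radius `tanh (f / 2)`. -/
def revRad (f : ℝ → ℝ) (t : ℝ) : ℝ := Real.tanh (f t / 2)

/-- The length `√(1 + f_t²)` of the velocity of the meridian. -/
def revSpeed (f : ℝ → ℝ) (t : ℝ) : ℝ := √(1 + deriv f t ^ 2)

/-- The hypersurface of revolution with profile `f`. -/
def revSurface (n : ℕ) (I : Set ℝ) (f : ℝ → ℝ) : Set (Amb n) :=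
  {p | p.2 ∈ I ∧ ‖p.1‖ = revRad f p.2}

/-- The unit normal of the hypersurface of revolution with profile `f`. -/
def revNormal (n : ℕ) (f : ℝ → ℝ) (p : Amb n) : Amb n :=
  ((-(1 / (revSpeed f p.2 * revFactor f p.2))) • (‖p.1‖⁻¹ • p.1), deriv f p.2 / revSpeed f p.2)

lemma catNormal_eq (n : ℕ) (a : ℝ) : catNormal n a = revNormal n (catF n a) := by
  ext1 p
  simp only [catNormal, revNormal, revSpeed, revFactor, Prod.smul_mk, smul_smul, smul_eq_mul]
  congr 1
  · congr 1
    rw [one_div_mul_eq_div, one_div ‖p.1‖]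
    field_simp
  · ring

lemma revFactor_pos (f : ℝ → ℝ) (t : ℝ) : 0 < revFactor f t := by
  have := Real.cosh_pos (f t / 2)
  unfold revFactor
  positivity

lemma revSpeed_pos (f : ℝ → ℝ) (t : ℝ) : 0 < revSpeed f t := by
  unfold revSpeed
  positivity

lemma revSpeed_sq (f : ℝ → ℝ) (t : ℝ) : revSpeed f t ^ 2 = 1 + deriv f t ^ 2 :=
  Real.sq_sqrt (by positivity)

lemma revRad_pos {f : ℝ → ℝ} {t : ℝ} (h : 0 < f t) : 0 < revRad f t := tanh_pos (by linarith)

lemma revRad_lt_one (f : ℝ → ℝ) (t : ℝ) : revRad f t < 1 := tanh_lt_one' _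

lemma hypFactor_eq_revFactor {n : ℕ} {f : ℝ → ℝ} {p : Amb n} (hp : ‖p.1‖ = revRad f p.2) :
    hypFactor p = revFactor f p.2 := by
  rw [hypFactor, hp, revRad, hyp_conformal_factor, revFactor]

lemma coth_eq_revRad {f : ℝ → ℝ} {t : ℝ} (h : 0 < f t) :
    Real.cosh (f t) / Real.sinh (f t) = 1 / (revFactor f t * revRad f t) + revRad f t := by
  have h3 : Real.sinh (f t) = 2 * Real.sinh (f t / 2) * Real.cosh (f t / 2) := by
    rw [← Real.sinh_two_mul]; ring_nf
  have h4 : Real.cosh (f t) = Real.cosh (f t / 2) ^ 2 + Real.sinh (f t / 2) ^ 2 := by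
    rw [← Real.cosh_two_mul]; ring_nf
  have h5 := Real.cosh_sq (f t / 2)
  rw [h3, h4, revFactor, revRad, Real.tanh_eq_sinh_div_cosh]
  field_simp
  linarith

lemma hasDerivAt_revRad {f : ℝ → ℝ} {t : ℝ} (hf : DifferentiableAt ℝ f t) :
    HasDerivAt (revRad f) (deriv f t / revFactor f t) t := by
  refine (HasDerivAt.comp t (hasDerivAt_tanh _) (hf.hasDerivAt.div_const 2)).congr_deriv ?_
  unfold revFactor
  have := Real.cosh_pos (f t / 2)
  field_simp

lemma hasDerivAt_revFactor {f : ℝ → ℝ} {t : ℝ} (hf : DifferentiableAt ℝ f t) :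
    HasDerivAt (revFactor f) (revFactor f t * revRad f t * deriv f t) t := by
  refine ((((hf.hasDerivAt.div_const 2).cosh).pow 2).const_mul 2).congr_deriv ?_
  have := Real.cosh_pos (f t / 2)
  rw [revFactor, revRad, Real.tanh_eq_sinh_div_cosh]
  field_simp
  simp
  ring

lemma hasDerivAt_revRad_deriv {f : ℝ → ℝ} {f₂ t : ℝ} (hf : DifferentiableAt ℝ f t)
    (hf₂ : HasDerivAt (deriv f) f₂ t) :
    HasDerivAt (fun t => deriv f t / revFactor f t)
      (f₂ / revFactor f t - deriv f t ^ 2 * revRad f t / revFactor f t) t := by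
  refine (hf₂.div (hasDerivAt_revFactor hf) (revFactor_pos f t).ne').congr_deriv ?_
  have := revFactor_pos f t
  field_simp

lemma hasDerivAt_revSpeed {f : ℝ → ℝ} {f₂ t : ℝ} (hf₂ : HasDerivAt (deriv f) f₂ t) :
    HasDerivAt (revSpeed f) (deriv f t * f₂ / revSpeed f t) t := by
  have h1 : (1 : ℝ) + deriv f t ^ 2 ≠ 0 := by positivity
  refine (((hf₂.pow 2).const_add 1).sqrt h1).congr_deriv ?_
  have := revSpeed_pos f t
  change _ / (2 * revSpeed f t) = _
  field_simp
  simp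
  ring

lemma hasDerivAt_revNormal_fst {f : ℝ → ℝ} {f₂ t : ℝ} (hf : DifferentiableAt ℝ f t)
    (hf₂ : HasDerivAt (deriv f) f₂ t) :
    HasDerivAt (fun t => -(1 / (revSpeed f t * revFactor f t)))
      (deriv f t * f₂ / (revSpeed f t ^ 3 * revFactor f t) +
        revRad f t * deriv f t / (revSpeed f t * revFactor f t)) t := by
  have h1 := revFactor_pos f t
  have h2 := revSpeed_pos f t
  refine (((hasDerivAt_const t (1 : ℝ)).div ((hasDerivAt_revSpeed hf₂).mul
    (hasDerivAt_revFactor hf)) (mul_pos h2 h1).ne').neg).congr_deriv ?_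
  simp only [Pi.mul_apply]
  field_simp
  ring

lemma hasDerivAt_revNormal_snd {f : ℝ → ℝ} {f₂ t : ℝ}
    (hf₂ : HasDerivAt (deriv f) f₂ t) :
    HasDerivAt (fun t => deriv f t / revSpeed f t) (f₂ / revSpeed f t ^ 3) t := by
  have h2 := revSpeed_pos f t
  have h3 := revSpeed_sq f t
  refine (hf₂.div (hasDerivAt_revSpeed hf₂) h2.ne').congr_deriv ?_
  field_simp
  rw [h3]
  ring

/-! ### Unit normal and shape operator of a hypersurface of revolution -/

section Point

variable {n : ℕ} {f : ℝ → ℝ} {f₂ : ℝ} {p : Amb n}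

lemma differentiableAt_revNormal (hp : p.1 ≠ 0) (hf : DifferentiableAt ℝ f p.2)
    (hf₂ : HasDerivAt (deriv f) f₂ p.2) : DifferentiableAt ℝ (revNormal n f) p := by
  have h1 : DifferentiableAt ℝ (fun q : Amb n => -(1 / (revSpeed f q.2 * revFactor f q.2))) p :=
    DifferentiableAt.comp (g := fun t => -(1 / (revSpeed f t * revFactor f t))) p
      (hasDerivAt_revNormal_fst hf hf₂).differentiableAt
      differentiableAt_snd
  have h2 : DifferentiableAt ℝ (fun q : Amb n => deriv f q.2 / revSpeed f q.2) p :=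
    DifferentiableAt.comp (g := fun t => deriv f t / revSpeed f t) p
      (hasDerivAt_revNormal_snd hf₂).differentiableAt differentiableAt_snd
  have h3 : DifferentiableAt ℝ (fun q : Amb n => ‖q.1‖) p := differentiableAt_fst.norm ℝ hp
  exact (h1.smul ((h3.inv (norm_ne_zero_iff.2 hp)).smul differentiableAt_fst)).prodMk h2

lemma hypMetric_revNormal_left (hp : ‖p.1‖ = revRad f p.2) (v : Amb n) :
    hypMetric n p (revNormal n f p) v =
      (deriv f p.2 * v.2 - revFactor f p.2 / revRad f p.2 * inner ℝ p.1 v.1) / revSpeed f p.2 := by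
  rw [hypMetric_apply, hypFactor_eq_revFactor hp, revNormal, hp]
  simp only [inner_smul_left, conj_trivial]
  field_simp
  ring

lemma hypMetric_revNormal_self (hp : ‖p.1‖ = revRad f p.2) (h0 : 0 < f p.2) :
    hypMetric n p (revNormal n f p) (revNormal n f p) = 1 := by
  have h1 := revFactor_pos f p.2
  have h2 := revSpeed_pos f p.2
  have h3 := revRad_pos h0
  rw [hypMetric_revNormal_left hp]
  simp only [revNormal, inner_smul_right, real_inner_self_eq_norm_sq, hp]
  field_simp
  linarith [revSpeed_sq f p.2]

lemma inner_of_tangent (hp : ‖p.1‖ = revRad f p.2) (h0 : 0 < f p.2) {e : Amb n}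
    (he : hypMetric n p (revNormal n f p) e = 0) :
    inner ℝ p.1 e.1 = revRad f p.2 * (deriv f p.2 / revFactor f p.2) * e.2 := by
  have h1 := revFactor_pos f p.2
  have h2 := revSpeed_pos f p.2
  have h3 := revRad_pos h0
  rw [hypMetric_revNormal_left hp, div_eq_zero_iff, or_iff_left h2.ne'] at he
  field_simp at he ⊢
  linarith

/-- The velocity of the meridian through `p`. -/
def revVelocity (n : ℕ) (f : ℝ → ℝ) (p : Amb n) : Amb n :=
  ((deriv f p.2 / (revFactor f p.2 * revRad f p.2)) • p.1, 1)

/-- The principal curvature of the meridians. -/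
def revCurvMeridian (f : ℝ → ℝ) (f₂ t : ℝ) : ℝ := f₂ / revSpeed f t ^ 3

/-- The principal curvature of the parallels. -/
def revCurvParallel (f : ℝ → ℝ) (t : ℝ) : ℝ :=
  -(1 / (revFactor f t * revRad f t) + revRad f t) / revSpeed f t

lemma hypMetric_revVelocity (hp : ‖p.1‖ = revRad f p.2) (h0 : 0 < f p.2) {e : Amb n}
    (he : hypMetric n p (revNormal n f p) e = 0) :
    hypMetric n p (revVelocity n f p) e = revSpeed f p.2 ^ 2 * e.2 := by
  have h1 := revFactor_pos f p.2
  have h3 := revRad_pos h0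
  rw [hypMetric_apply, revVelocity, hypFactor_eq_revFactor hp, inner_smul_left,
    inner_of_tangent hp h0 he, revSpeed_sq]
  simp only [conj_trivial]
  field_simp
  ring

/-- By `hypMetric_revVelocity`, the meridian component of a tangent vector e is e.2 times the
meridian velocity. The formula thus says that meridians and parallels are the principal directions.
-/
lemma covDeriv_revNormal (hp : ‖p.1‖ = revRad f p.2) (h0 : 0 < f p.2)
    (hf : DifferentiableAt ℝ f p.2) (hf₂ : HasDerivAt (deriv f) f₂ p.2) {e : Amb n}
    (he : hypMetric n p (revNormal n f p) e = 0) :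
    covDeriv (hypMetric n) (revNormal n f) p e = revCurvParallel f p.2 • e +
      ((revCurvMeridian f f₂ p.2 - revCurvParallel f p.2) * e.2) • revVelocity n f p := by
  have h1 := revFactor_pos f p.2
  have h3 := revRad_pos h0
  have hx : p.1 ≠ 0 := norm_ne_zero_iff.1 (by rw [hp]; exact h3.ne')
  have hlt : ‖p.1‖ < 1 := by rw [hp]; exact revRad_lt_one f _
  have hin := inner_of_tangent hp h0 he
  -- The derivative of the normal is computed along the straight line p + s e. That line need not
  -- stay in the hypersurface, which is harmless because the normal field extends to a
  -- neighbourhood.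
  have hq : HasDerivAt (fun s : ℝ => p + s • e) e 0 := by
    simpa using ((hasDerivAt_id (0 : ℝ)).smul_const e).const_add p
  have hq0 : p + (0 : ℝ) • e = p := by simp
  have hq1 : HasDerivAt (fun s : ℝ => p.1 + s • e.1) e.1 0 := by
    simpa using ((hasDerivAt_id (0 : ℝ)).smul_const e.1).const_add p.1
  have hq2 : HasDerivAt (fun s : ℝ => p.2 + s * e.2) e.2 0 := by
    simpa using ((hasDerivAt_id (0 : ℝ)).mul_const e.2).const_add p.2
  have hnorm : HasDerivAt (fun s : ℝ => ‖p.1 + s • e.1‖) (inner ℝ p.1 e.1 / ‖p.1‖) 0 := by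
    have := (hq1.norm_sq).sqrt (by simpa using hx)
    simp only [Real.sqrt_sq (norm_nonneg _)] at this
    refine this.congr_deriv ?_
    simp only [zero_smul, add_zero]
    rw [mul_div_mul_left _ _ two_ne_zero]
  have hc2 : ∀ {g : ℝ → ℝ} {g' : ℝ}, HasDerivAt g g' p.2 →
      HasDerivAt (fun s : ℝ => g (p.2 + s * e.2)) (g' * e.2) 0 := fun {g g'} hg =>
    HasDerivAt.comp (0 : ℝ) (h₂ := g) (h := fun s : ℝ => p.2 + s * e.2) (by simpa using hg) hq2
  have hline : HasDerivAt (fun s : ℝ => revNormal n f (p + s • e)) _ 0 :=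
    ((hc2 (hasDerivAt_revNormal_fst hf hf₂)).smul ((hnorm.inv (by simpa using hx)).smul hq1)).prodMk
      (hc2 (hasDerivAt_revNormal_snd hf₂))
  have hchain : HasDerivAt (fun s : ℝ => revNormal n f (p + s • e))
      (fderiv ℝ (revNormal n f) p e) 0 :=
    HasFDerivAt.comp_hasDerivAt (0 : ℝ) (l := revNormal n f)
      (l' := fderiv ℝ (revNormal n f) p) (f := fun s : ℝ => p + s • e)
      (by rw [hq0]; exact (differentiableAt_revNormal hx hf hf₂).hasFDerivAt) hq
  rw [covDeriv, christoffel_eq hlt, hchain.unique hline, hypGamma, hypFactor_eq_revFactor hp]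
  simp only [Pi.inv_apply, Pi.smul_apply', zero_smul, zero_mul, add_zero, hin, hp, revNormal, inner_smul_right,
    real_inner_self_eq_norm_sq, real_inner_comm p.1 e.1, revVelocity, revCurvParallel,
    revCurvMeridian]
  refine Prod.ext ?_ ?_
  · simp only [Prod.fst_add, Prod.smul_fst]
    match_scalars
    · field_simp
      ring
    · field_simp
      ring
  · simp only [Prod.snd_add, Prod.smul_snd, smul_eq_mul]
    field_simp
    ring

end Point

/-! ### Second derivatives at a maximum on a hypersurface of revolution -/

/-- If the second derivative were positive, the point would also be a local minimum, so the function
would be locally constant and its second derivative zero. -/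
lemma second_deriv_nonpos_of_isLocalMax {g g₁ : ℝ → ℝ} {g₂ x : ℝ} (hmax : IsLocalMax g x)
    (h₁ : ∀ᶠ s in 𝓝 x, HasDerivAt g (g₁ s) s) (h₂ : HasDerivAt g₁ g₂ x) : g₂ ≤ 0 := by
  by_contra! hpos
  have hev : deriv g =ᶠ[𝓝 x] g₁ := h₁.mono fun s hs => hs.deriv
  have hdd : deriv (deriv g) x = g₂ := by rw [hev.deriv_eq, h₂.deriv]
  have hmin : IsLocalMin g x := isLocalMin_of_deriv_deriv_pos (by rw [hdd]; exact hpos)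
    hmax.deriv_eq_zero h₁.self_of_nhds.continuousAt
  have hconst : g =ᶠ[𝓝 x] fun _ => g x := by
    filter_upwards [hmax, hmin] with s h h' using le_antisymm h h'
  have h0 : deriv g =ᶠ[𝓝 x] fun _ => 0 := by
    filter_upwards [hconst.eventuallyEq_nhds] with s hs
    rw [hs.deriv_eq, deriv_const]
  rw [h0.deriv_eq, deriv_const] at hdd
  linarith

lemma ContDiffAt.differentiableAt_fderiv_of_two {E : Type*} [NormedAddCommGroup E]
    [NormedSpace ℝ E] {φ : E → ℝ} {p : E} (h : ContDiffAt ℝ 2 φ p) :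
    DifferentiableAt ℝ (fderiv ℝ φ) p :=
  (h.fderiv_right (m := 1) (by norm_num)).differentiableAt (by norm_num)

lemma ContDiffAt.eventually_differentiableAt_of_two {E : Type*} [NormedAddCommGroup E]
    [NormedSpace ℝ E] {φ : E → ℝ} {p : E} (h : ContDiffAt ℝ 2 φ p) :
    ∀ᶠ q in 𝓝 p, DifferentiableAt ℝ φ q :=
  (h.eventually (by simp)).mono fun _ hq => hq.differentiableAt (by norm_num)

section Curve

variable {n : ℕ} {I : Set ℝ} {f f₂ : ℝ → ℝ} {p : Amb n}

/-- Through every point of a hypersurface of revolution and in every tangent direction there is a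
curve in the hypersurface, of which the acceleration is known. -/
lemma exists_curve_revSurface (hI : IsOpen I) (hpos : ∀ t ∈ I, 0 < f t)
    (hf : ∀ t ∈ I, DifferentiableAt ℝ f t) (hf₂ : ∀ t ∈ I, HasDerivAt (deriv f) (f₂ t) t)
    (hp : p ∈ revSurface n I f) {e : Amb n} (he : hypMetric n p (revNormal n f p) e = 0) :
    ∃ (c c₁ : ℝ → Amb n) (c₂ : Amb n), c 0 = p ∧ c₁ 0 = e ∧
      (∀ᶠ s in 𝓝 (0 : ℝ), c s ∈ revSurface n I f) ∧
      (∀ᶠ s in 𝓝 (0 : ℝ), HasDerivAt c (c₁ s) s) ∧ HasDerivAt c₁ c₂ 0 ∧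
      hypMetric n p (revNormal n f p) (c₂ + hypGamma p e e) =
        - hypMetric n p (covDeriv (hypMetric n) (revNormal n f) p e) e := by
  obtain ⟨hpI, hpr⟩ := hp
  have h0 := hpos _ hpI
  have h1 := revFactor_pos f p.2
  have h2 := revSpeed_pos f p.2
  have h3 := revRad_pos h0
  have hin := inner_of_tangent hpr h0 he
  set r := revRad f p.2 with hr
  set z := e.2 with hz
  set dr : ℝ → ℝ := fun t => deriv f t / revFactor f t with hdr
  -- The part of the horizontal component of e that is orthogonal to the radius, that is, tangent to
  -- the parallel.
  set η := e.1 - (z * dr p.2 / r) • p.1 with hη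
  have hxη : inner ℝ p.1 η = 0 := by
    rw [hη, inner_sub_right, hin, inner_smul_right, real_inner_self_eq_norm_sq, hpr, hdr]
    field_simp
    ring
  have heη : e.1 = η + (z * dr p.2 / r) • p.1 := by rw [hη]; simp
  set D : ℝ → ℝ := fun s => √(r ^ 2 + s ^ 2 * ‖η‖ ^ 2) with hD
  have hDpos : ∀ s, 0 < D s := fun s => Real.sqrt_pos.2 (by positivity)
  have hD0 : D 0 = r := by simp [hD, Real.sqrt_sq h3.le]
  have hDd : ∀ s, HasDerivAt D (s * ‖η‖ ^ 2 / D s) s := by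
    intro s
    have := ((((hasDerivAt_id s).pow 2).mul_const (‖η‖ ^ 2)).const_add (r ^ 2)).sqrt
      (show r ^ 2 + s ^ 2 * ‖η‖ ^ 2 ≠ 0 by positivity)
    refine this.congr_deriv ?_
    have hs := hDpos s
    change _ / (2 * D s) = _
    field_simp
    simp
    ring
  set R : ℝ → ℝ := fun s => revRad f (p.2 + s * z) with hR
  have hline : ∀ s, HasDerivAt (fun s : ℝ => p.2 + s * z) z s := fun s => by
    simpa using ((hasDerivAt_id s).mul_const z).const_add p.2
  have hRd : ∀ s, p.2 + s * z ∈ I → HasDerivAt R (dr (p.2 + s * z) * z) s := fun s hs =>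
    HasDerivAt.comp s (h₂ := revRad f) (h := fun s => p.2 + s * z)
      (hasDerivAt_revRad (hf _ hs)) (hline s)
  have hdrd : HasDerivAt (fun s => dr (p.2 + s * z))
      ((f₂ p.2 / revFactor f p.2 - deriv f p.2 ^ 2 * r / revFactor f p.2) * z) 0 := by
    refine HasDerivAt.comp (0 : ℝ) (h₂ := dr) (h := fun s => p.2 + s * z) ?_ (hline 0)
    simpa using hasDerivAt_revRad_deriv (hf _ hpI) (hf₂ _ hpI)
  have hIev : ∀ᶠ s in 𝓝 (0 : ℝ), p.2 + s * z ∈ I :=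
    (hline 0).continuousAt.eventually_mem (hI.mem_nhds (by simpa using hpI))
  -- The curve is s ↦ (k(s)(x + s η), t + s z). Dividing by D = |x + s η| and multiplying by the
  -- radius R at height t + s z puts it on the hypersurface.
  set k : ℝ → ℝ := fun s => R s / D s with hk
  set k₁ : ℝ → ℝ := fun s => dr (p.2 + s * z) * z / D s - R s * (s * ‖η‖ ^ 2) / D s ^ 3 with hk₁
  have hkd : ∀ᶠ s in 𝓝 (0 : ℝ), HasDerivAt k (k₁ s) s := by
    filter_upwards [hIev] with s hs
    refine ((hRd s hs).div (hDd s) (hDpos s).ne').congr_deriv ?_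
    have := hDpos s
    simp only [hk₁]
    field_simp
  have hR0 : R 0 = r := by simp [hR, hr]
  set k₂ := (f₂ p.2 / revFactor f p.2 - deriv f p.2 ^ 2 * r / revFactor f p.2) * z ^ 2 / r -
    ‖η‖ ^ 2 / r ^ 2 with hk₂
  have hk₁d : HasDerivAt k₁ k₂ 0 := by
    have h4 := ((hdrd.mul_const z).div (hDd 0) (hDpos 0).ne').sub
      (((hRd 0 (by simpa using hpI)).mul ((hasDerivAt_id (0 : ℝ)).mul_const (‖η‖ ^ 2))).div
        ((hDd 0).pow 3) (pow_pos (hDpos 0) 3).ne')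
    refine h4.congr_deriv ?_
    simp only [Pi.mul_apply, Pi.pow_apply, hD0, hR0, id, hk₂]
    field_simp
    ring
  have hk0 : k 0 = 1 := by rw [hk]; simp only [hR0, hD0]; exact div_self h3.ne'
  have hk₁0 : k₁ 0 = dr p.2 * z / r := by simp [hk₁, hD0]
  have hv : ∀ s, HasDerivAt (fun s : ℝ => p.1 + s • η) η s := fun s => by
    simpa using ((hasDerivAt_id s).smul_const η).const_add p.1
  have hnorm : ∀ s, ‖p.1 + s • η‖ = D s := fun s => by
    rw [hD, ← Real.sqrt_sq (norm_nonneg (p.1 + s • η)), norm_add_sq_real, inner_smul_right, hxη,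
      hpr, norm_smul, mul_pow, Real.norm_eq_abs, sq_abs]
    simp
  have hc₁d : HasDerivAt (fun s => ((k₁ s • (p.1 + s • η) + k s • η, z) : Amb n))
      (k₂ • p.1 + (2 * (dr p.2 * z / r)) • η, 0) 0 := by
    have h5 := ((hk₁d.smul (hv 0)).add (hkd.self_of_nhds.smul_const η)).prodMk
      (hasDerivAt_const (0 : ℝ) z)
    refine h5.congr_deriv ?_
    simp only [zero_smul, add_zero, hk₁0]
    congr 1
    module
  refine ⟨fun s => (k s • (p.1 + s • η), p.2 + s * z),
    fun s => (k₁ s • (p.1 + s • η) + k s • η, z),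
    (k₂ • p.1 + (2 * (dr p.2 * z / r)) • η, 0), ?_, ?_, ?_, ?_, hc₁d, ?_⟩
  · simp [hk0]
  · refine Prod.ext ?_ hz
    simp only [zero_smul, add_zero, hk0, hk₁0, one_smul, heη]
    module
  · filter_upwards [hIev] with s hs
    refine ⟨hs, ?_⟩
    have := revRad_pos (hpos _ hs)
    have hD' := hDpos s
    rw [norm_smul, hnorm, hk, Real.norm_of_nonneg (by positivity)]
    exact div_mul_cancel₀ _ hD'.ne'
  · filter_upwards [hkd] with s hs
    refine ((hs.smul (hv s)).prodMk (hline s)).congr_deriv ?_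
    rw [add_comm]
  · have hine : inner ℝ e.1 e.1 = ‖η‖ ^ 2 + (z * dr p.2) ^ 2 := by
      rw [heη, real_inner_self_eq_norm_sq,
        norm_add_sq_real, inner_smul_right, real_inner_comm, hxη, norm_smul, hpr, mul_pow,
        Real.norm_eq_abs, sq_abs]
      field_simp
      ring
    have hee : hypMetric n p e e = revFactor f p.2 ^ 2 * (‖η‖ ^ 2 + (z * dr p.2) ^ 2) + z ^ 2 := by
      rw [hypMetric_apply, hypFactor_eq_revFactor hpr, hine, ← sq, hz]
    rw [covDeriv_revNormal hpr h0 (hf _ hpI) (hf₂ _ hpI) he, hypMetric_add_left,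
      hypMetric_smul_left, hypMetric_smul_left, hypMetric_revVelocity hpr h0 he, hee,
      hypMetric_revNormal_left hpr]
    simp only [hypGamma, Prod.fst_add, Prod.snd_add, add_zero, inner_add_right, inner_smul_right,
      inner_sub_right, real_inner_self_eq_norm_sq, hxη, hin, hine, hpr,
      hypFactor_eq_revFactor hpr, revCurvMeridian, revCurvParallel, hk₂]
    have hW := revSpeed_sq f p.2
    simp only [hdr, ← hr, ← hz]
    generalize revSpeed f p.2 = W at *
    generalize revFactor f p.2 = ρ at *
    generalize deriv f p.2 = f1 at *
    field_simp
    linear_combination (r * z ^ 2 * (1 + ρ * r ^ 2)) * hW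

/-- The Hessian of the hypersurface is non-positive at a local maximum. -/
lemma hessian_nonpos_of_isLocalMaxOn (hI : IsOpen I) (hpos : ∀ t ∈ I, 0 < f t)
    (hf : ∀ t ∈ I, DifferentiableAt ℝ f t) (hf₂ : ∀ t ∈ I, HasDerivAt (deriv f) (f₂ t) t)
    (hp : p ∈ revSurface n I f) {χ : Amb n → ℝ} (hχ : ContDiffAt ℝ 2 χ p)
    (hmax : IsLocalMaxOn χ (revSurface n I f) p) {e : Amb n}
    (he : hypMetric n p (revNormal n f p) e = 0) :
    fderiv ℝ (fderiv ℝ χ) p e e - fderiv ℝ χ p (hypGamma p e e) -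
      fderiv ℝ χ p (revNormal n f p) *
        hypMetric n p (covDeriv (hypMetric n) (revNormal n f) p e) e ≤ 0 := by
  have hcomp : ∀ c : ℝ → Amb n, ContinuousAt c 0 → c 0 = p →
      (∀ᶠ s in 𝓝 (0 : ℝ), c s ∈ revSurface n I f) → IsLocalMax (χ ∘ c) 0 := by
    intro c hc h0 hM
    have ht : Tendsto c (𝓝 0) (𝓝[revSurface n I f] p) :=
      tendsto_nhdsWithin_iff.2 ⟨by rw [← h0]; exact hc, hM⟩
    filter_upwards [ht.eventually hmax] with s hs
    simpa [h0] using hs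
  have hdχ : DifferentiableAt ℝ χ p := hχ.differentiableAt (by norm_num)
  have htan : ∀ v : Amb n, hypMetric n p (revNormal n f p) v = 0 → fderiv ℝ χ p v = 0 := by
    intro v hv
    obtain ⟨c, c₁, c₂, h0, h1, hM, hc, -, -⟩ := exists_curve_revSurface hI hpos hf hf₂ hp hv
    have hc0 := hc.self_of_nhds
    refine (hcomp c hc0.continuousAt h0 hM).hasDerivAt_eq_zero ?_
    rw [← h1]
    exact HasFDerivAt.comp_hasDerivAt (0 : ℝ) (l := χ) (by rw [h0]; exact hdχ.hasFDerivAt) hc0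
  have hN1 := hypMetric_revNormal_self hp.2 (hpos _ hp.1)
  -- Since dχ vanishes on tangent vectors, it is a multiple of g(N, ·). So only the normal part of
  -- the acceleration of the curve matters, and that part is given by the second fundamental form.
  have hμ : ∀ v : Amb n, fderiv ℝ χ p v =
      fderiv ℝ χ p (revNormal n f p) * hypMetric n p (revNormal n f p) v := by
    intro v
    have h := htan (v - hypMetric n p (revNormal n f p) v • revNormal n f p) (by
      rw [hypMetric_comm, hypMetric_sub_left, hypMetric_smul_left, hN1, hypMetric_comm p v]
      ring)
    rw [map_sub, map_smul, smul_eq_mul, sub_eq_zero] at h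
    rw [h, mul_comm]
  obtain ⟨c, c₁, c₂, h0, h1, hM, hc, hc₁, hacc⟩ := exists_curve_revSurface hI hpos hf hf₂ hp he
  have hc0 := hc.self_of_nhds
  have hd1 : ∀ᶠ s in 𝓝 (0 : ℝ), HasDerivAt (χ ∘ c) (fderiv ℝ χ (c s) (c₁ s)) s := by
    have ht : Tendsto c (𝓝 0) (𝓝 p) := by rw [← h0]; exact hc0.continuousAt
    filter_upwards [hc, ht.eventually hχ.eventually_differentiableAt_of_two] with s hs hs'
    exact hs'.hasFDerivAt.comp_hasDerivAt s hs
  have hd2 : HasDerivAt (fun s => fderiv ℝ χ (c s) (c₁ s))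
      (fderiv ℝ (fderiv ℝ χ) p e e + fderiv ℝ χ p c₂) 0 := by
    have h2 : HasDerivAt (fun s => fderiv ℝ χ (c s)) (fderiv ℝ (fderiv ℝ χ) p (c₁ 0)) 0 :=
      HasFDerivAt.comp_hasDerivAt (0 : ℝ) (l := fderiv ℝ χ)
        (by rw [h0]; exact hχ.differentiableAt_fderiv_of_two.hasFDerivAt) hc0
    have h3 := h2.clm_apply hc₁
    rwa [h0, h1] at h3
  have hle := second_deriv_nonpos_of_isLocalMax (hcomp c hc0.continuousAt h0 hM) hd1 hd2
  have h4 : fderiv ℝ χ p c₂ + fderiv ℝ χ p (hypGamma p e e) =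
      -(fderiv ℝ χ p (revNormal n f p) *
        hypMetric n p (covDeriv (hypMetric n) (revNormal n f) p e) e) := by
    rw [← map_add, hμ, hacc]
    ring
  linarith

end Curve

/-! ### The Jacobi operator of a minimal hypersurface of revolution -/

section Jacobi

variable {n : ℕ} {f : ℝ → ℝ} {f₂ : ℝ} {p : Amb n}

/-- Parseval applied to the vertical field ∂_t, whose tangential part has squared length 1 - f_t² /
(1 + f_t²). -/
lemma sum_tangentFrame_snd_sq (hp : ‖p.1‖ = revRad f p.2) (h0 : 0 < f p.2) :
    ∑ i, (tangentFrame (hypMetric n) (revNormal n f) p i).2 ^ 2 = 1 / revSpeed f p.2 ^ 2 := by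
  have hlt : ‖p.1‖ < 1 := by rw [hp]; exact revRad_lt_one f _
  have h := tangentFrame_parseval hlt (hypMetric_revNormal_self hp h0) (0, 1) (0, 1)
  have hg : ∀ v : Amb n, hypMetric n p (0, 1) v = v.2 := fun v => by simp [hypMetric_apply]
  simp only [hg] at h
  rw [Finset.sum_congr rfl fun i _ => sq _, h, revNormal]
  have h2 := revSpeed_pos f p.2
  have h3 := revSpeed_sq f p.2
  field_simp
  linarith

/-- In a tangent frame the second fundamental form is a multiple of the identity plus a rank-one
matrix built from the vertical components. Traces and norms then need only the sum of their squares.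
-/
lemma hypMetric_covDeriv_revNormal (hp : ‖p.1‖ = revRad f p.2) (h0 : 0 < f p.2)
    (hf : DifferentiableAt ℝ f p.2) (hf₂ : HasDerivAt (deriv f) f₂ p.2) (i j : Fin n) :
    hypMetric n p (covDeriv (hypMetric n) (revNormal n f) p
        (tangentFrame (hypMetric n) (revNormal n f) p i))
        (tangentFrame (hypMetric n) (revNormal n f) p j) =
      (if i = j then revCurvParallel f p.2 else 0) +
        (revCurvMeridian f f₂ p.2 - revCurvParallel f p.2) * revSpeed f p.2 ^ 2 *
        ((tangentFrame (hypMetric n) (revNormal n f) p i).2 *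
          (tangentFrame (hypMetric n) (revNormal n f) p j).2) := by
  have hlt : ‖p.1‖ < 1 := by rw [hp]; exact revRad_lt_one f _
  obtain ⟨h1, h2⟩ := tangentFrame_spec hlt (hypMetric_revNormal_self hp h0)
  rw [covDeriv_revNormal hp h0 hf hf₂ (h1 i), hypMetric_add_left, hypMetric_smul_left,
    hypMetric_smul_left, hypMetric_revVelocity hp h0 (h1 j), h2 i j]
  split_ifs <;> ring

/-- The mean curvature. -/
lemma sum_covDeriv_revNormal (hp : ‖p.1‖ = revRad f p.2) (h0 : 0 < f p.2)
    (hf : DifferentiableAt ℝ f p.2) (hf₂ : HasDerivAt (deriv f) f₂ p.2) :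
    ∑ i, hypMetric n p (covDeriv (hypMetric n) (revNormal n f) p
        (tangentFrame (hypMetric n) (revNormal n f) p i))
        (tangentFrame (hypMetric n) (revNormal n f) p i) =
      ((n : ℝ) - 1) * revCurvParallel f p.2 + revCurvMeridian f f₂ p.2 := by
  have h2 := revSpeed_pos f p.2
  rw [Finset.sum_congr rfl fun i _ => hypMetric_covDeriv_revNormal hp h0 hf hf₂ i i,
    Finset.sum_add_distrib, ← Finset.mul_sum,
    Finset.sum_congr (g := fun i => (tangentFrame (hypMetric n) (revNormal n f) p i).2 ^ 2) rfl
      (fun i _ => (sq _).symm), sum_tangentFrame_snd_sq hp h0]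
  simp
  field_simp
  ring

lemma normSqSecondFF_revNormal (hp : ‖p.1‖ = revRad f p.2) (h0 : 0 < f p.2)
    (hf : DifferentiableAt ℝ f p.2) (hf₂ : HasDerivAt (deriv f) f₂ p.2) :
    normSqSecondFF (hypMetric n) (revNormal n f) p =
      ((n : ℝ) - 1) * revCurvParallel f p.2 ^ 2 + revCurvMeridian f f₂ p.2 ^ 2 := by
  have h2 := revSpeed_pos f p.2
  have hs := sum_tangentFrame_snd_sq hp h0
  simp only [normSqSecondFF, hypMetric_covDeriv_revNormal hp h0 hf hf₂]
  generalize revCurvParallel f p.2 = k at *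
  generalize (revCurvMeridian f f₂ p.2) = κ at *
  set z : Fin n → ℝ := fun i => (tangentFrame (hypMetric n) (revNormal n f) p i).2 with hz
  set c := (κ - k) * revSpeed f p.2 ^ 2 with hc
  have hs' : ∑ i, z i ^ 2 = 1 / revSpeed f p.2 ^ 2 := hs
  have h3 : ∀ i j : Fin n, ((if i = j then k else 0) + c * (z i * z j)) ^ 2 =
      (if i = j then k ^ 2 + 2 * k * c * (z i * z j) else 0) + c ^ 2 * (z i ^ 2 * z j ^ 2) := by
    intro i j
    split_ifs <;> ring
  have h4 : ∑ i, ∑ j, ((if i = j then k else 0) + c * (z i * z j)) ^ 2 =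
      n * k ^ 2 + 2 * k * c * ∑ i, z i ^ 2 + c ^ 2 * ((∑ i, z i ^ 2) * ∑ i, z i ^ 2) := by
    simp only [h3, Finset.sum_add_distrib, ← Finset.mul_sum, ← Finset.sum_mul]
    simp [Finset.sum_add_distrib, ← Finset.mul_sum, ← sq]
  change ∑ i, ∑ j, ((if i = j then k else 0) + c * (z i * z j)) ^ 2 = _
  rw [h4, hs', hc]
  field_simp
  ring

/-- The data of a minimal hypersurface of revolution at one of its points. -/
structure IsMinimalPoint (n : ℕ) (f : ℝ → ℝ) (p : Amb n) : Prop where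
  norm_fst : ‖p.1‖ = revRad f p.2
  pos : 0 < f p.2
  differentiableAt : DifferentiableAt ℝ f p.2
  ode : HasDerivAt (deriv f)
    (((n : ℝ) - 1) * (Real.cosh (f p.2) / Real.sinh (f p.2)) * (1 + deriv f p.2 ^ 2)) p.2

lemma IsMinimalPoint.norm_lt_one (h : IsMinimalPoint n f p) : ‖p.1‖ < 1 := by
  rw [h.norm_fst]; exact revRad_lt_one f _

lemma IsMinimalPoint.differentiableAt_revNormal (h : IsMinimalPoint n f p) :
    DifferentiableAt ℝ (revNormal n f) p := by
  refine _root_.differentiableAt_revNormal (norm_ne_zero_iff.1 ?_) h.differentiableAt h.ode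
  rw [h.norm_fst]
  exact (revRad_pos h.pos).ne'

/-- The catenary equation in geometric form: the mean curvature vanishes. -/
lemma IsMinimalPoint.curvMeridian (h : IsMinimalPoint n f p) :
    revCurvMeridian f (((n : ℝ) - 1) * (Real.cosh (f p.2) / Real.sinh (f p.2)) *
      (1 + deriv f p.2 ^ 2)) p.2 = -((n : ℝ) - 1) * revCurvParallel f p.2 := by
  rw [revCurvMeridian, revCurvParallel, ← coth_eq_revRad h.pos, ← revSpeed_sq]
  field_simp

/-- Vanishing mean curvature kills the term in dφ(N), and the Laplacian becomes the trace of the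
ambient Hessian over the tangent space. -/
lemma IsMinimalPoint.laplaceHyp_eq (h : IsMinimalPoint n f p) {φ : Amb n → ℝ}
    (hφ : ContDiffAt ℝ 2 φ p) :
    laplaceHyp (hypMetric n) (revNormal n f) φ p = ∑ i,
      (fderiv ℝ (fderiv ℝ φ) p (tangentFrame (hypMetric n) (revNormal n f) p i)
          (tangentFrame (hypMetric n) (revNormal n f) p i) -
        fderiv ℝ φ p (hypGamma p (tangentFrame (hypMetric n) (revNormal n f) p i)
          (tangentFrame (hypMetric n) (revNormal n f) p i))) := by
  rw [_root_.laplaceHyp_eq h.norm_lt_one hφ.differentiableAt_fderiv_of_two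
    h.differentiableAt_revNormal (hypMetric_revNormal_self h.norm_fst h.pos),
    Finset.sum_sub_distrib, ← Finset.mul_sum, sum_covDeriv_revNormal h.norm_fst h.pos
    h.differentiableAt h.ode, h.curvMeridian]
  ring

lemma IsMinimalPoint.laplaceHyp_sub (h : IsMinimalPoint n f p) {φ ψ : Amb n → ℝ}
    (hφ : ContDiffAt ℝ 2 φ p) (hψ : ContDiffAt ℝ 2 ψ p) :
    laplaceHyp (hypMetric n) (revNormal n f) (φ - ψ) p =
      laplaceHyp (hypMetric n) (revNormal n f) φ p -
        laplaceHyp (hypMetric n) (revNormal n f) ψ p := by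
  have hev : fderiv ℝ (φ - ψ) =ᶠ[𝓝 p] fderiv ℝ φ - fderiv ℝ ψ := by
    filter_upwards [hφ.eventually_differentiableAt_of_two, hψ.eventually_differentiableAt_of_two]
      with q h1 h2
    rw [fderiv_sub h1 h2, Pi.sub_apply]
  rw [h.laplaceHyp_eq hφ, h.laplaceHyp_eq hψ, h.laplaceHyp_eq (φ := φ - ψ) (hφ.sub hψ),
    ← Finset.sum_sub_distrib, hev.fderiv_eq, hev.eq_of_nhds,
    fderiv_sub hφ.differentiableAt_fderiv_of_two hψ.differentiableAt_fderiv_of_two]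
  refine Finset.sum_congr rfl fun i _ => ?_
  simp only [Pi.sub_apply, sub_apply]
  ring

/-- The Laplacian of a function of `t`. -/
lemma IsMinimalPoint.laplaceHyp_comp_snd (h : IsMinimalPoint n f p) {w : ℝ → ℝ}
    {w₁ : ℝ → ℝ} {w₂ : ℝ} (hw : ContDiffAt ℝ 2 w p.2)
    (hw₁ : ∀ᶠ t in 𝓝 p.2, HasDerivAt w (w₁ t) t) (hw₂ : HasDerivAt w₁ w₂ p.2) :
    laplaceHyp (hypMetric n) (revNormal n f) (fun q => w q.2) p = w₂ / revSpeed f p.2 ^ 2 := by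
  have hc : ContDiffAt ℝ 2 (fun q : Amb n => w q.2) p := hw.comp p contDiffAt_snd
  have hev : fderiv ℝ (fun q : Amb n => w q.2) =ᶠ[𝓝 p]
      fun q => w₁ q.2 • ContinuousLinearMap.snd ℝ (EuclideanSpace ℝ (Fin n)) ℝ := by
    filter_upwards [continuousAt_snd.eventually hw₁] with q hq
    exact (hq.comp_hasFDerivAt q hasFDerivAt_snd).fderiv
  have hd : HasFDerivAt
      (fun q : Amb n => w₁ q.2 • ContinuousLinearMap.snd ℝ (EuclideanSpace ℝ (Fin n)) ℝ) _ p :=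
    (HasDerivAt.comp_hasFDerivAt (h₂ := w₁) (f := fun q : Amb n => q.2) p hw₂
      (hasFDerivAt_snd (𝕜 := ℝ) (p := p))).smul_const _
  rw [h.laplaceHyp_eq hc, hev.fderiv_eq, hev.eq_of_nhds, hd.fderiv]
  have h3 : ∀ e : Amb n, (hypGamma p e e).2 = 0 := fun _ => rfl
  simp only [ContinuousLinearMap.smulRight_apply, smul_apply,
    ContinuousLinearMap.coe_snd', smul_eq_mul, h3, mul_zero, sub_zero]
  rw [div_eq_mul_one_div, ← sum_tangentFrame_snd_sq h.norm_fst h.pos, Finset.mul_sum]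
  exact Finset.sum_congr rfl fun i _ => by ring

/-- The potential of the Jacobi operator. -/
lemma IsMinimalPoint.potential (h : IsMinimalPoint n f p) :
    normSqSecondFF (hypMetric n) (revNormal n f) p +
      ricci (hypMetric n) p (revNormal n f p) (revNormal n f p) =
      (((n : ℝ) - 1) * (((n : ℝ) - 1) + 1) * (Real.cosh (f p.2) / Real.sinh (f p.2)) ^ 2 -
        ((n : ℝ) - 1)) / revSpeed f p.2 ^ 2 := by
  have h1 := revFactor_pos f p.2
  have h3 := revRad_pos h.pos
  rw [normSqSecondFF_revNormal h.norm_fst h.pos h.differentiableAt h.ode, h.curvMeridian,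
    ricci_eq h.norm_lt_one, hypFactor_eq_revFactor h.norm_fst, revCurvParallel,
    ← coth_eq_revRad h.pos]
  simp only [revNormal, inner_smul_left, inner_smul_right, real_inner_self_eq_norm_sq,
    h.norm_fst, conj_trivial]
  field_simp
  ring

lemma IsMinimalPoint.jacobiOp_comp_snd (h : IsMinimalPoint n f p) {w : ℝ → ℝ}
    {w₁ : ℝ → ℝ} {w₂ : ℝ} (hw : ContDiffAt ℝ 2 w p.2)
    (hw₁ : ∀ᶠ t in 𝓝 p.2, HasDerivAt w (w₁ t) t) (hw₂ : HasDerivAt w₁ w₂ p.2) :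
    jacobiOp (hypMetric n) (revNormal n f) (fun q => w q.2) p =
      -(w₂ + (((n : ℝ) - 1) * (((n : ℝ) - 1) + 1) *
        (Real.cosh (f p.2) / Real.sinh (f p.2)) ^ 2 - ((n : ℝ) - 1)) * w p.2) /
        (1 + deriv f p.2 ^ 2) := by
  rw [jacobiOp, h.laplaceHyp_comp_snd hw hw₁ hw₂, h.potential, ← revSpeed_sq]
  ring

lemma IsMinimalPoint.jacobiOp_neg (h : IsMinimalPoint n f p) {φ : Amb n → ℝ}
    (hφ : ContDiffAt ℝ 2 φ p) :
    jacobiOp (hypMetric n) (revNormal n f) (-φ) p =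
      -jacobiOp (hypMetric n) (revNormal n f) φ p := by
  have h0 : ContDiffAt ℝ 2 (0 : Amb n → ℝ) p := contDiffAt_const
  have h1 := h.laplaceHyp_sub h0 hφ
  have h2 := h.laplaceHyp_sub h0 h0
  simp only [zero_sub, sub_self] at h1 h2
  rw [jacobiOp, jacobiOp, h1, h2, Pi.neg_apply]
  ring

/-- Comparison at a point of contact with a rotationally symmetric function. -/
lemma IsMinimalPoint.jacobiOp_le (h : IsMinimalPoint n f p) {I : Set ℝ} {f' : ℝ → ℝ}
    (hI : IsOpen I) (hpos : ∀ t ∈ I, 0 < f t) (hpI : p.2 ∈ I)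
    (hf : ∀ t ∈ I, DifferentiableAt ℝ f t) (hf₂ : ∀ t ∈ I, HasDerivAt (deriv f) (f' t) t)
    {φ : Amb n → ℝ} (hφ : ContDiffAt ℝ 2 φ p) {w : ℝ → ℝ} (hw : ContDiffAt ℝ 2 w p.2)
    (hle : ∀ᶠ q in 𝓝[revSurface n I f] p, φ q ≤ w q.2) (heq : φ p = w p.2) :
    jacobiOp (hypMetric n) (revNormal n f) (fun q => w q.2) p ≤
      jacobiOp (hypMetric n) (revNormal n f) φ p := by
  have hp : p ∈ revSurface n I f := ⟨hpI, h.norm_fst⟩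
  have hwc : ContDiffAt ℝ 2 (fun q : Amb n => w q.2) p := hw.comp p contDiffAt_snd
  have hmax : IsLocalMaxOn (φ - fun q : Amb n => w q.2) (revSurface n I f) p := by
    filter_upwards [hle] with q hq
    simp only [Pi.sub_apply, heq, sub_self]
    linarith
  have hle0 : laplaceHyp (hypMetric n) (revNormal n f) (φ - fun q : Amb n => w q.2) p ≤ 0 := by
    have hN1 := hypMetric_revNormal_self h.norm_fst h.pos
    rw [_root_.laplaceHyp_eq (φ := φ - fun q : Amb n => w q.2) h.norm_lt_one (hφ.sub hwc).differentiableAt_fderiv_of_two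
      h.differentiableAt_revNormal hN1]
    exact Finset.sum_nonpos fun i _ => hessian_nonpos_of_isLocalMaxOn hI hpos hf hf₂ hp
      (hφ.sub hwc) hmax ((tangentFrame_spec h.norm_lt_one hN1).1 i)
  rw [h.laplaceHyp_sub hφ hwc] at hle0
  rw [jacobiOp, jacobiOp, heq]
  linarith

end Jacobi

/-! ### Linear equations of the second order -/

lemma abs_cos_sq_sub_cos_sq_le (x y : ℝ) : |Real.cos x ^ 2 - Real.cos y ^ 2| ≤ 2 * |x - y| := by
  have h1 : |Real.cos x - Real.cos y| ≤ |x - y| := by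
    simpa [Real.dist_eq] using Real.lipschitzWith_cos.dist_le_mul x y
  have h2 : |Real.cos x + Real.cos y| ≤ 2 :=
    (abs_add_le _ _).trans (by linarith [Real.abs_cos_le_one x, Real.abs_cos_le_one y])
  rw [sq_sub_sq, abs_mul]
  exact mul_le_mul h2 h1 (abs_nonneg _) (by norm_num)

lemma lipschitzWith_prufer {q C : ℝ} (hC : 0 ≤ C) (hq : |q| ≤ C) :
    LipschitzWith (2 * (C + 1)).toNNReal fun x : ℝ => -1 - (q - 1) * Real.cos x ^ 2 := by
  refine LipschitzWith.of_dist_le_mul fun x y => ?_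
  rw [Real.coe_toNNReal _ (by positivity), Real.dist_eq, Real.dist_eq]
  have h1 : |q - 1| ≤ C + 1 := (abs_sub _ _).trans (by rw [abs_one]; linarith)
  have h2 : -1 - (q - 1) * Real.cos x ^ 2 - (-1 - (q - 1) * Real.cos y ^ 2) =
      -((q - 1) * (Real.cos x ^ 2 - Real.cos y ^ 2)) := by ring
  rw [h2, abs_neg, abs_mul]
  calc |q - 1| * |Real.cos x ^ 2 - Real.cos y ^ 2| ≤ (C + 1) * (2 * |x - y|) := by
        gcongr
        exact abs_cos_sq_sub_cos_sq_le x y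
    _ = _ := by ring

/-- Existence for the equation of the Prüfer angle. -/
lemma exists_pruferAngle {b : ℝ} (hb : 0 < b) {q : ℝ → ℝ} (hq : ContinuousOn q (Icc (-b) b)) :
    ∃ θ : ℝ → ℝ, θ 0 = 0 ∧ ∀ t ∈ Icc (-b) b,
      HasDerivWithinAt θ (-1 - (q t - 1) * Real.cos (θ t) ^ 2) (Icc (-b) b) t := by
  obtain ⟨C, hC⟩ := isCompact_Icc.exists_bound_of_continuousOn hq
  have h0 : (0 : ℝ) ∈ Icc (-b) b := ⟨by linarith, hb.le⟩
  have hC0 : 0 ≤ C := (norm_nonneg _).trans (hC 0 h0)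
  have hL : 0 ≤ C + 2 := by linarith
  -- The angular field is bounded by C + 2 for all values of the angle, so a ball of radius (C + 2)
  -- b suffices and the solution exists on the whole interval at once.
  have hpl : IsPicardLindelof (fun t x => -1 - (q t - 1) * Real.cos x ^ 2) (⟨0, h0⟩ : Icc (-b) b)
      (0 : ℝ) ((C + 2) * b).toNNReal 0 (C + 2).toNNReal (2 * (C + 1)).toNNReal := by
    refine ⟨fun t ht => (lipschitzWith_prufer hC0 (hC t ht)).lipschitzOnWith, fun x _ => ?_,
      fun t ht x _ => ?_, ?_⟩
    · exact continuousOn_const.sub ((hq.sub continuousOn_const).mul continuousOn_const)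
    · rw [Real.coe_toNNReal _ hL, Real.norm_eq_abs]
      have h1 := hC t ht
      rw [Real.norm_eq_abs] at h1
      have h2 : |q t - 1| ≤ C + 1 := (abs_sub _ _).trans (by rw [abs_one]; linarith)
      have h3 : |Real.cos x ^ 2| ≤ 1 := by
        rw [abs_of_nonneg (sq_nonneg _)]
        exact Real.cos_sq_le_one x
      calc |-1 - (q t - 1) * Real.cos x ^ 2| ≤ |(-1 : ℝ)| + |(q t - 1) * Real.cos x ^ 2| :=
            abs_sub _ _
        _ ≤ 1 + (C + 1) * 1 := by
            rw [abs_neg, abs_one, abs_mul]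
            gcongr
        _ = C + 2 := by ring
    · rw [Real.coe_toNNReal _ hL, Real.coe_toNNReal _ (by positivity)]
      simp
  exact hpl.exists_eq_forall_mem_Icc_hasDerivWithinAt₀

/-- Grönwall: the angle for k solves the equation for l up to an error |k - l| C, where C bounds Q,
and both angles start at 0. -/
lemma continuous_pruferAngle {b : ℝ} {P Q : ℝ → ℝ}
    (hP : ContinuousOn P (Icc (-b) b)) (hQ : ContinuousOn Q (Icc (-b) b)) {θ : ℝ → ℝ → ℝ}
    (h0 : ∀ l, θ l 0 = 0) (hθ : ∀ l, ∀ t ∈ Icc (-b) b, HasDerivWithinAt (θ l)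
      (-1 - (P t + l * Q t - 1) * Real.cos (θ l t) ^ 2) (Icc (-b) b) t)
    {α : ℝ} (hα : α ∈ Ioo 0 b) : Continuous fun l => θ l α := by
  have hsub : Icc 0 α ⊆ Icc (-b) b := Icc_subset_Icc (by linarith [hα.1, hα.2]) hα.2.le
  obtain ⟨C, hC⟩ := isCompact_Icc.exists_bound_of_continuousOn hQ
  have hC0 : 0 ≤ C := (norm_nonneg _).trans (hC 0 (hsub ⟨le_rfl, hα.1.le⟩))
  refine continuous_iff_continuousAt.2 fun l => ?_
  obtain ⟨C', hC'⟩ := isCompact_Icc.exists_bound_of_continuousOn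
    (hP.add (hQ.const_smul l))
  have hC'0 : 0 ≤ C' := (norm_nonneg _).trans (hC' 0 (hsub ⟨le_rfl, hα.1.le⟩))
  have hright : ∀ k, ∀ t ∈ Ico 0 α, HasDerivWithinAt (θ k)
      (-1 - (P t + k * Q t - 1) * Real.cos (θ k t) ^ 2) (Ici t) t := fun k t ht =>
    ((hθ k t (hsub (Ico_subset_Icc_self ht))).hasDerivAt (Icc_mem_nhds
      (by linarith [ht.1, ht.2, hα.1, hα.2]) (by linarith [ht.2, hα.2]))).hasDerivWithinAt
  have hcont : ∀ k, ContinuousOn (θ k) (Icc 0 α) := fun k t ht =>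
    ((hθ k t (hsub ht)).continuousWithinAt).mono hsub
  have hbound : ∀ k, dist (θ k α) (θ l α) ≤
      gronwallBound 0 (2 * (C' + 1)).toNNReal (|k - l| * C + 0) (α - 0) := by
    intro k
    refine dist_le_of_approx_trajectories_ODE_of_mem
      (v := fun t x => -1 - (P t + l * Q t - 1) * Real.cos x ^ 2) (s := fun _ => univ)
      (fun t ht => (lipschitzWith_prufer hC'0 (hC' t (hsub (Ico_subset_Icc_self ht)))).lipschitzOnWith)
      (hcont k) (hright k) (fun t ht => ?_) (fun _ _ => trivial) (hcont l) (hright l)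
      (fun t ht => by rw [dist_self]) (fun _ _ => trivial) (by rw [h0, h0, dist_self]) α
      ⟨hα.1.le, le_rfl⟩
    have h1 := hC t (hsub (Ico_subset_Icc_self ht))
    rw [Real.norm_eq_abs] at h1
    have h3 : |Real.cos (θ k t) ^ 2| ≤ 1 := by
      rw [abs_of_nonneg (sq_nonneg _)]
      exact Real.cos_sq_le_one _
    have h2 : -1 - (P t + k * Q t - 1) * Real.cos (θ k t) ^ 2 -
        (-1 - (P t + l * Q t - 1) * Real.cos (θ k t) ^ 2) =
        -((k - l) * Q t * Real.cos (θ k t) ^ 2) := by ring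
    rw [Real.dist_eq, h2, abs_neg, abs_mul, abs_mul]
    calc |k - l| * |Q t| * |Real.cos (θ k t) ^ 2| ≤ |k - l| * C * 1 := by gcongr
      _ = _ := mul_one _
  rw [ContinuousAt, tendsto_iff_dist_tendsto_zero]
  refine squeeze_zero (fun _ => dist_nonneg) hbound ?_
  have hc : Continuous fun k => gronwallBound 0 (2 * (C' + 1)).toNNReal (|k - l| * C + 0) (α - 0) :=
    (gronwallBound_continuous_ε 0 _ (α - 0)).comp (by fun_prop)
  have := hc.tendsto l
  simpa [gronwallBound_ε0_δ0] using this

/-- The solution of the linear equation with a given Prüfer angle. -/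
lemma exists_amplitude {b : ℝ} (hb : 0 < b) {q θ : ℝ → ℝ} (hq : ContinuousOn q (Icc (-b) b))
    (h0 : θ 0 = 0) (hθ : ∀ t ∈ Icc (-b) b,
      HasDerivWithinAt θ (-1 - (q t - 1) * Real.cos (θ t) ^ 2) (Icc (-b) b) t) :
    ∃ R u v : ℝ → ℝ, u 0 = 1 ∧ v 0 = 0 ∧ (∀ t, 0 < R t) ∧ (∀ t, u t = R t * Real.cos (θ t)) ∧
      ∀ t ∈ Ioo (-b) b, HasDerivAt u (v t) t ∧ HasDerivAt v (-(q t * u t)) t := by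
  -- With u = R cos θ and u' = R sin θ, the equation u'' = -q u splits into the angular equation and
  -- R' = g R; hence R is the exponential of an integral.
  set g : ℝ → ℝ := fun t => (1 - q t) * (Real.sin (θ t) * Real.cos (θ t)) with hg
  have hθc : ContinuousOn θ (Icc (-b) b) := fun t ht => (hθ t ht).continuousWithinAt
  have hgc : ContinuousOn g (Icc (-b) b) :=
    (continuousOn_const.sub hq).mul ((Real.continuous_sin.comp_continuousOn hθc).mul
      (Real.continuous_cos.comp_continuousOn hθc))
  set G : ℝ → ℝ := fun t => ∫ s in (0 : ℝ)..t, g s with hG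
  have hGd : ∀ t ∈ Ioo (-b) b, HasDerivAt G (g t) t := by
    intro t ht
    have hsub : uIcc 0 t ⊆ Icc (-b) b := by
      refine uIcc_subset_Icc ⟨by linarith, hb.le⟩ (Ioo_subset_Icc_self ht)
    refine intervalIntegral.integral_hasDerivAt_right (hgc.mono hsub).intervalIntegrable ?_ ?_
    · exact (hgc.mono Ioo_subset_Icc_self).stronglyMeasurableAtFilter isOpen_Ioo t ht
    · exact hgc.continuousAt (Icc_mem_nhds ht.1 ht.2)
  refine ⟨fun t => Real.exp (G t), fun t => Real.exp (G t) * Real.cos (θ t),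
    fun t => Real.exp (G t) * Real.sin (θ t), by simp [hG, h0], by simp [h0],
    fun t => Real.exp_pos _, fun t => rfl, fun t ht => ?_⟩
  have hθd := (hθ t (Ioo_subset_Icc_self ht)).hasDerivAt (Icc_mem_nhds ht.1 ht.2)
  have hsc := Real.sin_sq_add_cos_sq (θ t)
  constructor
  · refine ((hGd t ht).exp.mul hθd.cos).congr_deriv ?_
    simp only [hg]
    ring
  · refine ((hGd t ht).exp.mul hθd.sin).congr_deriv ?_
    simp only [hg]
    linear_combination (Real.exp (G t) * Real.cos (θ t) * (1 - q t)) * hsc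

/-- A one-parameter family of linear equations of the second order: the sign of the solution at a
given point is the sign of a continuous function of the parameter. -/
lemma exists_linear_family {b : ℝ} (hb : 0 < b) {P Q : ℝ → ℝ}
    (hP : ContinuousOn P (Icc (-b) b)) (hQ : ContinuousOn Q (Icc (-b) b)) :
    ∃ (u v R c : ℝ → ℝ → ℝ), (∀ l, u l 0 = 1) ∧ (∀ l, v l 0 = 0) ∧ (∀ l t, 0 < R l t) ∧
      (∀ l t, u l t = R l t * c l t) ∧ (∀ α ∈ Ioo 0 b, Continuous fun l => c l α) ∧
      ∀ l, ∀ t ∈ Ioo (-b) b, HasDerivAt (u l) (v l t) t ∧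
        HasDerivAt (v l) (-((P t + l * Q t) * u l t)) t := by
  have hq : ∀ l : ℝ, ContinuousOn (fun t => P t + l * Q t) (Icc (-b) b) := fun l =>
    hP.add (continuousOn_const.mul hQ)
  choose θ h0 hθ using fun l => exists_pruferAngle hb (hq l)
  choose R u v hu hv hR hRu hd using fun l => exists_amplitude hb (hq l) (h0 l) (hθ l)
  exact ⟨u, v, R, fun l t => Real.cos (θ l t), hu, hv, hR, hRu, fun α hα =>
    Real.continuous_cos.comp (continuous_pruferAngle hP hQ h0 hθ hα), hd⟩

/-! ### Uniqueness, parity and comparison for linear equations -/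

lemma linear_unique {b C : ℝ} (hb : 0 < b) {q u v u' v' : ℝ → ℝ}
    (hq : ∀ t ∈ Ioo (-b) b, |q t| ≤ C) (h0 : u 0 = u' 0) (h0' : v 0 = v' 0)
    (hu : ∀ t ∈ Ioo (-b) b, HasDerivAt u (v t) t ∧ HasDerivAt v (-(q t * u t)) t)
    (hu' : ∀ t ∈ Ioo (-b) b, HasDerivAt u' (v' t) t ∧ HasDerivAt v' (-(q t * u' t)) t) :
    EqOn u u' (Ioo (-b) b) := by
  have hb0 : (0 : ℝ) ∈ Ioo (-b) b := ⟨by linarith, hb⟩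
  have hC : 0 ≤ C := (abs_nonneg _).trans (hq 0 hb0)
  have hlip : ∀ t ∈ Ioo (-b) b, LipschitzOnWith (C + 1).toNNReal
      (fun x : ℝ × ℝ => (x.2, -(q t * x.1))) univ := by
    intro t ht
    refine (LipschitzWith.of_dist_le_mul fun x y => ?_).lipschitzOnWith
    rw [Real.coe_toNNReal _ (by positivity), Prod.dist_eq, Prod.dist_eq]
    have h1 : dist (-(q t * x.1)) (-(q t * y.1)) ≤ C * dist x.1 y.1 := by
      rw [dist_neg_neg, Real.dist_eq, ← mul_sub, abs_mul, Real.dist_eq]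
      gcongr
      exact hq t ht
    have h2 : dist x.1 y.1 ≤ max (dist x.1 y.1) (dist x.2 y.2) := le_max_left _ _
    have h3 : dist x.2 y.2 ≤ max (dist x.1 y.1) (dist x.2 y.2) := le_max_right _ _
    have h4 : 0 ≤ max (dist x.1 y.1) (dist x.2 y.2) := dist_nonneg.trans h2
    refine max_le ?_ ?_
    · nlinarith
    · nlinarith
  have h := ODE_solution_unique_of_mem_Ioo (v := fun t (x : ℝ × ℝ) => (x.2, -(q t * x.1)))
    (f := fun t => (u t, v t)) (g := fun t => (u' t, v' t)) hlip hb0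
    (fun t ht => ⟨(hu t ht).1.prodMk (hu t ht).2, trivial⟩)
    (fun t ht => ⟨(hu' t ht).1.prodMk (hu' t ht).2, trivial⟩) (by simp [h0, h0'])
  exact fun t ht => congrArg Prod.fst (h ht)

/-- When q is even and u'(0) = 0, the reflection t ↦ u(-t) solves the same initial value problem. -/
lemma linear_even {b C : ℝ} (hb : 0 < b) {q u v : ℝ → ℝ}
    (hq : ∀ t ∈ Ioo (-b) b, |q t| ≤ C) (hqe : ∀ t ∈ Ioo (-b) b, q (-t) = q t) (h0 : v 0 = 0)
    (hu : ∀ t ∈ Ioo (-b) b, HasDerivAt u (v t) t ∧ HasDerivAt v (-(q t * u t)) t) :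
    ∀ t ∈ Ioo (-b) b, u (-t) = u t := by
  refine linear_unique (u := fun t => u (-t)) (v := fun t => -v (-t)) hb hq (by simp)
    (by simp [h0]) (fun t ht => ?_) hu
  have h := hu (-t) (neg_mem_Ioo ht)
  have hneg : HasDerivAt (fun t : ℝ => -t) (-1) t := hasDerivAt_neg t
  constructor
  · exact (HasDerivAt.comp t h.1 hneg).congr_deriv (by ring)
  · exact (HasDerivAt.comp t h.2 hneg).neg.congr_deriv (by rw [hqe t ht]; ring)

/-- Sturm comparison. -/
lemma sturm_pos {α : ℝ} {q₁ q₂ u₁ v₁ u₂ v₂ : ℝ → ℝ}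
    (h₁ : u₁ 0 = 1) (h₁' : v₁ 0 = 0) (h₂' : v₂ 0 = 0)
    (hu₁ : ∀ t ∈ Icc 0 α, HasDerivAt u₁ (v₁ t) t ∧ HasDerivAt v₁ (-(q₁ t * u₁ t)) t)
    (hu₂ : ∀ t ∈ Icc 0 α, HasDerivAt u₂ (v₂ t) t ∧ HasDerivAt v₂ (-(q₂ t * u₂ t)) t)
    (hq : ∀ t ∈ Icc 0 α, q₁ t < q₂ t) (hpos : ∀ t ∈ Ico 0 α, 0 < u₂ t) :
    ∀ t ∈ Icc 0 α, 0 < u₁ t := by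
  by_contra! hcon
  have hcont : ContinuousOn u₁ (Icc 0 α) := fun t ht => (hu₁ t ht).1.continuousAt.continuousWithinAt
  have hclosed : IsClosed (Icc 0 α ∩ u₁ ⁻¹' Iic 0) :=
    hcont.preimage_isClosed_of_isClosed isClosed_Icc isClosed_Iic
  obtain ⟨t₁, ⟨ht₁, hle⟩, hleast⟩ :=
    (isCompact_Icc.of_isClosed_subset hclosed inter_subset_left).exists_isLeast
      (by obtain ⟨t, ht, h⟩ := hcon; exact ⟨t, ht, h⟩)
  have hlt : ∀ t ∈ Ico 0 t₁, 0 < u₁ t := by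
    intro t ht
    by_contra! h
    exact absurd (hleast ⟨⟨ht.1, ht.2.le.trans ht₁.2⟩, h⟩) (not_le.2 ht.2)
  have ht₁0 : 0 < t₁ := by
    refine lt_of_le_of_ne ht₁.1 ?_
    rintro rfl
    rw [mem_preimage, mem_Iic, h₁] at hle
    linarith
  have hev : ∀ᶠ t in 𝓝[<] t₁, t ∈ Ico 0 t₁ := by
    filter_upwards [Ioo_mem_nhdsLT ht₁0] with t ht using ⟨ht.1.le, ht.2⟩
  have hle' : u₁ t₁ ≤ 0 := hle
  have h0 : u₁ t₁ = 0 := le_antisymm hle'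
    (ge_of_tendsto (x := 𝓝[<] t₁) ((hu₁ t₁ ht₁).1.continuousAt.tendsto.mono_left nhdsWithin_le_nhds)
      (hev.mono fun t ht => (hlt t ht).le))
  have hu2 : 0 ≤ u₂ t₁ :=
    ge_of_tendsto (x := 𝓝[<] t₁) ((hu₂ t₁ ht₁).1.continuousAt.tendsto.mono_left nhdsWithin_le_nhds)
      (hev.mono fun t ht => (hpos t ⟨ht.1, ht.2.trans_le ht₁.2⟩).le)
  -- At its first zero t₁, u₁ arrives from positive values.
  have hv : v₁ t₁ ≤ 0 := by
    have hs := (hasDerivAt_iff_tendsto_slope.1 (hu₁ t₁ ht₁).1).mono_left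
      (nhdsWithin_mono t₁ (fun t (ht : t < t₁) => ht.ne))
    refine le_of_tendsto (x := 𝓝[<] t₁) hs (hev.mono fun t ht => ?_)
    rw [slope_def_field, h0, sub_zero]
    exact div_nonpos_of_nonneg_of_nonpos (hlt t ht).le (by linarith [ht.2])
  -- The Wronskian vanishes at 0 and strictly increases while both solutions are positive. At t₁ it
  -- equals v₁ u₂, which is at most 0: a contradiction.
  have hW : ∀ t ∈ Icc 0 t₁, HasDerivAt (fun t => v₁ t * u₂ t - u₁ t * v₂ t)
      ((q₂ t - q₁ t) * (u₁ t * u₂ t)) t := by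
    intro t ht
    have ht' : t ∈ Icc 0 α := ⟨ht.1, ht.2.trans ht₁.2⟩
    exact (((hu₁ t ht').2.mul (hu₂ t ht').1).sub ((hu₁ t ht').1.mul (hu₂ t ht').2)).congr_deriv
      (by ring)
  have hmono : StrictMonoOn (fun t => v₁ t * u₂ t - u₁ t * v₂ t) (Icc 0 t₁) := by
    refine strictMonoOn_of_deriv_pos (convex_Icc 0 t₁)
      (fun t ht => (hW t ht).continuousAt.continuousWithinAt) fun t ht => ?_
    rw [interior_Icc] at ht
    rw [(hW t (Ioo_subset_Icc_self ht)).deriv]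
    have ha := hlt t ⟨ht.1.le, ht.2⟩
    have hb := hpos t ⟨ht.1.le, ht.2.trans_le ht₁.2⟩
    have hc := hq t ⟨ht.1.le, ht.2.le.trans ht₁.2⟩
    exact mul_pos (by linarith) (mul_pos ha hb)
  have hfin := hmono ⟨le_rfl, ht₁0.le⟩ ⟨ht₁0.le, le_rfl⟩ ht₁0
  simp only [h₁', h₂', h0] at hfin
  nlinarith

/-! ### Catenoids as hypersurfaces of revolution -/

section Catenoid

variable {n : ℕ} {a : ℝ}

/-- The maximal interval of the catenary. -/
def catIoo (n : ℕ) (a : ℝ) : Set ℝ := Ioo (-profHeight (n - 1) a) (profHeight (n - 1) a)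

lemma isCatenarySolution_catF (hn : 2 ≤ n) (ha : 0 < a) :
    IsCatenarySolution n a (catIoo n a) (catF n a) :=
  isCatenarySolution_of_eqOn hn ha fun _ ht => catF_eq hn ha ht

lemma Icc_subset_catIoo {α : ℝ} (hα : α ∈ Ioo 0 (profHeight (n - 1) a)) :
    Icc (-α) α ⊆ catIoo n a := fun t ht =>
  ⟨by linarith [ht.1, hα.2], by linarith [ht.2, hα.2]⟩

lemma mem_catIoo_of_mem_Ioo {α : ℝ} (hα : α ∈ Ioo 0 (profHeight (n - 1) a)) : α ∈ catIoo n a :=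
  Icc_subset_catIoo hα ⟨by linarith [hα.1], le_rfl⟩

lemma continuousOn_revRad (hn : 2 ≤ n) (ha : 0 < a) :
    ContinuousOn (revRad (catF n a)) (catIoo n a) := fun t ht =>
  (hasDerivAt_revRad ((isCatenarySolution_catF hn ha).differentiable t
    ht)).continuousAt.continuousWithinAt

lemma exists_eq_catX_iff (hn : 2 ≤ n) (ha : 0 < a) {t : ℝ} (ht : t ∈ catIoo n a) (p : Amb n) :
    (∃ ξ : EuclideanSpace ℝ (Fin n), ‖ξ‖ = 1 ∧ p = catX n a t ξ) ↔
      p.2 = t ∧ ‖p.1‖ = revRad (catF n a) t := by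
  constructor
  · rintro ⟨ξ, hξ, rfl⟩
    exact ⟨rfl, norm_catX_fst hn ha ht hξ⟩
  · rintro ⟨h1, h2⟩
    have hr := revRad_pos ((isCatenarySolution_catF hn ha).pos t ht)
    refine ⟨(revRad (catF n a) t)⁻¹ • p.1, ?_, Prod.ext ?_ h1⟩
    · rw [norm_smul, h2, norm_inv, Real.norm_of_nonneg hr.le, inv_mul_cancel₀ hr.ne']
    · change p.1 = revRad (catF n a) t • (revRad (catF n a) t)⁻¹ • p.1
      rw [smul_smul, mul_inv_cancel₀ hr.ne', one_smul]

lemma catenoid_eq (hn : 2 ≤ n) (ha : 0 < a) :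
    catenoid n a = revSurface n (catIoo n a) (catF n a) := by
  ext p
  simp only [catenoid, catInterval_eq hn ha]
  constructor
  · rintro ⟨t, ht, h⟩
    obtain ⟨rfl, h2⟩ := (exists_eq_catX_iff hn ha ht p).1 h
    exact ⟨ht, h2⟩
  · rintro ⟨ht, h⟩
    exact ⟨p.2, ht, (exists_eq_catX_iff hn ha ht p).2 ⟨rfl, h⟩⟩

lemma catDomain_eq (hn : 2 ≤ n) (ha : 0 < a) {α : ℝ} (hα : α ∈ Ioo 0 (profHeight (n - 1) a)) :
    catDomain n a (-α) α = revSurface n (Ioo (-α) α) (catF n a) := by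
  have hsub := Ioo_subset_Icc_self.trans (Icc_subset_catIoo hα)
  ext p
  constructor
  · rintro ⟨t, ht, h⟩
    obtain ⟨rfl, h2⟩ := (exists_eq_catX_iff hn ha (hsub ht) p).1 h
    exact ⟨ht, h2⟩
  · rintro ⟨ht, h⟩
    exact ⟨p.2, ht, (exists_eq_catX_iff hn ha (hsub ht) p).2 ⟨rfl, h⟩⟩

lemma mem_catSphere_iff (hn : 2 ≤ n) (ha : 0 < a) {t : ℝ} (ht : t ∈ catIoo n a) (p : Amb n) :
    p ∈ catSphere n a t ↔ p.2 = t ∧ ‖p.1‖ = revRad (catF n a) t :=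
  exists_eq_catX_iff hn ha ht p

lemma catSphere_nonempty (hn : 2 ≤ n) (t : ℝ) : (catSphere n a t).Nonempty :=
  ⟨_, EuclideanSpace.single ⟨0, by omega⟩ 1, by simp, rfl⟩

lemma isMinimalPoint_catF (hn : 2 ≤ n) (ha : 0 < a) {p : Amb n}
    (hp : p ∈ revSurface n (catIoo n a) (catF n a)) : IsMinimalPoint n (catF n a) p :=
  have h := isCatenarySolution_catF hn ha
  ⟨hp.2, h.pos _ hp.1, h.differentiable _ hp.1, h.ode _ hp.1⟩

lemma isCompact_revSurface_Icc (hn : 2 ≤ n) (ha : 0 < a) {α : ℝ}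
    (hα : α ∈ Ioo 0 (profHeight (n - 1) a)) :
    IsCompact (revSurface n (Icc (-α) α) (catF n a)) := by
  have hcl : IsClosed {p : Amb n | p.2 ∈ Icc (-α) α} := isClosed_Icc.preimage continuous_snd
  have hc : ContinuousOn (fun p : Amb n => ‖p.1‖ - revRad (catF n a) p.2)
      {p : Amb n | p.2 ∈ Icc (-α) α} :=
    (continuous_fst.norm).continuousOn.sub
      (((continuousOn_revRad hn ha).mono (Icc_subset_catIoo hα)).comp continuous_snd.continuousOn
        fun _ hp => hp)
  have hclosed : IsClosed (revSurface n (Icc (-α) α) (catF n a)) := by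
    convert hc.preimage_isClosed_of_isClosed hcl (isClosed_singleton (x := (0 : ℝ))) using 1
    ext p
    simp only [revSurface, mem_ofPred_eq, mem_inter_iff, mem_preimage, mem_singleton_iff, sub_eq_zero]
  refine ((isCompact_closedBall (0 : EuclideanSpace ℝ (Fin n)) 1).prod
    (isCompact_Icc (a := -α) (b := α))).of_isClosed_subset hclosed fun p hp => ⟨?_, hp.1⟩
  rw [mem_closedBall_zero_iff, hp.2]
  exact (revRad_lt_one _ _).le

lemma closure_revSurface_Ioo (hn : 2 ≤ n) (ha : 0 < a) {α : ℝ}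
    (hα : α ∈ Ioo 0 (profHeight (n - 1) a)) :
    closure (revSurface n (Ioo (-α) α) (catF n a)) = revSurface n (Icc (-α) α) (catF n a) := by
  apply Subset.antisymm
  · exact closure_minimal (fun p hp => ⟨Ioo_subset_Icc_self hp.1, hp.2⟩)
      (isCompact_revSurface_Icc hn ha hα).isClosed
  · rintro p ⟨hpI, hp⟩
    have hsol := isCatenarySolution_catF hn ha
    have hr := revRad_pos (hsol.pos _ (Icc_subset_catIoo hα hpI))
    -- The meridian through p, parametrized by height; it approaches p from inside the open piece.
    set c : ℝ → Amb n := fun s => ((revRad (catF n a) s / revRad (catF n a) p.2) • p.1, s) with hc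
    have hcp : c p.2 = p := by simp [hc, div_self hr.ne']
    have hcont : ContinuousAt c p.2 := by
      have h1 := (hasDerivAt_revRad (hsol.differentiable _ (Icc_subset_catIoo hα hpI))).continuousAt
      exact ((h1.div_const _).smul continuousAt_const).prodMk continuousAt_id
    rw [← hcp]
    refine hcont.continuousWithinAt.mem_closure (s := Ioo (-α) α) ?_ fun s hs => ⟨hs, ?_⟩
    · rw [closure_Ioo (by linarith [hα.1])]
      exact hpI
    · have h2 := revRad_pos (hsol.pos _ (Icc_subset_catIoo hα (Ioo_subset_Icc_self hs)))
      rw [hc, norm_smul, hp, Real.norm_of_nonneg (by positivity), div_mul_cancel₀ _ hr.ne']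

lemma bdry_catDomain (hn : 2 ≤ n) (ha : 0 < a) {α : ℝ}
    (hα : α ∈ Ioo 0 (profHeight (n - 1) a)) :
    bdry (catDomain n a (-α) α) = catSphere n a (-α) ∪ catSphere n a α := by
  have hαI := mem_catIoo_of_mem_Ioo hα
  have hα' : -α ∈ catIoo n a := neg_mem_Ioo hαI
  ext p
  rw [bdry, catDomain_eq hn ha hα, closure_revSurface_Ioo hn ha hα, mem_union,
    mem_catSphere_iff hn ha hα', mem_catSphere_iff hn ha hαI]
  constructor
  · rintro ⟨⟨h1, h2⟩, h3⟩
    by_cases h4 : p.2 = α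
    · exact Or.inr ⟨h4, by rw [h2, h4]⟩
    · by_cases h5 : p.2 = -α
      · exact Or.inl ⟨h5, by rw [h2, h5]⟩
      · exact absurd ⟨⟨lt_of_le_of_ne h1.1 (Ne.symm h5), lt_of_le_of_ne h1.2 h4⟩, h2⟩ h3
  · rintro (⟨h1, h2⟩ | ⟨h1, h2⟩)
    · exact ⟨⟨by rw [h1]; exact ⟨le_rfl, by linarith [hα.1]⟩, by rw [h2, h1]⟩,
        fun h => absurd h.1.1 (by rw [h1]; exact lt_irrefl _)⟩
    · exact ⟨⟨by rw [h1]; exact ⟨by linarith [hα.1], le_rfl⟩, by rw [h2, h1]⟩,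
        fun h => absurd h.1.2 (by rw [h1]; exact lt_irrefl _)⟩

/-- `catNormal` is a unit normal field. -/
lemma isUnitNormal_catNormal (hn : 2 ≤ n) (ha : 0 < a) :
    IsUnitNormal (hypMetric n) (catenoid n a) (catNormal n a) := by
  rw [catenoid_eq hn ha, catNormal_eq]
  intro p hp
  have h := isMinimalPoint_catF hn ha hp
  refine ⟨h.differentiableAt_revNormal, hypMetric_revNormal_self h.norm_fst h.pos,
    fun c w hc0 hcM hcd => ?_⟩
  have h1 := revFactor_pos (catF n a) p.2
  have h3 := revRad_pos h.pos
  have hcd1 : HasDerivAt (fun s => (c s).1) w.1 0 :=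
    (ContinuousLinearMap.fst ℝ (EuclideanSpace ℝ (Fin n)) ℝ).hasFDerivAt.comp_hasDerivAt 0 hcd
  have hcd2 : HasDerivAt (fun s => (c s).2) w.2 0 :=
    (ContinuousLinearMap.snd ℝ (EuclideanSpace ℝ (Fin n)) ℝ).hasFDerivAt.comp_hasDerivAt 0 hcd
  have hd1 : HasDerivAt (fun s => ‖(c s).1‖ ^ 2) (2 * inner ℝ p.1 w.1) 0 := by
    have := hcd1.norm_sq
    rwa [hc0] at this
  have hd2 : HasDerivAt (fun s => revRad (catF n a) (c s).2 ^ 2)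
      (2 * revRad (catF n a) p.2 * (deriv (catF n a) p.2 / revFactor (catF n a) p.2 * w.2)) 0 := by
    have h4 := (HasDerivAt.comp (0 : ℝ) (h₂ := revRad (catF n a)) (h := fun s => (c s).2)
      (by rw [hc0]; exact hasDerivAt_revRad h.differentiableAt) hcd2).pow 2
    refine h4.congr_deriv ?_
    simp [hc0]
  -- Normality comes from differentiating |x|² = r(t)² along the curve, r being the profile radius.
  have hev : (fun s => ‖(c s).1‖ ^ 2) =ᶠ[𝓝 0] fun s => revRad (catF n a) (c s).2 ^ 2 :=
    hcM.mono fun s hs => by simp only [hs.2]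
  have he := hd1.unique (hd2.congr_of_eventuallyEq hev)
  have hin : inner ℝ p.1 w.1 =
      revRad (catF n a) p.2 * (deriv (catF n a) p.2 / revFactor (catF n a) p.2 * w.2) := by
    linarith
  rw [hypMetric_revNormal_left h.norm_fst, hin]
  field_simp
  simp

/-! ### Dirichlet eigenvalues -/

lemma profPot_eq (hn : 2 ≤ n) (ha : 0 < a) {t : ℝ} (ht : t ∈ catIoo n a) :
    profPot (n - 1) a t = ((n : ℝ) - 1) * (((n : ℝ) - 1) + 1) *
      (Real.cosh (catF n a t) / Real.sinh (catF n a t)) ^ 2 - ((n : ℝ) - 1) := by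
  rw [profPot, catF_eq hn ha ht]

lemma profWeight_eq (hn : 2 ≤ n) (ha : 0 < a) {t : ℝ} (ht : t ∈ catIoo n a) :
    profWeight (n - 1) a t = 1 + deriv (catF n a) t ^ 2 := by
  rw [profWeight, deriv_catF hn ha ht]

lemma one_le_profWeight (m a t : ℝ) : 1 ≤ profWeight m a t := by
  unfold profWeight
  nlinarith [sq_nonneg (Real.sinh (profInv m a t))]

lemma profPot_nonneg {m : ℝ} (hm : 0 < m) (ha : 0 < a) (t : ℝ) : 0 ≤ profPot m a t := by
  have h1 : 0 < Real.sinh (profSol m a t) := Real.sinh_pos_iff.2 (profF_pos ha _)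
  have h2 : 1 ≤ Real.cosh (profSol m a t) / Real.sinh (profSol m a t) := by
    rw [one_le_div h1]
    exact (Real.sinh_lt_cosh _).le
  have h3 : 1 ≤ (Real.cosh (profSol m a t) / Real.sinh (profSol m a t)) ^ 2 := one_le_pow₀ h2
  unfold profPot
  nlinarith [mul_pos hm (by linarith : 0 < m + 1)]

lemma continuousOn_profPot (hn : 2 ≤ n) (ha : 0 < a) :
    ContinuousOn (profPot (n - 1) a) (catIoo n a) := by
  have hc : ContinuousOn (profSol (n - 1) a) (catIoo n a) := fun t ht =>
    (hasDerivAt_profSol (pos_of_two_le hn) ha ht).continuousAt.continuousWithinAt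
  refine ((continuousOn_const.mul (((Real.continuous_cosh.comp_continuousOn hc).div
    (Real.continuous_sinh.comp_continuousOn hc) fun _ _ => ?_).pow 2)).sub continuousOn_const)
  exact (Real.sinh_pos_iff.2 (profF_pos ha _)).ne'

lemma continuousOn_profWeight (hn : 2 ≤ n) (ha : 0 < a) :
    ContinuousOn (profWeight (n - 1) a) (catIoo n a) := fun _ ht =>
  ((hasDerivAt_sinh_profInv (pos_of_two_le hn) ha ht).continuousAt.pow 2).const_add 1
    |>.continuousWithinAt

lemma profPot_neg (hn : 2 ≤ n) (ha : 0 < a) {t : ℝ} (ht : t ∈ catIoo n a) :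
    profPot (n - 1) a (-t) = profPot (n - 1) a t := by
  simp only [profPot, profSol, profInv_neg (pos_of_two_le hn) ha ht, profF_neg]

lemma profWeight_neg (hn : 2 ≤ n) (ha : 0 < a) {t : ℝ} (ht : t ∈ catIoo n a) :
    profWeight (n - 1) a (-t) = profWeight (n - 1) a t := by
  simp only [profWeight, profInv_neg (pos_of_two_le hn) ha ht, Real.sinh_neg, neg_sq]

lemma contDiffOn_two_of_hasDerivAt {s : Set ℝ} (hs : IsOpen s) {w w₁ w₂ : ℝ → ℝ}
    (h₁ : ∀ t ∈ s, HasDerivAt w (w₁ t) t) (h₂ : ∀ t ∈ s, HasDerivAt w₁ (w₂ t) t)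
    (hc : ContinuousOn w₂ s) : ContDiffOn ℝ 2 w s := by
  have hone : ContDiffOn ℝ 1 w₁ s := by
    rw [show (1 : WithTop ℕ∞) = 0 + 1 from rfl, contDiffOn_succ_iff_deriv_of_isOpen hs]
    refine ⟨fun t ht => (h₂ t ht).differentiableAt.differentiableWithinAt, by simp, ?_⟩
    exact contDiffOn_zero.2 (hc.congr fun t ht => (h₂ t ht).deriv)
  rw [show (2 : WithTop ℕ∞) = 1 + 1 from rfl, contDiffOn_succ_iff_deriv_of_isOpen hs]
  exact ⟨fun t ht => (h₁ t ht).differentiableAt.differentiableWithinAt, by simp,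
    hone.congr fun t ht => (h₁ t ht).deriv⟩

/-- The Jacobi operator on functions of `t`. -/
lemma jacobiOp_catNormal (hn : 2 ≤ n) (ha : 0 < a) {α : ℝ}
    (hα : α ∈ Ioo 0 (profHeight (n - 1) a)) {w w₁ w₂ : ℝ → ℝ}
    (h₁ : ∀ t ∈ Ioo (-α) α, HasDerivAt w (w₁ t) t)
    (h₂ : ∀ t ∈ Ioo (-α) α, HasDerivAt w₁ (w₂ t) t) (hc : ContinuousOn w₂ (Ioo (-α) α))
    {p : Amb n} (hp : p ∈ revSurface n (Ioo (-α) α) (catF n a)) :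
    jacobiOp (hypMetric n) (catNormal n a) (fun q => w q.2) p =
      -(w₂ p.2 + profPot (n - 1) a p.2 * w p.2) / profWeight (n - 1) a p.2 := by
  have hpI : p.2 ∈ catIoo n a := Icc_subset_catIoo hα (Ioo_subset_Icc_self hp.1)
  have hn1 := isOpen_Ioo.mem_nhds hp.1
  rw [catNormal_eq, (isMinimalPoint_catF hn ha ⟨hpI, hp.2⟩).jacobiOp_comp_snd
    ((contDiffOn_two_of_hasDerivAt isOpen_Ioo h₁ h₂ hc).contDiffAt hn1)
    (eventually_of_mem hn1 h₁) (h₂ _ hp.1), profPot_eq hn ha hpI, profWeight_eq hn ha hpI]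

/-- A solution of the ordinary differential equation that vanishes at `±α` gives a Dirichlet
eigenvalue. -/
lemma mem_dirichletEigenvalues (hn : 2 ≤ n) (ha : 0 < a) {α : ℝ}
    (hα : α ∈ Ioo 0 (profHeight (n - 1) a)) {l : ℝ} {w w₁ : ℝ → ℝ}
    (h₁ : ∀ t ∈ Ioo (-α) α, HasDerivAt w (w₁ t) t)
    (h₂ : ∀ t ∈ Ioo (-α) α, HasDerivAt w₁
      (-((profPot (n - 1) a t + l * profWeight (n - 1) a t) * w t)) t)
    (hc : ContinuousOn w (Icc (-α) α)) (h0 : w 0 ≠ 0) (hα0 : w α = 0) (hα0' : w (-α) = 0) :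
    l ∈ dirichletEigenvalues (hypMetric n) (catNormal n a) (catDomain n a (-α) α) := by
  have hsub : Ioo (-α) α ⊆ catIoo n a := Ioo_subset_Icc_self.trans (Icc_subset_catIoo hα)
  have hc₂ : ContinuousOn (fun t => -((profPot (n - 1) a t + l * profWeight (n - 1) a t) * w t))
      (Ioo (-α) α) :=
    ((((continuousOn_profPot hn ha).mono hsub).add
      (continuousOn_const.mul ((continuousOn_profWeight hn ha).mono hsub))).mul
      (hc.mono Ioo_subset_Icc_self)).neg
  have h00 : (0 : ℝ) ∈ Ioo (-α) α := ⟨by linarith [hα.1], hα.1⟩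
  refine ⟨fun q => w q.2, ⟨{q | q.2 ∈ Ioo (-α) α}, isOpen_Ioo.preimage continuous_snd, ?_, ?_⟩,
    ?_, ?_, ?_, ?_⟩
  · rw [catDomain_eq hn ha hα]
    exact fun p hp => hp.1
  · exact (contDiffOn_two_of_hasDerivAt isOpen_Ioo h₁ h₂ hc₂).comp contDiff_snd.contDiffOn
      fun _ hq => hq
  · rw [catDomain_eq hn ha hα, closure_revSurface_Ioo hn ha hα]
    exact hc.comp continuous_snd.continuousOn fun p hp => hp.1
  · obtain ⟨p, hp⟩ := catSphere_nonempty (a := a) hn 0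
    have hp' := (mem_catSphere_iff hn ha (hsub h00) p).1 hp
    exact ⟨p, ⟨0, h00, hp⟩, by simp only [hp'.1]; exact h0⟩
  · have hαI := mem_catIoo_of_mem_Ioo hα
    intro p hp
    rw [bdry_catDomain hn ha hα, mem_union, mem_catSphere_iff hn ha (neg_mem_Ioo hαI),
      mem_catSphere_iff hn ha hαI] at hp
    rcases hp with hp | hp
    · simp only [hp.1, hα0']
    · simp only [hp.1, hα0]
  · intro p hp
    rw [catDomain_eq hn ha hα] at hp
    rw [jacobiOp_catNormal hn ha hα h₁ h₂ hc₂ hp]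
    have := one_le_profWeight (n - 1) a p.2
    field_simp
    ring

/-- A positive strict supersolution that depends only on `t` excludes an eigenvalue. -/
lemma notMem_dirichletEigenvalues (hn : 2 ≤ n) (ha : 0 < a) {α : ℝ}
    (hα : α ∈ Ioo 0 (profHeight (n - 1) a)) {l : ℝ} {w w₁ w₂ : ℝ → ℝ}
    (h₁ : ∀ t ∈ Ioo (-α) α, HasDerivAt w (w₁ t) t)
    (h₂ : ∀ t ∈ Ioo (-α) α, HasDerivAt w₁ (w₂ t) t) (hc₂ : ContinuousOn w₂ (Ioo (-α) α))
    (hc : ContinuousOn w (Icc (-α) α)) (hpos : ∀ t ∈ Icc (-α) α, 0 < w t)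
    (hsup : ∀ t ∈ Ioo (-α) α,
      w₂ t + profPot (n - 1) a t * w t < -(l * profWeight (n - 1) a t * w t)) :
    l ∉ dirichletEigenvalues (hypMetric n) (catNormal n a) (catDomain n a (-α) α) := by
  have hsub : Ioo (-α) α ⊆ catIoo n a := Ioo_subset_Icc_self.trans (Icc_subset_catIoo hα)
  have hsol := isCatenarySolution_catF hn ha
  rintro ⟨φ, ⟨U, hU, hΩU, hφU⟩, hφc, ⟨p₀, hp₀, hφ0⟩, hφb, hφJ⟩
  have hφC : ∀ p ∈ revSurface n (Ioo (-α) α) (catF n a), ContDiffAt ℝ 2 φ p := fun p hp => by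
    rw [← catDomain_eq hn ha hα] at hp
    exact hφU.contDiffAt (hU.mem_nhds (hΩU hp))
  -- One-sided statement for an arbitrary φ, so that it can be applied to both φ and -φ.
  have key : ∀ φ : Amb n → ℝ, (∀ p ∈ revSurface n (Ioo (-α) α) (catF n a), ContDiffAt ℝ 2 φ p) →
      ContinuousOn φ (closure (catDomain n a (-α) α)) → (∀ p ∈ bdry (catDomain n a (-α) α), φ p = 0) →
      (∀ p ∈ catDomain n a (-α) α, jacobiOp (hypMetric n) (catNormal n a) φ p = l * φ p) →
      ∀ p ∈ catDomain n a (-α) α, φ p ≤ 0 := by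
    clear hφC hφJ hφb hφ0 hp₀ p₀ hφc hφU hΩU hU U φ
    intro φ hφC hφc hφb hφJ p₀ hp₀
    by_contra! hφ0
    rw [catDomain_eq hn ha hα] at hφJ hp₀
    rw [catDomain_eq hn ha hα, closure_revSurface_Ioo hn ha hα] at hφc
    rw [bdry, catDomain_eq hn ha hα, closure_revSurface_Ioo hn ha hα] at hφb
    have hp₀' : p₀ ∈ revSurface n (Icc (-α) α) (catF n a) := ⟨Ioo_subset_Icc_self hp₀.1, hp₀.2⟩
    have hwc : ContinuousOn (fun q : Amb n => w q.2) (revSurface n (Icc (-α) α) (catF n a)) :=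
      hc.comp continuous_snd.continuousOn fun p hp => hp.1
    -- At a maximum of φ / w, with positive value k, the function k w touches φ from above. The
    -- boundary condition forces this point to be interior.
    obtain ⟨p, hp, hmax⟩ := (isCompact_revSurface_Icc hn ha hα).exists_isMaxOn ⟨p₀, hp₀'⟩
      (hφc.div hwc fun q hq => (hpos _ hq.1).ne')
    have hmax' : ∀ q ∈ revSurface n (Icc (-α) α) (catF n a), φ q / w q.2 ≤ φ p / w p.2 := hmax
    set k := φ p / w p.2 with hk
    have hk0 : 0 < k := (div_pos hφ0 (hpos _ hp₀'.1)).trans_le (hmax' _ hp₀')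
    have hwp := hpos _ hp.1
    have hφp : φ p = k * w p.2 := by rw [hk, div_mul_cancel₀ _ hwp.ne']
    have hpΩ : p ∈ revSurface n (Ioo (-α) α) (catF n a) := by
      by_contra hcon
      have := hφb p ⟨hp, hcon⟩
      rw [hφp] at this
      exact (mul_pos hk0 hwp).ne' this
    have hkw₁ : ∀ t ∈ Ioo (-α) α, HasDerivAt (fun t => k * w t) (k * w₁ t) t := fun t ht =>
      (h₁ t ht).const_mul k
    have hkw₂ : ∀ t ∈ Ioo (-α) α, HasDerivAt (fun t => k * w₁ t) (k * w₂ t) t := fun t ht =>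
      (h₂ t ht).const_mul k
    have hkc : ContinuousOn (fun t => k * w₂ t) (Ioo (-α) α) := continuousOn_const.mul hc₂
    have hle : jacobiOp (hypMetric n) (catNormal n a) (fun q => k * w q.2) p ≤
        jacobiOp (hypMetric n) (catNormal n a) φ p := by
      rw [catNormal_eq]
      refine (isMinimalPoint_catF hn ha ⟨hsub hpΩ.1, hpΩ.2⟩).jacobiOp_le (w := fun t => k * w t)
        isOpen_Ioo (fun t ht => hsol.pos t (hsub ht)) hpΩ.1
        (fun t ht => hsol.differentiable t (hsub ht)) (fun t ht => hsol.ode t (hsub ht))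
        (hφC p hpΩ) ((contDiffOn_two_of_hasDerivAt isOpen_Ioo hkw₁ hkw₂ hkc).contDiffAt
          (isOpen_Ioo.mem_nhds hpΩ.1)) ?_ hφp
      filter_upwards [self_mem_nhdsWithin] with q hq
      have hq' : q.2 ∈ Icc (-α) α := Ioo_subset_Icc_self hq.1
      have h := hmax' q ⟨hq', hq.2⟩
      rwa [div_le_iff₀ (hpos _ hq')] at h
    -- The contact inequality gives J(k w) ≤ J φ = l k w at p, against the strict supersolution
    -- property.
    rw [jacobiOp_catNormal hn ha hα (w := fun t => k * w t) hkw₁ hkw₂ hkc hpΩ, hφJ p hpΩ, hφp] at hle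
    have hQ := one_le_profWeight (n - 1) a p.2
    have hs := hsup _ hpΩ.1
    rw [div_le_iff₀ (by linarith)] at hle
    nlinarith
  have h1 := key φ hφC hφc hφb hφJ p₀ hp₀
  have h2 := key (-φ) (fun p hp => (hφC p hp).neg) hφc.neg
    (fun p hp => by rw [Pi.neg_apply, hφb p hp, neg_zero]) (fun p hp => by
      have hp' := hp
      rw [catDomain_eq hn ha hα] at hp'
      have hJ := hφJ p hp
      rw [catNormal_eq] at hJ ⊢
      rw [(isMinimalPoint_catF hn ha ⟨hsub hp'.1, hp'.2⟩).jacobiOp_neg (hφC p hp'), hJ,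
        Pi.neg_apply]
      ring) p₀ hp₀
  rw [Pi.neg_apply] at h2
  exact hφ0 (by linarith)

end Catenoid

/-! ### Stability and the envelope -/

section Stability

variable {n : ℕ} {a : ℝ}

lemma profVar_abs (m a s : ℝ) : profVar m a |s| = profVar m a s := by
  rcases abs_choice s with h | h <;> rw [h]
  exact profVar_neg m a s

lemma abs_profInv (hn : 2 ≤ n) (ha : 0 < a) {t : ℝ} (ht : t ∈ catIoo n a) :
    |profInv (n - 1) a t| = profInv (n - 1) a |t| := by
  have hm := pos_of_two_le hn
  have h0 : (0 : ℝ) ∈ catIoo n a := by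
    have := profHeight_pos hm ha
    exact ⟨by linarith, this⟩
  have hnn : ∀ s ∈ catIoo n a, 0 ≤ s → 0 ≤ profInv (n - 1) a s := by
    intro s hs h
    rcases h.eq_or_lt with rfl | h
    · rw [profInv_zero hm ha]
    · have := profInv_lt_profInv hm ha h0 hs h
      rw [profInv_zero hm ha] at this
      exact this.le
  rcases le_total 0 t with h | h
  · rw [abs_of_nonneg h, abs_of_nonneg (hnn t ht h)]
  · have h1 := hnn (-t) (neg_mem_Ioo ht) (by linarith)
    rw [abs_of_nonpos h, ← abs_of_nonneg h1, profInv_neg hm ha ht, abs_neg]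

/-- By parity the field depends only on |t|; it decreases in |s|, and |s| increases with |t|. -/
lemma profVar_profInv_lt (hn : 2 ≤ n) (ha : 0 < a) {t t' : ℝ} (ht : t ∈ catIoo n a)
    (ht' : t' ∈ catIoo n a) (h : |t| < |t'|) :
    profVar (n - 1) a (profInv (n - 1) a t') < profVar (n - 1) a (profInv (n - 1) a t) := by
  have hm := pos_of_two_le hn
  have habs : ∀ s ∈ catIoo n a, |s| ∈ catIoo n a := fun s hs => by
    rcases abs_choice s with h | h <;> rw [h]
    · exact hs
    · exact neg_mem_Ioo hs
  rw [← profVar_abs _ _ (profInv _ _ t'), ← profVar_abs _ _ (profInv _ _ t), abs_profInv hn ha ht,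
    abs_profInv hn ha ht']
  refine profVar_strictAntiOn hm ha ?_ ?_ (profInv_lt_profInv hm ha (habs t ht) (habs t' ht') h)
  · rw [mem_Ici, ← abs_profInv hn ha ht]
    exact abs_nonneg _
  · rw [mem_Ici, ← abs_profInv hn ha ht']
    exact abs_nonneg _

lemma profVar_profInv_neg (hn : 2 ≤ n) (ha : 0 < a) {t : ℝ} (ht : t ∈ catIoo n a) :
    profVar (n - 1) a (profInv (n - 1) a (-t)) = profVar (n - 1) a (profInv (n - 1) a t) := by
  rw [profInv_neg (pos_of_two_le hn) ha ht, profVar_neg]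

lemma profVar_profInv_zero (hn : 2 ≤ n) (ha : 0 < a) :
    profVar (n - 1) a (profInv (n - 1) a 0) = 1 := by
  rw [profInv_zero (pos_of_two_le hn) ha, profVar_zero ha]

lemma profVarDeriv_zero (hn : 2 ≤ n) (ha : 0 < a) : profVarDeriv (n - 1) a 0 = 0 := by
  simp [profVarDeriv, profInv_zero (pos_of_two_le hn) ha, profTimeParam_zero]

/-- The positive zero of the variation Jacobi field. -/
lemma exists_sigma (hn : 2 ≤ n) (ha : 0 < a) : ∃ σ ∈ Ioo 0 (profHeight (n - 1) a),
    profVar (n - 1) a (profInv (n - 1) a σ) = 0 := by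
  have hm := pos_of_two_le hn
  obtain ⟨s, hs, h0⟩ := exists_profVar_zero hm ha
  refine ⟨profTime (n - 1) a s, ⟨?_, profTime_lt hm ha s⟩, ?_⟩
  · have := strictMono_profTime hm ha hs
    rwa [profTime_zero] at this
  · rw [profInv_profTime hm ha, h0]

lemma profVar_profInv_eq_zero_iff (hn : 2 ≤ n) (ha : 0 < a) {σ : ℝ}
    (hσ : σ ∈ Ioo 0 (profHeight (n - 1) a)) (h0 : profVar (n - 1) a (profInv (n - 1) a σ) = 0)
    {t : ℝ} (ht : t ∈ catIoo n a) :
    profVar (n - 1) a (profInv (n - 1) a t) = 0 ↔ t = -σ ∨ t = σ := by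
  have hσI := mem_catIoo_of_mem_Ioo hσ
  constructor
  · intro h
    rcases lt_trichotomy |t| |σ| with hlt | heq | hgt
    · have := profVar_profInv_lt hn ha ht hσI hlt
      linarith
    · exact (abs_eq_abs.1 heq).symm
    · have := profVar_profInv_lt hn ha hσI ht hgt
      linarith
  · rintro (rfl | rfl)
    · rw [profVar_profInv_neg hn ha hσI, h0]
    · exact h0

/-- Solutions of the family of linear equations along a catenary. -/
lemma exists_catenary_family (hn : 2 ≤ n) (ha : 0 < a) {α : ℝ}
    (hα : α ∈ Ioo 0 (profHeight (n - 1) a)) :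
    ∃ (u v R c : ℝ → ℝ → ℝ), (∀ l, u l 0 = 1) ∧ (∀ l, v l 0 = 0) ∧ (∀ l t, 0 < R l t) ∧
      (∀ l t, u l t = R l t * c l t) ∧ (Continuous fun l => c l α) ∧
      (∀ l, ∀ t ∈ Icc (-α) α, HasDerivAt (u l) (v l t) t ∧ HasDerivAt (v l)
        (-((profPot (n - 1) a t + l * profWeight (n - 1) a t) * u l t)) t) ∧
      (∀ l, ∀ t ∈ Icc (-α) α, u l (-t) = u l t) ∧
      ∀ t ∈ Icc (-α) α, u 0 t = profVar (n - 1) a (profInv (n - 1) a t) := by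
  have hm := pos_of_two_le hn
  -- A slightly larger interval still inside I_a, so that the derivatives at ±α are two-sided and
  -- the coefficients are bounded.
  obtain ⟨b, hαb, hb⟩ := exists_between hα.2
  have hb0 : 0 < b := hα.1.trans hαb
  have hbI : Icc (-b) b ⊆ catIoo n a := Icc_subset_catIoo ⟨hb0, hb⟩
  have hsub : Icc (-α) α ⊆ Ioo (-b) b := Icc_subset_Ioo (by linarith) hαb
  have hP := (continuousOn_profPot hn ha).mono hbI
  have hQ := (continuousOn_profWeight hn ha).mono hbI
  obtain ⟨u, v, R, c, hu, hv, hR, hRu, hc, hd⟩ := exists_linear_family hb0 hP hQ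
  have hbd : ∀ l : ℝ, ∃ C, ∀ t ∈ Ioo (-b) b,
      |profPot (n - 1) a t + l * profWeight (n - 1) a t| ≤ C := fun l => by
    obtain ⟨C, hC⟩ := isCompact_Icc.exists_bound_of_continuousOn
      (hP.add (continuousOn_const (c := l) |>.mul hQ))
    exact ⟨C, fun t ht => hC t (Ioo_subset_Icc_self ht)⟩
  refine ⟨u, v, R, c, hu, hv, hR, hRu, hc α ⟨hα.1, hαb⟩, fun l t ht => hd l t (hsub ht),
    fun l t ht => ?_, fun t ht => ?_⟩
  · obtain ⟨C, hC⟩ := hbd l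
    exact linear_even hb0 hC (fun s hs => by
      rw [profPot_neg hn ha (hbI (Ioo_subset_Icc_self hs)),
        profWeight_neg hn ha (hbI (Ioo_subset_Icc_self hs))]) (hv l) (hd l) t (hsub ht)
  · obtain ⟨C, hC⟩ := hbd 0
    refine linear_unique (u := u 0) (v := v 0) (v' := profVarDeriv (n - 1) a)
      (u' := fun t => profVar (n - 1) a (profInv (n - 1) a t))
      (q := fun t => profPot (n - 1) a t + 0 * profWeight (n - 1) a t) hb0 hC
      (by rw [hu, profVar_profInv_zero hn ha]) (by rw [hv, profVarDeriv_zero hn ha]) (hd 0)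
      (fun s hs => ?_) (hsub ht)
    have hs' := hbI (Ioo_subset_Icc_self hs)
    exact ⟨hasDerivAt_profVar_profInv hm ha hs', (hasDerivAt_profVarDeriv hm ha hs').congr_deriv
      (by ring)⟩

/-! ### The sign of the bottom of the Dirichlet spectrum -/

lemma hasDerivAt_catenary_jacobi (hn : 2 ≤ n) (ha : 0 < a) {t : ℝ} (ht : t ∈ catIoo n a) :
    HasDerivAt (fun t => profVar (n - 1) a (profInv (n - 1) a t)) (profVarDeriv (n - 1) a t) t ∧
      HasDerivAt (profVarDeriv (n - 1) a)
        (-(profPot (n - 1) a t * profVar (n - 1) a (profInv (n - 1) a t))) t :=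
  ⟨hasDerivAt_profVar_profInv (pos_of_two_le hn) ha ht,
    hasDerivAt_profVarDeriv (pos_of_two_le hn) ha ht⟩

lemma continuousOn_catenary_jacobi (hn : 2 ≤ n) (ha : 0 < a) :
    ContinuousOn (fun t => profVar (n - 1) a (profInv (n - 1) a t)) (catIoo n a) := fun _ ht =>
  (hasDerivAt_catenary_jacobi hn ha ht).1.continuousAt.continuousWithinAt

lemma zero_mem_dirichletEigenvalues (hn : 2 ≤ n) (ha : 0 < a) {σ : ℝ}
    (hσ : σ ∈ Ioo 0 (profHeight (n - 1) a)) (h0 : profVar (n - 1) a (profInv (n - 1) a σ) = 0) :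
    0 ∈ dirichletEigenvalues (hypMetric n) (catNormal n a) (catDomain n a (-σ) σ) := by
  have hsub := Icc_subset_catIoo hσ
  refine mem_dirichletEigenvalues hn ha hσ
    (fun t ht => (hasDerivAt_catenary_jacobi hn ha (hsub (Ioo_subset_Icc_self ht))).1)
    (fun t ht => (hasDerivAt_catenary_jacobi hn ha (hsub (Ioo_subset_Icc_self ht))).2.congr_deriv
      (by ring)) ((continuousOn_catenary_jacobi hn ha).mono hsub) ?_ h0 ?_
  · simp only [profVar_profInv_zero hn ha]
    exact one_ne_zero
  · simp only [profVar_profInv_neg hn ha (mem_catIoo_of_mem_Ioo hσ), h0]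

/-- For l < 0 the supersolution is the solution u with parameter l/2. It satisfies J u = (l/2) u > l
u. Its coefficient lies strictly below P, so Sturm comparison with the Jacobi field keeps it
positive up to σ, where the field itself vanishes. -/
lemma nonneg_of_mem_dirichletEigenvalues (hn : 2 ≤ n) (ha : 0 < a) {σ : ℝ}
    (hσ : σ ∈ Ioo 0 (profHeight (n - 1) a)) (h0 : profVar (n - 1) a (profInv (n - 1) a σ) = 0)
    {l : ℝ} (hl : l ∈ dirichletEigenvalues (hypMetric n) (catNormal n a) (catDomain n a (-σ) σ)) :
    0 ≤ l := by
  by_contra! hneg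
  have hσI := mem_catIoo_of_mem_Ioo hσ
  have hsub := Icc_subset_catIoo hσ
  obtain ⟨u, v, -, -, hu, hv, -, -, -, hd, heven, -⟩ := exists_catenary_family hn ha hσ
  have hsub0 : Icc 0 σ ⊆ Icc (-σ) σ := Icc_subset_Icc_left (by linarith [hσ.1])
  have hpos0 : ∀ t ∈ Icc 0 σ, 0 < u (l / 2) t := by
    refine sturm_pos (hu _) (hv _) (profVarDeriv_zero hn ha) (fun t ht => hd _ t (hsub0 ht))
      (fun t ht => hasDerivAt_catenary_jacobi hn ha (hsub (hsub0 ht))) (fun t _ => ?_)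
      fun t ht => ?_
    · have := one_le_profWeight (n - 1) a t
      nlinarith
    · rw [← h0]
      refine profVar_profInv_lt hn ha (hsub (hsub0 (Ico_subset_Icc_self ht))) hσI ?_
      rw [abs_of_nonneg ht.1, abs_of_pos hσ.1]
      exact ht.2
  have hpos : ∀ t ∈ Icc (-σ) σ, 0 < u (l / 2) t := by
    intro t ht
    rcases le_total 0 t with h | h
    · exact hpos0 t ⟨h, ht.2⟩
    · rw [← heven _ t ht]
      exact hpos0 (-t) ⟨by linarith, by linarith [ht.1]⟩
  have hc : ContinuousOn (u (l / 2)) (Icc (-σ) σ) := fun t ht =>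
    (hd _ t ht).1.continuousAt.continuousWithinAt
  refine notMem_dirichletEigenvalues hn ha hσ (fun t ht => (hd _ t (Ioo_subset_Icc_self ht)).1)
    (fun t ht => (hd (l / 2) t (Ioo_subset_Icc_self ht)).2) ?_ hc hpos (fun t ht => ?_) hl
  · have hss : Ioo (-σ) σ ⊆ catIoo n a := Ioo_subset_Icc_self.trans hsub
    exact ((((continuousOn_profPot hn ha).mono hss).add
      (continuousOn_const.mul ((continuousOn_profWeight hn ha).mono hss))).mul
      (hc.mono Ioo_subset_Icc_self)).neg
  · have h1 := one_le_profWeight (n - 1) a t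
    have h2 := hpos t (Ioo_subset_Icc_self ht)
    have h3 : 0 < profWeight (n - 1) a t * u (l / 2) t := mul_pos (by linarith) h2
    nlinarith

/-- For α < σ the Jacobi field e is positive on [-α, α], but J e = 0 is not strict. Subtracting ε t²
makes it so, because P ≥ 0. -/
lemma zero_notMem_dirichletEigenvalues (hn : 2 ≤ n) (ha : 0 < a) {σ α : ℝ}
    (hσ : σ ∈ Ioo 0 (profHeight (n - 1) a)) (h0 : profVar (n - 1) a (profInv (n - 1) a σ) = 0)
    (hα : α ∈ Ioo 0 (profHeight (n - 1) a)) (hασ : α < σ) :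
    0 ∉ dirichletEigenvalues (hypMetric n) (catNormal n a) (catDomain n a (-α) α) := by
  have hσI := mem_catIoo_of_mem_Ioo hσ
  have hαI := mem_catIoo_of_mem_Ioo hα
  have hsub := Icc_subset_catIoo hα
  set e : ℝ → ℝ := fun t => profVar (n - 1) a (profInv (n - 1) a t) with he
  have heα : 0 < e α := by
    rw [← h0]
    refine profVar_profInv_lt hn ha hαI hσI ?_
    rwa [abs_of_pos hα.1, abs_of_pos hσ.1]
  have hee : ∀ t ∈ Icc (-α) α, e α ≤ e t := by
    intro t ht
    have habs : |t| ≤ |α| := by rw [abs_of_pos hα.1]; exact abs_le.2 ht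
    rcases habs.lt_or_eq with h | h
    · exact (profVar_profInv_lt hn ha (hsub ht) hαI h).le
    · rcases abs_eq_abs.1 h with rfl | rfl
      · exact le_rfl
      · exact (profVar_profInv_neg hn ha hαI).ge
  -- Chosen so that ε t² is at most half of e α, the minimum of the field on [-α, α].
  set ε := e α / (2 * α ^ 2) with hε
  have hα2 : 0 < α ^ 2 := pow_pos hα.1 2
  have hα0 : α ≠ 0 := hα.1.ne'
  have hεα : ε * α ^ 2 = e α / 2 := by rw [hε]; field_simp
  have hpos : ∀ t ∈ Icc (-α) α, 0 < e t - ε * t ^ 2 := by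
    intro t ht
    have h1 := hee t ht
    have h2 : t ^ 2 ≤ α ^ 2 := sq_le_sq' ht.1 ht.2
    have h3 : ε * t ^ 2 ≤ ε * α ^ 2 := by gcongr
    linarith
  have hss : Ioo (-α) α ⊆ catIoo n a := Ioo_subset_Icc_self.trans hsub
  have hec := continuousOn_catenary_jacobi hn ha
  refine notMem_dirichletEigenvalues hn ha hα (w := fun t => e t - ε * t ^ 2)
    (w₁ := fun t => profVarDeriv (n - 1) a t - ε * (2 * t))
    (w₂ := fun t => -(profPot (n - 1) a t * e t) - ε * 2) (fun t ht => ?_) (fun t ht => ?_) ?_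
    ((hec.mono hsub).sub (by fun_prop)) hpos (fun t ht => ?_)
  · refine ((hasDerivAt_catenary_jacobi hn ha (hss ht)).1.sub
      ((hasDerivAt_pow 2 t).const_mul ε)).congr_deriv ?_
    simp
  · refine ((hasDerivAt_catenary_jacobi hn ha (hss ht)).2.sub
      (((hasDerivAt_id t).const_mul 2).const_mul ε)).congr_deriv ?_
    simp [he]
  · exact ((((continuousOn_profPot hn ha).mono hss).mul (hec.mono hss)).neg).sub
      continuousOn_const
  · have h1 := profPot_nonneg (pos_of_two_le hn) ha t
    have h2 : 0 ≤ profPot (n - 1) a t * (ε * t ^ 2) := by positivity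
    simp only [zero_mul, neg_zero]
    nlinarith

/-- Shooting in l: at l = 0 the even solution is the Jacobi field, negative at α > σ; for very
negative l it is positive at α. An intermediate l < 0 makes it vanish at ±α. Interior zeros are
harmless, since any negative eigenvalue suffices. -/
lemma exists_neg_mem_dirichletEigenvalues (hn : 2 ≤ n) (ha : 0 < a) {σ α : ℝ}
    (hσ : σ ∈ Ioo 0 (profHeight (n - 1) a)) (h0 : profVar (n - 1) a (profInv (n - 1) a σ) = 0)
    (hα : α ∈ Ioo 0 (profHeight (n - 1) a)) (hασ : σ < α) :
    ∃ l < 0, l ∈ dirichletEigenvalues (hypMetric n) (catNormal n a) (catDomain n a (-α) α) := by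
  have hσI := mem_catIoo_of_mem_Ioo hσ
  have hαI := mem_catIoo_of_mem_Ioo hα
  have hsub := Icc_subset_catIoo hα
  have hαα : α ∈ Icc (-α) α := ⟨by linarith [hα.1], le_rfl⟩
  obtain ⟨u, v, R, c, hu, hv, hR, hRu, hc, hd, heven, hu0⟩ := exists_catenary_family hn ha hα
  have hsub0 : Icc 0 α ⊆ Icc (-α) α := Icc_subset_Icc_left (by linarith [hα.1])
  have hc0 : c 0 α < 0 := by
    have h1 : u 0 α < 0 := by
      rw [hu0 α hαα, ← h0]
      refine profVar_profInv_lt hn ha hσI hαI ?_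
      rwa [abs_of_pos hα.1, abs_of_pos hσ.1]
    rw [hRu] at h1
    exact neg_of_mul_neg_right h1 (hR 0 α).le
  obtain ⟨C, hC⟩ := isCompact_Icc.exists_bound_of_continuousOn
    ((continuousOn_profPot hn ha).mono hsub)
  have hC0 : 0 ≤ C := (norm_nonneg _).trans (hC α hαα)
  -- With C a bound for P and with weight at least 1, the coefficient P - (C + 1)(1 + f_t²) is
  -- negative. Sturm comparison with the constant solution 1 of u'' = 0 gives positivity.
  have hc1 : 0 < c (-(C + 1)) α := by
    have h1 : 0 < u (-(C + 1)) α := by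
      refine sturm_pos (q₂ := fun _ => 0) (u₂ := fun _ => 1) (v₂ := fun _ => 0) (hu _) (hv _) rfl
        (fun t ht => hd _ t (hsub0 ht)) (fun t _ => ⟨hasDerivAt_const t 1, ?_⟩) (fun t ht => ?_)
        (fun _ _ => one_pos) α ⟨hα.1.le, le_rfl⟩
      · simpa using hasDerivAt_const t (0 : ℝ)
      · have h2 := one_le_profWeight (n - 1) a t
        have h3 := (le_abs_self _).trans (hC t (hsub0 ht))
        nlinarith
    rw [hRu] at h1
    exact pos_of_mul_pos_right h1 (hR _ α).le
  obtain ⟨l, hl, hl0⟩ := intermediate_value_Icc' (show -(C + 1) ≤ 0 by linarith)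
    hc.continuousOn (show (0 : ℝ) ∈ Icc (c 0 α) (c (-(C + 1)) α) from ⟨hc0.le, hc1.le⟩)
  simp only at hl0
  have hul : u l α = 0 := by rw [hRu, hl0, mul_zero]
  refine ⟨l, lt_of_le_of_ne hl.2 ?_, mem_dirichletEigenvalues hn ha hα
    (fun t ht => (hd l t (Ioo_subset_Icc_self ht)).1)
    (fun t ht => (hd l t (Ioo_subset_Icc_self ht)).2)
    (fun t ht => (hd l t ht).1.continuousAt.continuousWithinAt) ?_ hul ?_⟩
  · rintro rfl
    exact hc0.ne hl0
  · rw [hu]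
    exact one_ne_zero
  · rw [heven l α hαα, hul]

lemma isStableUnstable_catDomain_iff (hn : 2 ≤ n) (ha : 0 < a) {σ α : ℝ}
    (hσ : σ ∈ Ioo 0 (profHeight (n - 1) a)) (h0 : profVar (n - 1) a (profInv (n - 1) a σ) = 0)
    (hα : α ∈ Ioo 0 (profHeight (n - 1) a)) :
    IsStableUnstable (hypMetric n) (catenoid n a) (catNormal n a) (catDomain n a (-α) α) ↔
      α = σ := by
  constructor
  · rintro ⟨-, -, -, hmem, hlb⟩
    rcases lt_trichotomy α σ with h | h | h
    · exact absurd hmem (zero_notMem_dirichletEigenvalues hn ha hσ h0 hα h)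
    · exact h
    · obtain ⟨l, hl, hl'⟩ := exists_neg_mem_dirichletEigenvalues hn ha hσ h0 hα h
      exact absurd (hlb hl') (not_le.2 hl)
  · rintro rfl
    have hsub := Icc_subset_catIoo hα
    have hcl : closure (catDomain n a (-α) α) = revSurface n (Icc (-α) α) (catF n a) := by
      rw [catDomain_eq hn ha hα, closure_revSurface_Ioo hn ha hα]
    have hclM : closure (catDomain n a (-α) α) ⊆ catenoid n a := by
      rw [hcl, catenoid_eq hn ha]
      exact fun p hp => ⟨hsub hp.1, hp.2⟩
    refine ⟨subset_closure.trans hclM, ?_, hclM, zero_mem_dirichletEigenvalues hn ha hα h0,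
      fun l hl => nonneg_of_mem_dirichletEigenvalues hn ha hα h0 hl⟩
    rw [hcl]
    exact isCompact_revSurface_Icc hn ha hα

lemma envelopeContact_eq (hn : 2 ≤ n) (ha : 0 < a) {σ : ℝ}
    (hσ : σ ∈ Ioo 0 (profHeight (n - 1) a)) (h0 : profVar (n - 1) a (profInv (n - 1) a σ) = 0) :
    envelopeContact n a = catSphere n a (-σ) ∪ catSphere n a σ := by
  have hσI := mem_catIoo_of_mem_Ioo hσ
  ext p
  rw [envelopeContact, catInterval_eq hn ha]
  constructor
  · rintro ⟨t, ht, hdet, h⟩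
    rw [envelopeDet_eq hn ha ht, profVar_profInv_eq_zero_iff hn ha hσ h0 ht] at hdet
    rcases hdet with rfl | rfl
    · exact Or.inl h
    · exact Or.inr h
  · rintro (h | h)
    · exact ⟨-σ, neg_mem_Ioo hσI, by
        rw [envelopeDet_eq hn ha (neg_mem_Ioo hσI),
          profVar_profInv_eq_zero_iff hn ha hσ h0 (neg_mem_Ioo hσI)]
        exact Or.inl rfl, h⟩
    · exact ⟨σ, hσI, by rw [envelopeDet_eq hn ha hσI, h0], h⟩

end Stability

end

theorem corollary3p5 (n : ℕ) (hn : 2 ≤ n) (a : ℝ) (ha : 0 < a) :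
    IsMaximalCatenarySolution n a (catInterval n a) (catF n a) ∧
    (∀ t ∈ catInterval n a, DifferentiableAt ℝ (fun b => catF n b t) a) ∧
    IsUnitNormal (hypMetric n) (catenoid n a) (catNormal n a) ∧
    ∃ T : ℝ, 0 < T ∧ catInterval n a = Set.Ioo (-T) T ∧
      ∃ σ ∈ Set.Ioo 0 T,
        -- `D_a(-σ, σ)` is the stable-unstable domain
        (∀ α ∈ Set.Ioo 0 T,
          IsStableUnstable (hypMetric n) (catenoid n a) (catNormal n a) (catDomain n a (-α) α) ↔
            α = σ) ∧
        -- it is bounded by two spheres, and these make up the contact set with the envelope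
        bdry (catDomain n a (-σ) σ) = catSphere n a (-σ) ∪ catSphere n a σ ∧
        envelopeContact n a = catSphere n a (-σ) ∪ catSphere n a σ ∧
        -- among the symmetric domains it is the only one bounded by the contact set
        (∀ α ∈ Set.Ioo 0 T, bdry (catDomain n a (-α) α) = envelopeContact n a ↔ α = σ) ∧
        -- `±σ` are the zeros of the variation Jacobi field
        (∀ t ∈ Set.Ioo (-T) T, ∀ ξ : EuclideanSpace ℝ (Fin n), ‖ξ‖ = 1 →
          (variationField n a t ξ = 0 ↔ t = -σ ∨ t = σ)) := by
  obtain ⟨σ, hσ, h0⟩ := exists_sigma hn ha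
  refine ⟨isMaximalCatenarySolution_catF hn ha, fun t ht => ?_, isUnitNormal_catNormal hn ha,
    profHeight (n - 1) a, profHeight_pos (pos_of_two_le hn) ha, catInterval_eq hn ha, σ, hσ,
    fun α hα => isStableUnstable_catDomain_iff hn ha hσ h0 hα, bdry_catDomain hn ha hσ,
    envelopeContact_eq hn ha hσ h0, fun α hα => ⟨fun h => ?_, ?_⟩, fun t ht ξ hξ => ?_⟩
  · rw [catInterval_eq hn ha] at ht
    exact (hasDerivAt_catF_param hn ha ht).differentiableAt
  · rw [bdry_catDomain hn ha hα, envelopeContact_eq hn ha hσ h0] at h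
    -- A point of the sphere at height α lies on one of the spheres at ±σ, and positivity of α and σ
    -- excludes -σ.
    obtain ⟨p, hp⟩ := catSphere_nonempty (a := a) hn α
    have hp' : p ∈ catSphere n a (-σ) ∪ catSphere n a σ := h ▸ Or.inr hp
    have hσI := mem_catIoo_of_mem_Ioo hσ
    rw [Set.mem_union, mem_catSphere_iff hn ha (neg_mem_Ioo hσI), mem_catSphere_iff hn ha hσI] at hp'
    have h1 := ((mem_catSphere_iff hn ha (mem_catIoo_of_mem_Ioo hα) p).1 hp).1
    rcases hp' with h2 | h2
    · linarith [h2.1, hσ.1, hα.1]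
    · rw [← h1, h2.1]
  · rintro rfl
    rw [bdry_catDomain hn ha hα, envelopeContact_eq hn ha hα h0]
  · rw [variationField_eq hn ha ht hξ, neg_eq_zero, profVar_profInv_eq_zero_iff hn ha hσ h0 ht]
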